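/- **Setting.** Let $\Phi$ be a reduced crystallographic root system (possibly reducible or empty) and let $V$ be the real vector space spanned by its coroots. Let $W_{\mathrm{aff}}$ be the affine Weyl group of $\Phi$, i.e. the group of affine transformations of $V$ generated by the reflections in the hyperplanes $H_{\alpha,k}=\{v\in V:\langle\alpha,v\rangle=k\}$, $\alpha\in\Phi$, $k\in\mathbb Z$. Fix a base alcove $\mathfrak a$ (a connected component of the complement of all these hyperplanes). Let $\tilde{\mathbb S}\subset W_{\mathrm{aff}}$ be the set of reflections in the walls of $\mathfrak a$, and for $x\in W_{\mathrm{aff}}$ let $\ell(x)$ be the number of hyperplanes $H_{\alpha,k}$ separating $\mathfrak a$ from $x\mathfrak a$. Let $\Omega$ be a group acting on $W_{\mathrm{aff}}$ by group automorphisms that stabilize $\tilde{\mathbb S}$, let $\tilde W=W_{\mathrm{aff}}\rtimes\Omega$, and extend the length to $\tilde W$ by $\ell(x\tau)=\ell(x)$ for $x\in W_{\mathrm{aff}}$, $\tau\in\Omega$. Let $\sigma$ be a group automorphism of $\tilde W$ that preserves $\ell$ and $\tilde{\mathbb S}$. (The Iwahori–Weyl group of a connected reductive group over a non-archimedean local field,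 with its Frobenius action, is of this form.) **Minimal length elements.** The $\sigma$-conjugacy class of $w\in\tilde W$ is $\{xw\sigma(x)^{-1}:x\in\tilde W\}$. Let $\tilde W_{\sigma,\min}$ be the set of elements of $\tilde W$ that have minimal length in their $\sigma$-conjugacy class. Write $w\to_\sigma w'$ if there is a finite sequence $w=w_1,w_2,\dots,w_n=w'$ ($n\ge 1$) such that for each $2\le k\le n$ one has $w_k=s_kw_{k-1}\sigma(s_k)$ for some $s_k\in\tilde{\mathbb S}$ and $\ell(w_k)\le\ell(w_{k-1})$. Write $w\approx_\sigma w'$ if $w\to_\sigma w'$ and $w'\to_\sigma w$, and $w\,\tilde\approx_\sigma\,w'$ if $w\approx_\sigma\tau w'\sigma(\tau)^{-1}$ for some $\tau\in\Omega$. Let $\tilde W_{\sigma,\min}/\tilde\approx_\sigma$ be the set of $\tilde\approx_\sigma$-equivalence classes in $\tilde W_{\sigma,\min}$. **$0$-Hecke algebra.** Let $H_0$ be the unital associative $\mathbb C$-algebra generated by $\{t_w:w\in\tilde W\}$ subject to the relations $t_1=1$, $t_wt_{w'}=t_{ww'}$ whenever $\ell(ww')=\ell(w)+\ell(w')$, and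 $t_s^2=-t_s$ for $s\in\tilde{\mathbb S}$. Let $\sigma$ also denote the algebra homomorphism $t_w\mapsto t_{\sigma(w)}$ of $H_0$, let $[H_0,H_0]_\sigma$ be the $\mathbb C$-linear span of all $hh'-h'\sigma(h)$ with $h,h'\in H_0$, and let $\bar H_{0,\sigma}=H_0/[H_0,H_0]_\sigma$ be the $\sigma$-cocenter. **Proposition.** For every $\Sigma\in\tilde W_{\sigma,\min}/\tilde\approx_\sigma$, the image of $t_w$ in $\bar H_{0,\sigma}$ is the same for all $w\in\Sigma$; denote it by $t_\Sigma$. Moreover: (1) The family $\{t_\Sigma\}$, indexed by $\Sigma\in\tilde W_{\sigma,\min}/\tilde\approx_\sigma$, is a $\mathbb C$-basis of $\bar H_{0,\sigma}$. (2) For every $w\in\tilde W$ there is a unique $\Sigma_w\in\tilde W_{\sigma,\min}/\tilde\approx_\sigma$ such that the image of $t_w$ in $\bar H_{0,\sigma}$ equals $t_{\Sigma_w}$ or $-t_{\Sigma_w}$. -/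

import Mathlib

/-! ### The affine Weyl group of a root system, its alcoves, and Iwahori–Weyl groups -/

noncomputable section

namespace IwahoriWeyl

section Affine

variable {ι M N : Type*} [AddCommGroup M] [Module ℝ M] [AddCommGroup N] [Module ℝ N]

/-- The affine hyperplane `{v | ⟨α_i, v⟩ = k}` of the coweight space `N` (the apartment). -/
def hyperplane (P : RootPairing ι ℝ M N) (i : ι) (k : ℤ) : Set N :=
  {v | P.root' i v = k}

/-- The affine reflection `v ↦ v - (⟨α_i, v⟩ - k) α_i^∨` in the hyperplane `⟨α_i, v⟩ = k`. -/
def affineReflection (P : RootPairing ι ℝ M N) (i : ι) (k : ℤ) : N ≃ᵃ[ℝ] N :=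
  (P.coreflection i).toAffineEquiv.trans (AffineEquiv.constVAdd ℝ N ((k : ℝ) • P.coroot i))

theorem affineReflection_apply (P : RootPairing ι ℝ M N) (i : ι) (k : ℤ) (v : N) :
    affineReflection P i k v = v - (P.root' i v - k) • P.coroot i := by
  simp only [affineReflection, AffineEquiv.trans_apply, LinearEquiv.coe_toAffineEquiv,
    AffineEquiv.constVAdd_apply, vadd_eq_add, RootPairing.coreflection_apply, sub_smul]
  abel

/-- The affine Weyl group `W_aff`, generated by all the reflections in the hyperplanes
`⟨α, v⟩ = k`, with `α` a root and `k` an integer. -/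
def affineWeylGroup (P : RootPairing ι ℝ M N) : Subgroup (N ≃ᵃ[ℝ] N) :=
  Subgroup.closure {g | ∃ i k, g = affineReflection P i k}

/-- A point is regular if it lies on none of the hyperplanes, i.e. if it lies in an alcove.
A regular point `x₀` stands for the unique alcove that contains it (the base alcove). -/
def IsRegularPoint (P : RootPairing ι ℝ M N) (x₀ : N) : Prop :=
  ∀ (i : ι) (k : ℤ), x₀ ∉ hyperplane P i k

/-- The set of the hyperplanes that strictly separate two points. -/
def separatingHyperplanes (P : RootPairing ι ℝ M N) (x y : N) : Set (Set N) :=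
  {H | ∃ (i : ι) (k : ℤ), H = hyperplane P i k ∧ (P.root' i x - k) * (P.root' i y - k) < 0}

/-- The length of `w ∈ W_aff`: the number of hyperplanes between the base alcove (that of `x₀`)
and its image under `w`. -/
def affineLength (P : RootPairing ι ℝ M N) (x₀ : N) (w : affineWeylGroup P) : ℕ :=
  (separatingHyperplanes P x₀ ((w : N ≃ᵃ[ℝ] N) x₀)).ncard

/-- The hyperplane `⟨α_i, v⟩ = k` is a wall of the base alcove: it has a point which, for every
other hyperplane, lies strictly on the same side as the base alcove. -/
def IsWall (P : RootPairing ι ℝ M N) (x₀ : N) (i : ι) (k : ℤ) : Prop :=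
  ∃ p ∈ hyperplane P i k, ∀ (j : ι) (m : ℤ), hyperplane P j m ≠ hyperplane P i k →
    0 < (P.root' j p - m) * (P.root' j x₀ - m)

/-- The simple reflections of `W_aff`: the reflections in the walls of the base alcove. -/
def affineSimpleReflections (P : RootPairing ι ℝ M N) (x₀ : N) : Set (affineWeylGroup P) :=
  {s | ∃ i k, IsWall P x₀ i k ∧ (s : N ≃ᵃ[ℝ] N) = affineReflection P i k}

variable {Ω : Type*} [Group Ω]

/-- The length function of the Iwahori–Weyl group `W_aff ⋊ Ω`: `ℓ(xτ) = ℓ(x)`. -/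
def length (P : RootPairing ι ℝ M N) (x₀ : N) (φ : Ω →* MulAut (affineWeylGroup P))
    (w : affineWeylGroup P ⋊[φ] Ω) : ℕ :=
  affineLength P x₀ w.left

/-- The simple reflections of `W_aff`, as elements of the Iwahori–Weyl group `W_aff ⋊ Ω`. -/
def simpleReflections (P : RootPairing ι ℝ M N) (x₀ : N) (φ : Ω →* MulAut (affineWeylGroup P)) :
    Set (affineWeylGroup P ⋊[φ] Ω) :=
  SemidirectProduct.inl '' affineSimpleReflections P x₀

/-- The copy of `Ω` in the Iwahori–Weyl group `W_aff ⋊ Ω`. -/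
def lengthZeroSubgroup {P : RootPairing ι ℝ M N} (φ : Ω →* MulAut (affineWeylGroup P)) :
    Subgroup (affineWeylGroup P ⋊[φ] Ω) :=
  (SemidirectProduct.inr : Ω →* affineWeylGroup P ⋊[φ] Ω).range

end Affine

/-! ### Twisted conjugation and minimal length elements

Here `W` is a group with a length function `ℓ`, a set `S` of simple reflections, a subgroup `Om`
(of length-zero elements) and an automorphism `σ`. -/

section Conjugation

variable {W : Type*} [Group W]

/-- The automorphism `σ` respects the length function and the set of simple reflections. -/
structure IsCompatible (ℓ : W → ℕ) (S : Set W) (σ : W ≃* W) : Prop where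
  length_eq : ∀ w, ℓ (σ w) = ℓ w
  mem_iff : ∀ w, σ w ∈ S ↔ w ∈ S

/-- `w →_σ w'`: a finite (possibly empty) chain of steps `v ↦ s v σ(s)`, with `s ∈ S`, none of
which increases the length. -/
def Arrow (ℓ : W → ℕ) (S : Set W) (σ : W ≃* W) : W → W → Prop :=
  Relation.ReflTransGen fun v v' => ∃ s ∈ S, v' = s * v * σ s ∧ ℓ v' ≤ ℓ v

/-- `w ≈_σ w'`. -/
def Approx (ℓ : W → ℕ) (S : Set W) (σ : W ≃* W) (w w' : W) : Prop :=
  Arrow ℓ S σ w w' ∧ Arrow ℓ S σ w' w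

/-- `w ≈̃_σ w'`: `w ≈_σ τ w' σ(τ)⁻¹` for some `τ` in `Om`. -/
def TildeApprox (ℓ : W → ℕ) (S : Set W) (Om : Subgroup W) (σ : W ≃* W) (w w' : W) : Prop :=
  ∃ τ ∈ Om, Approx ℓ S σ w (τ * w' * (σ τ)⁻¹)

/-- `w` has minimal length in its `σ`-conjugacy class. -/
def IsMinLength (ℓ : W → ℕ) (σ : W ≃* W) (w : W) : Prop :=
  ∀ x : W, ℓ w ≤ ℓ (x * w * (σ x)⁻¹)

/-- The set of `≈̃_σ`-classes of the elements of minimal length in their `σ`-conjugacy class;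
a class is given as a subset of `W`. -/
def MinClass (ℓ : W → ℕ) (S : Set W) (Om : Subgroup W) (σ : W ≃* W) : Type _ :=
  {C : Set W // ∃ w, IsMinLength ℓ σ w ∧ C = {w' | TildeApprox ℓ S Om σ w' w}}

end Conjugation

/-! ### The `0`-Hecke algebra and its `σ`-cocenter -/

section Hecke

variable {W : Type*} [Group W]

/-- The defining relations of the `0`-Hecke algebra, on the free unital algebra on symbols
`t_w`, with `w ∈ W`. -/
inductive HeckeRel (ℓ : W → ℕ) (S : Set W) : FreeAlgebra ℂ W → FreeAlgebra ℂ W → Prop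
  | one : HeckeRel ℓ S (FreeAlgebra.ι ℂ 1) 1
  | mul (w w' : W) (h : ℓ (w * w') = ℓ w + ℓ w') :
      HeckeRel ℓ S (FreeAlgebra.ι ℂ w * FreeAlgebra.ι ℂ w') (FreeAlgebra.ι ℂ (w * w'))
  | sq (s : W) (hs : s ∈ S) :
      HeckeRel ℓ S (FreeAlgebra.ι ℂ s * FreeAlgebra.ι ℂ s) (-FreeAlgebra.ι ℂ s)

/-- The `0`-Hecke algebra `H_0`. -/
abbrev ZeroHecke (ℓ : W → ℕ) (S : Set W) : Type _ := RingQuot (HeckeRel ℓ S)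

/-- The generator `t_w` of `H_0`. -/
def t (ℓ : W → ℕ) (S : Set W) (w : W) : ZeroHecke ℓ S :=
  RingQuot.mkAlgHom ℂ (HeckeRel ℓ S) (FreeAlgebra.ι ℂ w)

theorem t_one (ℓ : W → ℕ) (S : Set W) : t ℓ S 1 = 1 := by
  rw [t, RingQuot.mkAlgHom_rel ℂ (HeckeRel.one (ℓ := ℓ) (S := S)), map_one]

theorem t_mul (ℓ : W → ℕ) (S : Set W) {w w' : W} (h : ℓ (w * w') = ℓ w + ℓ w') :
    t ℓ S w * t ℓ S w' = t ℓ S (w * w') := by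
  rw [t, t, t, ← map_mul, RingQuot.mkAlgHom_rel ℂ (HeckeRel.mul (S := S) w w' h)]

theorem t_sq (ℓ : W → ℕ) (S : Set W) {s : W} (hs : s ∈ S) :
    t ℓ S s * t ℓ S s = -t ℓ S s := by
  rw [t, ← map_mul, RingQuot.mkAlgHom_rel ℂ (HeckeRel.sq (ℓ := ℓ) s hs), map_neg]

/-- The algebra endomorphism `t_w ↦ t_{σ(w)}` of `H_0` induced by `σ`. -/
def heckeMap {ℓ : W → ℕ} {S : Set W} {σ : W ≃* W} (hσ : IsCompatible ℓ S σ) :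
    ZeroHecke ℓ S →ₐ[ℂ] ZeroHecke ℓ S :=
  RingQuot.liftAlgHom ℂ ⟨FreeAlgebra.lift ℂ fun w => t ℓ S (σ w), by
    intro a b hab
    induction hab with
    | one => simp [t_one]
    | mul w w' h =>
      rw [map_mul, FreeAlgebra.lift_ι_apply, FreeAlgebra.lift_ι_apply, FreeAlgebra.lift_ι_apply,
        map_mul σ, t_mul]
      rw [← map_mul, hσ.length_eq, hσ.length_eq, hσ.length_eq, h]
    | sq s hs =>
      rw [map_mul, map_neg, FreeAlgebra.lift_ι_apply, t_sq ℓ S ((hσ.mem_iff s).2 hs)]⟩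

theorem heckeMap_t {ℓ : W → ℕ} {S : Set W} {σ : W ≃* W} (hσ : IsCompatible ℓ S σ) (w : W) :
    heckeMap hσ (t ℓ S w) = t ℓ S (σ w) := by
  simp [heckeMap, t]

/-- The `σ`-commutator `[H_0, H_0]_σ`: the span of all `h h' - h' σ(h)`. -/
def commutator {ℓ : W → ℕ} {S : Set W} {σ : W ≃* W} (hσ : IsCompatible ℓ S σ) :
    Submodule ℂ (ZeroHecke ℓ S) :=
  Submodule.span ℂ {c | ∃ h h' : ZeroHecke ℓ S, c = h * h' - h' * heckeMap hσ h}

/-- The `σ`-cocenter `H_0 / [H_0, H_0]_σ`. -/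
abbrev Cocenter {ℓ : W → ℕ} {S : Set W} {σ : W ≃* W} (hσ : IsCompatible ℓ S σ) : Type _ :=
  ZeroHecke ℓ S ⧸ commutator hσ

/-- The image of `t_w` in the `σ`-cocenter. -/
def tBar {ℓ : W → ℕ} {S : Set W} {σ : W ≃* W} (hσ : IsCompatible ℓ S σ) (w : W) : Cocenter hσ :=
  (commutator hσ).mkQ (t ℓ S w)

end Hecke

end IwahoriWeyl

end

/-! The proof combines a spanning argument, a trace that separates the classes, and a geometric
theorem on reduction to minimal length.

Spanning. A shift `w ↦ s w σ(s)` that keeps the length does not change the image of `t_w`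
(`tBar_shift`). If the shift lowers the length, then `t_w = t_s t_{sw} ≡ t_{sw} t_{σ(s)} = -t_{sw}`,
which replaces `w` by a shorter element up to sign (`tBar_descent`). By induction on the length
every `t_w` becomes, up to sign, some `t_v` with `v` of minimal length in its class, provided that
nonincreasing shifts always lead to minimal length.

Independence. Lower Bruhat sets multiply along reduced products (`lowerSet_mul`) and `{1, s}` is
idempotent, so `w ↦ (-1)^ℓ(w) [lower set of w]` respects the `0`-Hecke relations in the algebra of
the monoid of subsets. Sending a subset to the set of classes of its minimal length elements turns
this representation into a `σ`-trace (`heckeTrace_mul_comm`). The trace of `t_w` is a signed basis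
vector, and for minimal `w` a comparison of lengths recovers the class of `w` from it
(`tildeApprox_of_minClassesIn_eq`).

Reduction to minimal length (`exists_arrow_isMinLength`). For `w = uτ`, the automorphism `δ = τσ` of
the affine Weyl group is induced by an affine map `d` that preserves the arrangement and the base
alcove (`exists_realization`). With `g = u d`, twice the length of the twisted conjugate by `y` is
the displacement `alcoveDist` between the alcove of `y⁻¹ x₀` and its image under `g`, and cyclic
shifts are wall crossings. The map `g` is an isometry. Let a generic point of an alcove flow down
the gradient of `‖g v - v‖²`. The flow line meets one hyperplane at a time, and where a crossing
would increase the displacement of the alcove the flow points back from the wall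
(`IsOnlyHyperplane.displacement_pos`). Hence nonincreasing crossings follow the flow line
(`exists_descends_of_curve`). At late times the displacement is the rate at which the iterates of
`g` cross hyperplanes, computed root by root, and this rate does not depend on the starting point
(`exists_alcoveDist_eventually_eq`). A value to which every alcove descends is the minimum. -/

namespace IwahoriWeyl

/-! ### Groups with a length function and the Bruhat order -/

/-- A group with a length function `ℓ`, simple reflections `S` and reflections `R`, subject to the
properties of (extended) Coxeter groups on which the theory of the Bruhat order rests. -/
structure IsReflectionLength {W : Type*} [Group W] (ℓ : W → ℕ) (S R : Set W) : Prop where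
  length_one : ℓ 1 = 0
  length_inv : ∀ w, ℓ w⁻¹ = ℓ w
  length_mul_of_eq_zero : ∀ τ w, ℓ τ = 0 → ℓ (τ * w) = ℓ w
  sq : ∀ s ∈ S, s * s = 1
  simple_mul : ∀ s ∈ S, ∀ w, ℓ (s * w) = ℓ w + 1 ∨ ℓ w = ℓ (s * w) + 1
  exists_descent : ∀ w, ℓ w ≠ 0 → ∃ s ∈ S, ℓ (s * w) < ℓ w
  simple_conj : ∀ τ, ℓ τ = 0 → ∀ s ∈ S, τ * s * τ⁻¹ ∈ S
  simple_subset : S ⊆ R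
  inv_mem : ∀ r ∈ R, r⁻¹ ∈ R
  conj_mem : ∀ r ∈ R, ∀ w, w * r * w⁻¹ ∈ R
  lift : ∀ r ∈ R, ∀ s ∈ S, r ≠ s → ∀ x, ℓ x < ℓ (r * x) → ℓ (s * x) < ℓ (s * r * x)

/-- The Bruhat order. -/
def BruhatLE {W : Type*} [Group W] (ℓ : W → ℕ) (R : Set W) : W → W → Prop :=
  Relation.ReflTransGen fun x y => ∃ r ∈ R, y = r * x ∧ ℓ x < ℓ y

/-- The elements below `w` in the Bruhat order. -/
def lowerSet {W : Type*} [Group W] (ℓ : W → ℕ) (R : Set W) (w : W) : Set W :=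
  {x | BruhatLE ℓ R x w}

namespace IsReflectionLength

variable {W : Type*} [Group W] {ℓ : W → ℕ} {S R : Set W}

section

variable (h : IsReflectionLength ℓ S R)
include h

theorem length_mul_of_eq_zero_right {τ w : W} (hτ : ℓ τ = 0) : ℓ (w * τ) = ℓ w := by
  rw [← h.length_inv (w * τ), mul_inv_rev, h.length_mul_of_eq_zero _ _ (by rw [h.length_inv, hτ]),
    h.length_inv]

theorem inv_simple {s : W} (hs : s ∈ S) : s⁻¹ = s :=
  inv_eq_of_mul_eq_one_left (h.sq s hs)

theorem simple_mul_cancel {s : W} (hs : s ∈ S) (w : W) : s * (s * w) = w := by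
  rw [← mul_assoc, h.sq s hs, one_mul]

theorem mul_simple_cancel {s : W} (hs : s ∈ S) (w : W) : w * s * s = w := by
  rw [mul_assoc, h.sq s hs, mul_one]

theorem length_simple {s : W} (hs : s ∈ S) : ℓ s = 1 := by
  have := h.simple_mul s hs 1
  rw [mul_one, h.length_one] at this
  omega

theorem mul_simple {s : W} (hs : s ∈ S) (w : W) :
    ℓ (w * s) = ℓ w + 1 ∨ ℓ w = ℓ (w * s) + 1 := by
  have := h.simple_mul s hs w⁻¹
  rwa [h.length_inv, ← h.length_inv (s * w⁻¹), mul_inv_rev, inv_inv, h.inv_simple hs] at this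

theorem length_mul_le (x y : W) : ℓ (x * y) ≤ ℓ x + ℓ y := by
  induction hn : ℓ x generalizing x with
  | zero => rw [h.length_mul_of_eq_zero _ _ hn]; omega
  | succ n ih =>
    obtain ⟨s, hs, hlt⟩ := h.exists_descent x (by omega)
    have h1 := h.simple_mul s hs x
    have h2 := ih (s * x) (by omega)
    have h3 := h.simple_mul s hs (x * y)
    rw [mul_assoc] at h2
    omega

theorem length_conj_of_eq_zero {τ : W} (hτ : ℓ τ = 0) (w : W) {τ' : W} (hτ' : ℓ τ' = 0) :
    ℓ (τ * w * τ'⁻¹) = ℓ w := by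
  rw [h.length_mul_of_eq_zero_right (by rw [h.length_inv, hτ']), h.length_mul_of_eq_zero _ _ hτ]

/-- Induction over the group: length-zero elements, and multiplication by a simple reflection that
increases the length. -/
theorem simple_induction {p : W → Prop} (h0 : ∀ τ, ℓ τ = 0 → p τ)
    (hs : ∀ s ∈ S, ∀ v, ℓ (s * v) = ℓ v + 1 → p v → p (s * v)) (w : W) : p w := by
  induction hn : ℓ w generalizing w with
  | zero => exact h0 w hn
  | succ n ih =>
    obtain ⟨s, hsS, hlt⟩ := h.exists_descent w (by omega)
    have h1 := h.simple_mul s hsS w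
    have := hs s hsS (s * w) (by rw [h.simple_mul_cancel hsS]; omega) (ih (s * w) (by omega))
    rwa [h.simple_mul_cancel hsS] at this

/-- The lifting axiom as a statement on edges: left multiplication by `s` preserves every Bruhat
edge except those labelled by `s`, which it reverses. -/
theorem edge_simple {r s x : W} (hr : r ∈ R) (hs : s ∈ S) (hrs : r ≠ s) (hl : ℓ x < ℓ (r * x)) :
    ∃ r' ∈ R, s * (r * x) = r' * (s * x) ∧ ℓ (s * x) < ℓ (s * (r * x)) := by
  refine ⟨s * r * s⁻¹, h.conj_mem r hr s, by group, ?_⟩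
  rw [← mul_assoc]
  exact h.lift r hr s hs hrs x hl

/-- The chain is multiplied by `s` edge by edge. At an edge labelled `s` the translated chain
already ends at the upper vertex of the original edge. -/
theorem simple_mul_le_or {x w s : W} (hs : s ∈ S) (hx : BruhatLE ℓ R x w) :
    BruhatLE ℓ R (s * x) w ∨ BruhatLE ℓ R (s * x) (s * w) := by
  induction hx with
  | refl => exact Or.inr .refl
  | @tail b c _ hbc ih =>
    rcases ih with ih | ih
    · exact Or.inl (ih.tail hbc)
    · obtain ⟨r, hr, rfl, hl⟩ := hbc
      by_cases hrs : r = s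
      · subst hrs; exact Or.inl ih
      · exact Or.inr (ih.tail (h.edge_simple hr hs hrs hl))

theorem le_simple_mul_or {x w s : W} (hs : s ∈ S) (hx : BruhatLE ℓ R x w) :
    BruhatLE ℓ R x (s * w) ∨ BruhatLE ℓ R (s * x) (s * w) := by
  induction hx with
  | refl => exact Or.inr .refl
  | @tail b c hxb hbc ih =>
    obtain ⟨r, hr, rfl, hl⟩ := hbc
    by_cases hrs : r = s
    · subst hrs
      rw [h.simple_mul_cancel hs]
      exact Or.inl hxb
    · have := h.edge_simple hr hs hrs hl
      exact ih.imp (fun k => k.tail this) fun k => k.tail this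

theorem le_simple_mul {s w : W} (hs : s ∈ S) (hw : ℓ w < ℓ (s * w)) : BruhatLE ℓ R w (s * w) :=
  .single ⟨s, h.simple_subset hs, rfl, hw⟩

theorem simple_mul_le {s w : W} (hs : s ∈ S) (hw : ℓ (s * w) < ℓ w) : BruhatLE ℓ R (s * w) w := by
  have := h.le_simple_mul hs (w := s * w) (by rwa [h.simple_mul_cancel hs])
  rwa [h.simple_mul_cancel hs] at this

theorem simple_mul_mem_lowerSet {x w s : W} (hs : s ∈ S) (hw : ℓ (s * w) < ℓ w)
    (hx : BruhatLE ℓ R x w) : BruhatLE ℓ R (s * x) w :=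
  (h.simple_mul_le_or hs hx).elim id fun k => k.trans (h.simple_mul_le hs hw)

theorem bruhatLE_inv {x w : W} (hx : BruhatLE ℓ R x w) : BruhatLE ℓ R x⁻¹ w⁻¹ := by
  induction hx with
  | refl => exact .refl
  | @tail b c _ hbc ih =>
    obtain ⟨r, hr, rfl, hl⟩ := hbc
    refine ih.tail ⟨b⁻¹ * r⁻¹ * b⁻¹⁻¹, h.conj_mem _ (h.inv_mem r hr) _, by group, ?_⟩
    rwa [h.length_inv, h.length_inv]

theorem mul_simple_le {s w : W} (hs : s ∈ S) (hw : ℓ (w * s) < ℓ w) : BruhatLE ℓ R (w * s) w := by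
  have := h.bruhatLE_inv (h.simple_mul_le hs (w := w⁻¹)
    (by rwa [h.length_inv, ← h.length_inv, mul_inv_rev, inv_inv, h.inv_simple hs]))
  rwa [mul_inv_rev, inv_inv, h.inv_simple hs] at this

theorem bruhatLE_zero_mul {x w τ : W} (hτ : ℓ τ = 0) (hx : BruhatLE ℓ R x w) :
    BruhatLE ℓ R (τ * x) (τ * w) := by
  induction hx with
  | refl => exact .refl
  | @tail b c _ hbc ih =>
    obtain ⟨r, hr, rfl, hl⟩ := hbc
    refine ih.tail ⟨τ * r * τ⁻¹, h.conj_mem _ hr _, by group, ?_⟩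
    rwa [h.length_mul_of_eq_zero _ _ hτ, h.length_mul_of_eq_zero _ _ hτ]

omit h in
theorem _root_.IwahoriWeyl.BruhatLE.eq_or_lt {x w : W} (hx : BruhatLE ℓ R x w) :
    x = w ∨ ℓ x < ℓ w := by
  induction hx with
  | refl => exact Or.inl rfl
  | tail _ hbc ih =>
    obtain ⟨r, hr, rfl, hl⟩ := hbc
    rcases ih with rfl | ih
    · exact Or.inr hl
    · exact Or.inr (ih.trans hl)

/-! ### Products of Bruhat lower sets -/

open scoped Pointwise

omit h in
theorem lowerSet_of_eq_zero {τ : W} (hτ : ℓ τ = 0) : lowerSet ℓ R τ = {τ} := by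
  ext x
  refine ⟨fun hx => ?_, fun hx => by rw [Set.mem_singleton_iff.1 hx]; exact .refl⟩
  rcases BruhatLE.eq_or_lt hx with rfl | hlt
  · rfl
  · omega

theorem lowerSet_one : lowerSet ℓ R (1 : W) = 1 :=
  lowerSet_of_eq_zero h.length_one

theorem lowerSet_zero_mul {τ w : W} (hτ : ℓ τ = 0) :
    lowerSet ℓ R (τ * w) = {τ} * lowerSet ℓ R w := by
  ext x
  rw [Set.singleton_mul, Set.mem_image]
  refine ⟨fun hx => ⟨τ⁻¹ * x, ?_, by group⟩, ?_⟩
  · have := h.bruhatLE_zero_mul (τ := τ⁻¹) (by rw [h.length_inv, hτ]) hx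
    rwa [inv_mul_cancel_left] at this
  · rintro ⟨y, hy, rfl⟩
    exact h.bruhatLE_zero_mul hτ hy

/-- Both inclusions are the lifting property: an element below `s v` is below `v` or becomes so
after multiplication by `s`, and the lower set of `s v` is stable under `s`. -/
theorem lowerSet_simple_mul {s v : W} (hs : s ∈ S) (hv : ℓ (s * v) = ℓ v + 1) :
    lowerSet ℓ R (s * v) = {1, s} * lowerSet ℓ R v := by
  have hle : BruhatLE ℓ R v (s * v) := h.le_simple_mul hs (by omega)
  ext x
  rw [Set.mem_mul]
  constructor
  · intro hx
    have := h.le_simple_mul_or hs hx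
    rw [h.simple_mul_cancel hs] at this
    rcases this with hk | hk
    · exact ⟨1, by simp, x, hk, one_mul x⟩
    · exact ⟨s, by simp, s * x, hk, h.simple_mul_cancel hs x⟩
  · rintro ⟨a, ha, y, hy, rfl⟩
    rcases ha with rfl | rfl
    · rw [one_mul]; exact hy.trans hle
    · exact h.simple_mul_mem_lowerSet hs (by rw [h.simple_mul_cancel hs]; omega) (hy.trans hle)

theorem lowerSet_simple {s : W} (hs : s ∈ S) : lowerSet ℓ R s = {1, s} := by
  have := h.lowerSet_simple_mul hs (v := 1) (by rw [mul_one, h.length_one, h.length_simple hs])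
  rwa [mul_one, h.lowerSet_one, mul_one] at this

/-- This is the relation `t_w t_w' = t_{ww'}` for lower sets. The left factor is peeled off one
simple reflection at a time; subadditivity keeps all intermediate products reduced. -/
theorem lowerSet_mul {w w' : W} (hl : ℓ (w * w') = ℓ w + ℓ w') :
    lowerSet ℓ R (w * w') = lowerSet ℓ R w * lowerSet ℓ R w' := by
  induction w using h.simple_induction with
  | h0 τ hτ => rw [h.lowerSet_zero_mul hτ, lowerSet_of_eq_zero hτ]
  | hs s hs v hv ih =>
    have h1 := h.length_mul_le v w'
    have h2 := h.simple_mul s hs (v * w')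
    rw [mul_assoc] at hl
    rw [mul_assoc, h.lowerSet_simple_mul hs (by omega), ih (by omega),
      h.lowerSet_simple_mul hs hv, mul_assoc]

end

end IsReflectionLength

/-! ### Minimal length elements and the cocenter of the `0`-Hecke algebra -/

section Conjugation

variable {W : Type*} [Group W] {ℓ : W → ℕ} {S R : Set W} {σ : W ≃* W} {Om : Subgroup W}

theorem IsReflectionLength.length_twisted_conj (h : IsReflectionLength ℓ S R)
    (hσ : IsCompatible ℓ S σ) {τ : W} (hτ : ℓ τ = 0) (w : W) : ℓ (τ * w * (σ τ)⁻¹) = ℓ w :=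
  h.length_conj_of_eq_zero hτ w (by rw [hσ.length_eq, hτ])

theorem Arrow.zero_conj (h : IsReflectionLength ℓ S R) (hσ : IsCompatible ℓ S σ) {τ : W}
    (hτ : ℓ τ = 0) {w w' : W} (hw : Arrow ℓ S σ w w') :
    Arrow ℓ S σ (τ * w * (σ τ)⁻¹) (τ * w' * (σ τ)⁻¹) := by
  induction hw with
  | refl => exact .refl
  | tail _ hbc ih =>
    obtain ⟨s, hs, rfl, hl⟩ := hbc
    refine ih.tail ⟨τ * s * τ⁻¹, h.simple_conj τ hτ s hs, ?_, ?_⟩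
    · simp only [map_mul, map_inv]; group
    · rwa [h.length_twisted_conj hσ hτ, h.length_twisted_conj hσ hτ]

theorem Arrow.length_le {w w' : W} (hw : Arrow ℓ S σ w w') : ℓ w' ≤ ℓ w := by
  induction hw with
  | refl => exact le_rfl
  | tail _ hbc ih => exact hbc.elim fun s hs => hs.2.2.trans ih

theorem IsMinLength.conj {w : W} (hw : IsMinLength ℓ σ w) (x : W)
    (hl : ℓ (x * w * (σ x)⁻¹) ≤ ℓ w) : IsMinLength ℓ σ (x * w * (σ x)⁻¹) := fun y => by
  refine hl.trans ((hw (y * x)).trans_eq ?_)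
  rw [map_mul]
  group

theorem Approx.symm {w w' : W} (hw : Approx ℓ S σ w w') : Approx ℓ S σ w' w := ⟨hw.2, hw.1⟩

theorem Approx.trans {a b c : W} (hab : Approx ℓ S σ a b) (hbc : Approx ℓ S σ b c) :
    Approx ℓ S σ a c := ⟨Relation.ReflTransGen.trans hab.1 hbc.1,
      Relation.ReflTransGen.trans hbc.2 hab.2⟩

theorem Approx.zero_conj (h : IsReflectionLength ℓ S R) (hσ : IsCompatible ℓ S σ) {τ : W}
    (hτ : ℓ τ = 0) {w w' : W} (hw : Approx ℓ S σ w w') :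
    Approx ℓ S σ (τ * w * (σ τ)⁻¹) (τ * w' * (σ τ)⁻¹) :=
  ⟨hw.1.zero_conj h hσ hτ, hw.2.zero_conj h hσ hτ⟩

theorem TildeApprox.refl (w : W) : TildeApprox ℓ S Om σ w w :=
  ⟨1, Om.one_mem, by simp only [map_one, one_mul, inv_one, mul_one]; exact ⟨.refl, .refl⟩⟩

theorem TildeApprox.symm (h : IsReflectionLength ℓ S R) (hσ : IsCompatible ℓ S σ)
    (hOm : ∀ w, w ∈ Om ↔ ℓ w = 0) {w w' : W} (hw : TildeApprox ℓ S Om σ w w') :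
    TildeApprox ℓ S Om σ w' w := by
  obtain ⟨τ, hτ, ha⟩ := hw
  refine ⟨τ⁻¹, Om.inv_mem hτ, ?_⟩
  have := (ha.zero_conj h hσ ((hOm _).1 (Om.inv_mem hτ))).symm
  convert this using 1
  rw [map_inv]
  group

theorem TildeApprox.trans (h : IsReflectionLength ℓ S R) (hσ : IsCompatible ℓ S σ)
    (hOm : ∀ w, w ∈ Om ↔ ℓ w = 0) {a b c : W} (hab : TildeApprox ℓ S Om σ a b)
    (hbc : TildeApprox ℓ S Om σ b c) : TildeApprox ℓ S Om σ a c := by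
  obtain ⟨τ, hτ, ha⟩ := hab
  obtain ⟨ρ, hρ, hb⟩ := hbc
  refine ⟨τ * ρ, Om.mul_mem hτ hρ, ha.trans ?_⟩
  convert hb.zero_conj h hσ ((hOm _).1 hτ) using 1
  rw [map_mul]
  group

/-- The elements that are equivalent to `w`. -/
def tildeClass (ℓ : W → ℕ) (S : Set W) (Om : Subgroup W) (σ : W ≃* W) (w : W) : Set W :=
  {w' | TildeApprox ℓ S Om σ w' w}

theorem tildeClass_eq (h : IsReflectionLength ℓ S R) (hσ : IsCompatible ℓ S σ)
    (hOm : ∀ w, w ∈ Om ↔ ℓ w = 0) {w w' : W} (hw : TildeApprox ℓ S Om σ w w') :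
    tildeClass ℓ S Om σ w = tildeClass ℓ S Om σ w' := by
  ext v
  exact ⟨fun k => TildeApprox.trans h hσ hOm k hw,
    fun k => TildeApprox.trans h hσ hOm k (TildeApprox.symm h hσ hOm hw)⟩

theorem TildeApprox.length_eq (h : IsReflectionLength ℓ S R) (hσ : IsCompatible ℓ S σ)
    (hOm : ∀ w, w ∈ Om ↔ ℓ w = 0) {w w' : W} (hw : TildeApprox ℓ S Om σ w w') : ℓ w = ℓ w' := by
  obtain ⟨τ, hτ, ha⟩ := hw
  rw [← h.length_twisted_conj hσ ((hOm _).1 hτ) w']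
  exact le_antisymm ha.2.length_le ha.1.length_le

end Conjugation

/-! ### Spanning of the cocenter by minimal length elements -/

section Span

variable {W : Type*} [Group W] {ℓ : W → ℕ} {S R : Set W}

theorem IsReflectionLength.t_simple_mul_of_lt (h : IsReflectionLength ℓ S R) {s v : W} (hs : s ∈ S)
    (hl : ℓ (s * v) < ℓ v) : t ℓ S s * t ℓ S v = -t ℓ S v := by
  have h1 := h.simple_mul s hs v
  have h2 : t ℓ S v = t ℓ S s * t ℓ S (s * v) := by
    rw [t_mul ℓ S (by rw [h.simple_mul_cancel hs, h.length_simple hs]; omega),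
      h.simple_mul_cancel hs]
  rw [h2, ← mul_assoc, t_sq ℓ S hs]
  exact neg_mul (t ℓ S s) (t ℓ S (s * v))

/-- The span contains `1` and is a left ideal: for simple `s` the product `t_s t_v` is `t_{sv}` or
`-t_v`, and a general `t_w` is a product of such factors and one of length zero. -/
theorem IsReflectionLength.span_t (h : IsReflectionLength ℓ S R) :
    Submodule.span ℂ (Set.range (t ℓ S)) = ⊤ := by
  have hst : ∀ w, ∀ x ∈ Submodule.span ℂ (Set.range (t ℓ S)),
      t ℓ S w * x ∈ Submodule.span ℂ (Set.range (t ℓ S)) := by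
    intro w
    induction w using h.simple_induction with
    | h0 τ hτ =>
      intro x hx
      induction hx using Submodule.span_induction with
      | mem x hx =>
        obtain ⟨v, rfl⟩ := hx
        rw [t_mul ℓ S (by rw [h.length_mul_of_eq_zero _ _ hτ, hτ, zero_add])]
        exact Submodule.subset_span ⟨_, rfl⟩
      | zero => rw [mul_zero]; exact Submodule.zero_mem _
      | add x y _ _ hx hy => rw [mul_add]; exact Submodule.add_mem _ hx hy
      | smul a x _ hx => rw [mul_smul_comm]; exact Submodule.smul_mem _ _ hx
    | hs s hs v hv ih =>
      intro x hx
      rw [← t_mul ℓ S (by rw [hv, h.length_simple hs, add_comm]), mul_assoc]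
      have hy := ih x hx
      generalize t ℓ S v * x = y at hy
      clear hx
      induction hy using Submodule.span_induction with
      | mem x hx =>
        obtain ⟨v, rfl⟩ := hx
        rcases h.simple_mul s hs v with hl | hl
        · rw [t_mul ℓ S (by rw [hl, h.length_simple hs, add_comm])]
          exact Submodule.subset_span ⟨_, rfl⟩
        · rw [h.t_simple_mul_of_lt hs (by omega)]
          exact Submodule.neg_mem _ (Submodule.subset_span ⟨_, rfl⟩)
      | zero => rw [mul_zero]; exact Submodule.zero_mem _
      | add x y _ _ hx hy => rw [mul_add]; exact Submodule.add_mem _ hx hy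
      | smul a x _ hx => rw [mul_smul_comm]; exact Submodule.smul_mem _ _ hx
  have key : ∀ a : FreeAlgebra ℂ W, ∀ x ∈ Submodule.span ℂ (Set.range (t ℓ S)),
      RingQuot.mkAlgHom ℂ (HeckeRel ℓ S) a * x ∈ Submodule.span ℂ (Set.range (t ℓ S)) := by
    intro a
    induction a using FreeAlgebra.induction with
    | grade0 r =>
      intro x hx
      rw [AlgHom.commutes, ← Algebra.smul_def]
      exact Submodule.smul_mem _ _ hx
    | grade1 w => exact hst w
    | mul a b ha hb => intro x hx; rw [map_mul, mul_assoc]; exact ha _ (hb _ hx)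
    | add a b ha hb => intro x hx; rw [map_add, add_mul]; exact Submodule.add_mem _ (ha x hx) (hb x hx)
  rw [eq_top_iff]
  intro x _
  obtain ⟨a, rfl⟩ := RingQuot.mkAlgHom_surjective ℂ (HeckeRel ℓ S) x
  have := key a (t ℓ S 1) (Submodule.subset_span ⟨1, rfl⟩)
  rwa [t_one, mul_one] at this

variable {σ : W ≃* W} (hσ : IsCompatible ℓ S σ)

theorem mkQ_mul_comm (a b : ZeroHecke ℓ S) :
    (commutator hσ).mkQ (a * b) = (commutator hσ).mkQ (b * heckeMap hσ a) := by
  rw [← sub_eq_zero, ← map_sub, Submodule.mkQ_apply, Submodule.Quotient.mk_eq_zero]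
  exact Submodule.subset_span ⟨a, b, rfl⟩

theorem tBar_mul_comm {x y : W} (h1 : ℓ (x * y) = ℓ x + ℓ y) (h2 : ℓ (y * σ x) = ℓ y + ℓ x) :
    tBar hσ (x * y) = tBar hσ (y * σ x) := by
  rw [tBar, ← t_mul ℓ S h1, mkQ_mul_comm, heckeMap_t, t_mul ℓ S (by rw [h2, hσ.length_eq]), tBar]

theorem tBar_zero_conj (h : IsReflectionLength ℓ S R) {τ : W} (hτ : ℓ τ = 0) (w : W) :
    tBar hσ (τ * w * (σ τ)⁻¹) = tBar hσ w := by
  have h0 : ℓ ((σ τ)⁻¹) = 0 := by rw [h.length_inv, hσ.length_eq, hτ]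
  rw [mul_assoc, tBar_mul_comm hσ, inv_mul_cancel_right]
  · rw [h.length_mul_of_eq_zero _ _ hτ, hτ, zero_add]
  · rw [inv_mul_cancel_right, h.length_mul_of_eq_zero_right h0, hτ, add_zero]

/-- If one of `s v`, `v σ(s)` is shorter than `v`, the shift moves a factor `t_s` from the left end
to `t_{σ(s)}` at the right end, or back. If both are longer, the lifting axiom forces `s v = v
σ(s)`, and the shift is trivial. -/
theorem tBar_shift (h : IsReflectionLength ℓ S R) {s v : W} (hs : s ∈ S)
    (hl : ℓ (s * v * σ s) = ℓ v) : tBar hσ (s * v * σ s) = tBar hσ v := by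
  have hs' : σ s ∈ S := (hσ.mem_iff s).2 hs
  have h1 := h.length_simple hs
  rcases h.simple_mul s hs v with h2 | h2
  · rcases h.mul_simple hs' v with h3 | h3
    · have hr : v * σ s * v⁻¹ = s := by
        by_contra hne
        have := h.lift (v * σ s * v⁻¹) (h.conj_mem _ (h.simple_subset hs') v) s hs hne v
          (by rw [inv_mul_cancel_right]; omega)
        have e : s * (v * σ s * v⁻¹) * v = s * v * σ s := by group
        rw [e] at this
        omega
      have : v * σ s = s * v := mul_inv_eq_iff_eq_mul.1 hr
      rw [mul_assoc, this, h.simple_mul_cancel hs]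
    · have e : v * σ s * σ s = v := h.mul_simple_cancel hs' v
      rw [mul_assoc, tBar_mul_comm hσ (x := s) (y := v * σ s), e]
      · rw [← mul_assoc]; omega
      · rw [e]; omega
  · have e : s * (s * v) = v := h.simple_mul_cancel hs v
    rw [← tBar_mul_comm hσ (x := s) (y := s * v), e]
    · rw [e]; omega
    · omega

/-- Moving `t_s` to the right end of `t_s t_{sv}` gives `t_{sv} t_{σ(s)}`. Since `s v` itself ends
in `σ(s)`, the quadratic relation absorbs the factor with a sign. -/
theorem tBar_descent (h : IsReflectionLength ℓ S R) {s v : W} (hs : s ∈ S)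
    (hl : ℓ (s * v * σ s) < ℓ v) : ℓ (s * v) < ℓ v ∧ tBar hσ v = -tBar hσ (s * v) := by
  have hs' : σ s ∈ S := (hσ.mem_iff s).2 hs
  have h1 := h.length_simple hs
  have h2 := h.simple_mul s hs v
  have h3 := h.mul_simple hs' (s * v)
  have h4 := h.mul_simple hs' v
  have h5 := h.simple_mul s hs (v * σ s)
  rw [← mul_assoc] at h5
  have hlt : ℓ (s * v) < ℓ v := by omega
  refine ⟨hlt, ?_⟩
  have e : s * (s * v) = v := h.simple_mul_cancel hs v
  have e' : s * v * σ s * σ s = s * v := h.mul_simple_cancel hs' _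
  have k1 : t ℓ S v = t ℓ S s * t ℓ S (s * v) := by rw [t_mul ℓ S (by rw [e]; omega), e]
  have k2 : t ℓ S (s * v) = t ℓ S (s * v * σ s) * t ℓ S (σ s) := by
    rw [t_mul ℓ S (by rw [e', h.length_simple hs']; omega), e']
  rw [tBar, k1, mkQ_mul_comm, heckeMap_t, k2, mul_assoc, t_sq ℓ S hs', tBar,
    ← map_neg, k2]
  exact congrArg _ (mul_neg (t ℓ S (s * v * σ s)) (t ℓ S (σ s)))

theorem tBar_arrow_of_length_eq (h : IsReflectionLength ℓ S R) {w w' : W} (hw : Arrow ℓ S σ w w')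
    (hl : ℓ w' = ℓ w) : tBar hσ w' = tBar hσ w := by
  induction hw with
  | refl => rfl
  | @tail b c hwb hbc ih =>
    obtain ⟨s, hs, rfl, hl'⟩ := hbc
    have hb : ℓ b = ℓ w := le_antisymm (Arrow.length_le hwb) (by omega)
    rw [tBar_shift hσ h hs (by omega), ih hb]

theorem tBar_tildeApprox (h : IsReflectionLength ℓ S R) {Om : Subgroup W}
    (hOm : ∀ w, w ∈ Om ↔ ℓ w = 0) {w w' : W} (hw : TildeApprox ℓ S Om σ w w') :
    tBar hσ w = tBar hσ w' := by
  have hl := TildeApprox.length_eq h hσ hOm hw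
  obtain ⟨τ, hτ, ha⟩ := hw
  have h0 := (hOm _).1 hτ
  rw [← tBar_zero_conj hσ h h0 w', tBar_arrow_of_length_eq hσ h ha.1]
  rw [h.length_twisted_conj hσ h0, hl]

theorem exists_descent_of_arrow {w w' : W} (hw : Arrow ℓ S σ w w') (hl : ℓ w' < ℓ w) :
    ∃ v, Arrow ℓ S σ w v ∧ ℓ v = ℓ w ∧ ∃ s ∈ S, ℓ (s * v * σ s) < ℓ v := by
  induction hw with
  | refl => exact absurd hl (lt_irrefl _)
  | @tail b c hwb hbc ih =>
    obtain ⟨s, hs, rfl, hl'⟩ := hbc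
    rcases (Arrow.length_le hwb).lt_or_eq with hlt | heq
    · exact ih hlt
    · exact ⟨b, hwb, heq, s, hs, by omega⟩

/-- Induction on the length. A strictly shortening shift is not carried out; it is used to pass from
`v` to `s v`, which in general lies in another `σ`-conjugacy class. -/
theorem exists_minLength_tBar (h : IsReflectionLength ℓ S R)
    (hmin : ∀ w, ∃ w', Arrow ℓ S σ w w' ∧ IsMinLength ℓ σ w') (w : W) :
    ∃ v, IsMinLength ℓ σ v ∧ (tBar hσ w = tBar hσ v ∨ tBar hσ w = -tBar hσ v) := by
  induction hn : ℓ w using Nat.strong_induction_on generalizing w with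
  | _ n ih =>
    subst hn
    obtain ⟨w', hw, hw'⟩ := hmin w
    rcases hw.length_le.lt_or_eq with hlt | heq
    · obtain ⟨v, hwv, hv, s, hs, hd⟩ := exists_descent_of_arrow hw hlt
      obtain ⟨hsv, ht⟩ := tBar_descent hσ h hs hd
      obtain ⟨u, hu, hu'⟩ := ih (ℓ (s * v)) (by omega) _ rfl
      rw [tBar_arrow_of_length_eq hσ h hwv hv] at ht
      refine ⟨u, hu, ?_⟩
      rw [ht]
      rcases hu' with hu' | hu' <;> rw [hu']
      · exact Or.inr rfl
      · exact Or.inl (neg_neg _)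
    · exact ⟨w', hw', Or.inl (tBar_arrow_of_length_eq hσ h hw heq).symm⟩

end Span

/-! ### The separating trace and linear independence -/

section Trace

open scoped Pointwise

variable {W : Type*} [Group W] {ℓ : W → ℕ} {S R : Set W}

/-- The homomorphism from the `0`-Hecke algebra to the algebra of the monoid of subsets of `W`
which sends `t_w` to the lower set of `w`, up to sign. -/
noncomputable def heckeToSets (h : IsReflectionLength ℓ S R) :
    ZeroHecke ℓ S →ₐ[ℂ] MonoidAlgebra ℂ (Set W) :=
  RingQuot.liftAlgHom ℂ ⟨FreeAlgebra.lift ℂ fun w =>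
      MonoidAlgebra.single (lowerSet ℓ R w) ((-1 : ℂ) ^ ℓ w), by
    intro a b hab
    induction hab with
    | one => simp [h.lowerSet_one, h.length_one, MonoidAlgebra.one_def]
    | mul w w' hl =>
      rw [map_mul, FreeAlgebra.lift_ι_apply, FreeAlgebra.lift_ι_apply, FreeAlgebra.lift_ι_apply,
        MonoidAlgebra.single_mul_single, h.lowerSet_mul hl, hl, pow_add]
    | sq s hs =>
      -- The lower set of `s` is idempotent; with the sign `(-1)^ℓ(s) = -1` this is the quadratic
      -- relation.
      have : ({1, s} : Set W) * {1, s} = {1, s} := by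
        ext x
        simp only [Set.mem_mul, Set.mem_insert_iff, Set.mem_singleton_iff]
        constructor
        · rintro ⟨a, rfl | rfl, b, rfl | rfl, rfl⟩ <;> simp [h.sq _ hs]
        · rintro (rfl | rfl)
          · exact ⟨1, by simp, 1, by simp, by simp⟩
          · exact ⟨1, by simp, x, by simp, by simp⟩
      rw [map_mul, map_neg, FreeAlgebra.lift_ι_apply, MonoidAlgebra.single_mul_single,
        h.lowerSet_simple hs, this, h.length_simple hs, ← MonoidAlgebra.single_neg]
      norm_num⟩

theorem heckeToSets_t (h : IsReflectionLength ℓ S R) (w : W) :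
    heckeToSets h (t ℓ S w) = MonoidAlgebra.single (lowerSet ℓ R w) ((-1 : ℂ) ^ ℓ w) := by
  simp [heckeToSets, t]

/-- The classes of the minimal length elements that lie in a given subset. -/
def minClassesIn (ℓ : W → ℕ) (S : Set W) (Om : Subgroup W) (σ : W ≃* W) (A : Set W) :
    Set (Set W) :=
  {C | ∃ x ∈ A, IsMinLength ℓ σ x ∧ C = tildeClass ℓ S Om σ x}

/-- The functional `t_w ↦ ±[minClassesIn (lowerSet w)]`. -/
noncomputable def heckeTrace (h : IsReflectionLength ℓ S R) (Om : Subgroup W) (σ : W ≃* W) :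
    ZeroHecke ℓ S →ₗ[ℂ] Set (Set W) →₀ ℂ :=
  Finsupp.lmapDomain ℂ ℂ (minClassesIn ℓ S Om σ) ∘ₗ
    (MonoidAlgebra.coeffLinearEquiv ℂ).toLinearMap ∘ₗ (heckeToSets h).toLinearMap

theorem heckeTrace_of_single (h : IsReflectionLength ℓ S R) (Om : Subgroup W) (σ : W ≃* W)
    {x : ZeroHecke ℓ S} {A : Set W} {c : ℂ} (hx : heckeToSets h x = MonoidAlgebra.single A c) :
    heckeTrace h Om σ x = Finsupp.single (minClassesIn ℓ S Om σ A) c := by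
  simp [heckeTrace, hx, Finsupp.lmapDomain_apply]

variable {σ : W ≃* W} (hσ : IsCompatible ℓ S σ) {Om : Subgroup W}

include hσ in
-- Only elements `s y` with `y ≤ w` need an argument. If `s y < y`, then `s y` lies in the lower set
-- already. Otherwise `y σ(s)` is a cyclic shift of `s y` that is not longer, so it is minimal and
-- in the same class. The reverse inclusion is symmetric.
theorem minClassesIn_simple (h : IsReflectionLength ℓ S R) (hOm : ∀ w, w ∈ Om ↔ ℓ w = 0) {s : W}
    (hs : s ∈ S) (w : W) :
    minClassesIn ℓ S Om σ ({1, s} * lowerSet ℓ R w) =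
      minClassesIn ℓ S Om σ (lowerSet ℓ R w * {1, σ s}) := by
  have hs' : σ s ∈ S := (hσ.mem_iff s).2 hs
  have hcl : ∀ x y, IsMinLength ℓ σ x → s * x * σ s = y → ℓ y ≤ ℓ x →
      IsMinLength ℓ σ y ∧ tildeClass ℓ S Om σ x = tildeClass ℓ S Om σ y := by
    rintro x y hx rfl hl
    have e : s * x * σ s = s * x * (σ s)⁻¹ := by rw [h.inv_simple hs']
    have hl' : ℓ (s * x * σ s) = ℓ x := le_antisymm hl (by rw [e]; exact hx s)
    refine ⟨by rw [e]; exact hx.conj s (by rwa [← e]), tildeClass_eq h hσ hOm ⟨1, Om.one_mem, ?_⟩⟩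
    simp only [map_one, one_mul, inv_one, mul_one]
    refine ⟨.single ⟨s, hs, rfl, hl⟩, .single ⟨s, hs, ?_, hl'.ge⟩⟩
    rw [mul_assoc s x, h.simple_mul_cancel hs, h.mul_simple_cancel hs']
  ext C
  constructor
  · rintro ⟨x, hx, hm, rfl⟩
    obtain ⟨a, ha, y, hy, rfl⟩ := Set.mem_mul.1 hx
    rcases ha with rfl | rfl
    · exact ⟨1 * y, Set.mem_mul.2 ⟨y, hy, 1, by simp, by simp⟩, hm, rfl⟩
    rcases h.simple_mul a hs y with hl | hl
    · have e : a * (a * y) * σ a = y * σ a := by rw [h.simple_mul_cancel hs]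
      have h1 := h.mul_simple hs' y
      obtain ⟨h2, h3⟩ := hcl _ _ hm e (by omega)
      exact ⟨_, Set.mem_mul.2 ⟨y, hy, σ a, by simp, rfl⟩, h2, h3⟩
    · exact ⟨a * y, Set.mem_mul.2 ⟨a * y, (h.simple_mul_le hs (by omega)).trans hy, 1, by simp,
        by simp⟩, hm, rfl⟩
  · rintro ⟨x, hx, hm, rfl⟩
    obtain ⟨y, hy, a, ha, rfl⟩ := Set.mem_mul.1 hx
    rcases ha with rfl | rfl
    · exact ⟨y * 1, Set.mem_mul.2 ⟨1, by simp, y, hy, by simp⟩, hm, rfl⟩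
    rcases h.mul_simple hs' y with hl | hl
    · have e : s * (y * σ s) * σ s = s * y := by rw [← mul_assoc, h.mul_simple_cancel hs']
      have h1 := h.simple_mul s hs y
      obtain ⟨h2, h3⟩ := hcl _ _ hm e (by omega)
      exact ⟨_, Set.mem_mul.2 ⟨s, by simp, y, hy, rfl⟩, h2, h3⟩
    · exact ⟨y * σ s, Set.mem_mul.2 ⟨1, by simp, y * σ s,
        (h.mul_simple_le hs' (by omega)).trans hy, by simp⟩, hm, rfl⟩

include hσ in
theorem minClassesIn_zero (h : IsReflectionLength ℓ S R) (hOm : ∀ w, w ∈ Om ↔ ℓ w = 0) {τ : W}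
    (hτ : ℓ τ = 0) (A : Set W) :
    minClassesIn ℓ S Om σ ({τ} * A) = minClassesIn ℓ S Om σ (A * {σ τ}) := by
  have hcl : ∀ ρ, ℓ ρ = 0 → ∀ x, IsMinLength ℓ σ x → IsMinLength ℓ σ (ρ * x * (σ ρ)⁻¹) ∧
      tildeClass ℓ S Om σ x = tildeClass ℓ S Om σ (ρ * x * (σ ρ)⁻¹) := by
    intro ρ hρ x hx
    refine ⟨hx.conj _ (h.length_twisted_conj hσ hρ x).le, (tildeClass_eq h hσ hOm ?_).symm⟩
    exact ⟨ρ, (hOm _).2 hρ, .refl, .refl⟩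
  ext C
  constructor
  · rintro ⟨x, hx, hm, rfl⟩
    obtain ⟨a, rfl, y, hy, rfl⟩ := Set.mem_mul.1 hx
    obtain ⟨h1, h2⟩ := hcl a⁻¹ (by rw [h.length_inv, hτ]) _ hm
    refine ⟨_, Set.mem_mul.2 ⟨y, hy, σ a, rfl, ?_⟩, h1, h2⟩
    rw [map_inv]
    group
  · rintro ⟨x, hx, hm, rfl⟩
    obtain ⟨y, hy, a, rfl, rfl⟩ := Set.mem_mul.1 hx
    obtain ⟨h1, h2⟩ := hcl τ hτ _ hm
    refine ⟨_, Set.mem_mul.2 ⟨τ, rfl, y, hy, ?_⟩, h1, h2⟩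
    group

/-- The elements `a` that satisfy the identity for all `b` are closed under products and linear
combinations, so length-zero elements (`minClassesIn_zero`) and simple reflections
(`minClassesIn_simple`) suffice. -/
theorem heckeTrace_mul_comm (h : IsReflectionLength ℓ S R) (hOm : ∀ w, w ∈ Om ↔ ℓ w = 0)
    (a b : ZeroHecke ℓ S) :
    heckeTrace h Om σ (a * b) = heckeTrace h Om σ (b * heckeMap hσ a) := by
  have key : ∀ w, (∀ w', heckeTrace h Om σ (t ℓ S w * t ℓ S w') =
      heckeTrace h Om σ (t ℓ S w' * t ℓ S (σ w))) →
      ∀ b, heckeTrace h Om σ (t ℓ S w * b) = heckeTrace h Om σ (b * t ℓ S (σ w)) := by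
    intro w hw b
    have hb : b ∈ Submodule.span ℂ (Set.range (t ℓ S)) := by rw [h.span_t]; trivial
    induction hb using Submodule.span_induction with
    | mem x hx => obtain ⟨v, rfl⟩ := hx; exact hw v
    | zero => rw [mul_zero, zero_mul]
    | add x y _ _ hx hy => rw [mul_add, add_mul, map_add, map_add, hx, hy]
    | smul c x _ hx => rw [mul_smul_comm, smul_mul_assoc, map_smul, map_smul, hx]
  have ht : ∀ w b, heckeTrace h Om σ (t ℓ S w * b) = heckeTrace h Om σ (b * t ℓ S (σ w)) := by
    intro w
    induction w using h.simple_induction with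
    | h0 τ hτ =>
      refine key τ fun w' => ?_
      have h0 : ℓ (σ τ) = 0 := by rw [hσ.length_eq, hτ]
      rw [heckeTrace_of_single h Om σ (x := t ℓ S τ * _) (by rw [map_mul, heckeToSets_t,
          heckeToSets_t, MonoidAlgebra.single_mul_single, IsReflectionLength.lowerSet_of_eq_zero hτ]),
        heckeTrace_of_single h Om σ (x := t ℓ S w' * _) (by rw [map_mul, heckeToSets_t,
          heckeToSets_t, MonoidAlgebra.single_mul_single, IsReflectionLength.lowerSet_of_eq_zero h0]),
        minClassesIn_zero hσ h hOm hτ, hτ, h0, mul_comm]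
    | hs s hs v hv ih =>
      have hs' : σ s ∈ S := (hσ.mem_iff s).2 hs
      have hss := key s fun w' => by
        rw [heckeTrace_of_single h Om σ (x := t ℓ S s * _) (by rw [map_mul, heckeToSets_t,
            heckeToSets_t, MonoidAlgebra.single_mul_single, h.lowerSet_simple hs]),
          heckeTrace_of_single h Om σ (x := t ℓ S w' * _) (by rw [map_mul, heckeToSets_t,
            heckeToSets_t, MonoidAlgebra.single_mul_single, h.lowerSet_simple hs']),
          minClassesIn_simple hσ h hOm hs, hσ.length_eq, mul_comm]
      intro b
      have e : t ℓ S (s * v) = t ℓ S s * t ℓ S v :=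
        (t_mul ℓ S (by rw [hv, h.length_simple hs, add_comm])).symm
      have e' : t ℓ S (σ (s * v)) = t ℓ S (σ s) * t ℓ S (σ v) := by
        rw [← heckeMap_t hσ, e, map_mul, heckeMap_t, heckeMap_t]
      rw [e, e', mul_assoc, hss, mul_assoc, ih, mul_assoc]
  have ha : a ∈ Submodule.span ℂ (Set.range (t ℓ S)) := by rw [h.span_t]; trivial
  induction ha using Submodule.span_induction with
  | mem x hx => obtain ⟨v, rfl⟩ := hx; rw [ht, heckeMap_t]
  | zero => rw [map_zero, mul_zero, zero_mul]
  | add x y _ _ hx hy => rw [map_add, mul_add, add_mul, map_add, map_add, hx, hy]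
  | smul c x _ hx => rw [map_smul, mul_smul_comm, smul_mul_assoc, map_smul, map_smul, hx]

/-- The functional on the cocenter induced by `heckeTrace`. -/
noncomputable def cocenterTrace (h : IsReflectionLength ℓ S R) (hOm : ∀ w, w ∈ Om ↔ ℓ w = 0) :
    Cocenter hσ →ₗ[ℂ] Set (Set W) →₀ ℂ :=
  (commutator hσ).liftQ (heckeTrace h Om σ) <| by
    rw [commutator, Submodule.span_le]
    rintro _ ⟨a, b, rfl⟩
    rw [SetLike.mem_coe, LinearMap.mem_ker, map_sub, heckeTrace_mul_comm hσ h hOm, sub_self]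

theorem cocenterTrace_tBar (h : IsReflectionLength ℓ S R) (hOm : ∀ w, w ∈ Om ↔ ℓ w = 0) (w : W) :
    cocenterTrace hσ h hOm (tBar hσ w) =
      Finsupp.single (minClassesIn ℓ S Om σ (lowerSet ℓ R w)) ((-1 : ℂ) ^ ℓ w) := by
  rw [cocenterTrace, tBar, Submodule.mkQ_apply, Submodule.liftQ_apply,
    heckeTrace_of_single h Om σ (heckeToSets_t h w)]

include hσ in
-- Each of the two classes meets the lower set of the other element. So `w` is equivalent to some `x
-- ≤ w'` and `w'` to some `y ≤ w`; equivalence preserves length, which leaves no room for a strict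
-- inequality.
theorem tildeApprox_of_minClassesIn_eq (h : IsReflectionLength ℓ S R)
    (hOm : ∀ w, w ∈ Om ↔ ℓ w = 0) {w w' : W} (hw : IsMinLength ℓ σ w) (hw' : IsMinLength ℓ σ w')
    (he : minClassesIn ℓ S Om σ (lowerSet ℓ R w) = minClassesIn ℓ S Om σ (lowerSet ℓ R w')) :
    TildeApprox ℓ S Om σ w w' := by
  have key : ∀ {a b}, IsMinLength ℓ σ a →
      minClassesIn ℓ S Om σ (lowerSet ℓ R a) = minClassesIn ℓ S Om σ (lowerSet ℓ R b) →
      ∃ x, BruhatLE ℓ R x b ∧ TildeApprox ℓ S Om σ a x := by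
    intro a b ha hab
    have : tildeClass ℓ S Om σ a ∈ minClassesIn ℓ S Om σ (lowerSet ℓ R b) := by
      rw [← hab]
      exact ⟨a, .refl, ha, rfl⟩
    obtain ⟨x, hx, -, hC⟩ := this
    refine ⟨x, hx, ?_⟩
    have : a ∈ tildeClass ℓ S Om σ a := TildeApprox.refl a
    rwa [hC] at this
  obtain ⟨x, hx, hax⟩ := key hw he
  obtain ⟨y, hy, hby⟩ := key hw' he.symm
  have h1 := TildeApprox.length_eq h hσ hOm hax
  have h2 := TildeApprox.length_eq h hσ hOm hby
  rcases hx.eq_or_lt with rfl | hlt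
  · exact hax
  · rcases hy.eq_or_lt with rfl | hlt' <;> omega

theorem basis_eq_of_eq_neg {ι V : Type*} [AddCommGroup V] [Module ℂ V] (b : Module.Basis ι ℂ V)
    {i j : ι} (hij : b i = -b j) : i = j := by
  by_contra hne
  have h1 := congrArg (fun x => b.repr x i) hij
  simp only [map_neg, Module.Basis.repr_self, Finsupp.coe_neg, Pi.neg_apply,
    Finsupp.single_eq_same, Finsupp.single_eq_of_ne hne, neg_zero] at h1
  exact one_ne_zero h1

/-- The structure of the cocenter of the `0`-Hecke algebra, given that every element can be
brought to minimal length by length-nonincreasing cyclic shifts. -/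
theorem exists_basis_cocenter (h : IsReflectionLength ℓ S R) (hOm : ∀ w, w ∈ Om ↔ ℓ w = 0)
    (hmin : ∀ w, ∃ w', Arrow ℓ S σ w w' ∧ IsMinLength ℓ σ w') :
    ∃ b : Module.Basis (MinClass ℓ S Om σ) ℂ (Cocenter hσ),
      (∀ C, ∀ w ∈ C.1, b C = tBar hσ w) ∧
      ∀ w, ∃! C, tBar hσ w = b C ∨ tBar hσ w = -b C := by
  choose rep hrep hC using fun C : MinClass ℓ S Om σ => C.2
  have hmem : ∀ C : MinClass ℓ S Om σ, ∀ w ∈ C.1, tBar hσ (rep C) = tBar hσ w := fun C w hw => by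
    rw [hC C] at hw
    exact (tBar_tildeApprox hσ h hOm hw).symm
  have hli : LinearIndependent ℂ fun C => tBar hσ (rep C) := by
    refine LinearIndependent.of_comp (cocenterTrace hσ h hOm) ?_
    have hinj : Function.Injective fun C : MinClass ℓ S Om σ =>
        minClassesIn ℓ S Om σ (lowerSet ℓ R (rep C)) := fun C C' he => by
      have := tildeClass_eq h hσ hOm
        (tildeApprox_of_minClassesIn_eq hσ h hOm (hrep C) (hrep C') he)
      exact Subtype.ext ((hC C).trans (this.trans (hC C').symm))
    -- The traces are distinct basis vectors up to sign, and signs are units.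
    have h1 := (Finsupp.linearIndependent_single_one ℂ (Set (Set W))).comp _ hinj
    have h2 := h1.units_smul fun C => ((-1 : ℂˣ) ^ ℓ (rep C))
    convert h2 using 1
    ext1 C
    simp [cocenterTrace_tBar, Units.smul_def]
  have hex : ∀ w, ∃ C : MinClass ℓ S Om σ,
      tBar hσ w = tBar hσ (rep C) ∨ tBar hσ w = -tBar hσ (rep C) := fun w => by
    obtain ⟨v, hv, hwv⟩ := exists_minLength_tBar hσ h hmin w
    refine ⟨⟨_, v, hv, rfl⟩, ?_⟩
    rwa [hmem ⟨_, v, hv, rfl⟩ v (TildeApprox.refl v)]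
  have hsp : ⊤ ≤ Submodule.span ℂ (Set.range fun C => tBar hσ (rep C)) := by
    have h1 : ⊤ ≤ (Submodule.span ℂ (Set.range (t ℓ S))).map (commutator hσ).mkQ := by
      rw [h.span_t, Submodule.map_top, Submodule.range_mkQ]
    refine h1.trans ?_
    rw [Submodule.map_span, Submodule.span_le]
    rintro _ ⟨_, ⟨w, rfl⟩, rfl⟩
    obtain ⟨C, hw | hw⟩ := hex w
    · exact Submodule.subset_span ⟨C, hw.symm⟩
    · change tBar hσ w ∈ _
      rw [hw]
      exact Submodule.neg_mem _ (Submodule.subset_span ⟨C, rfl⟩)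
  obtain ⟨b, hb⟩ : ∃ b : Module.Basis (MinClass ℓ S Om σ) ℂ (Cocenter hσ),
      ∀ C, b C = tBar hσ (rep C) := ⟨Module.Basis.mk hli hsp, Module.Basis.mk_apply hli hsp⟩
  refine ⟨b, fun C w hw => by rw [hb, hmem C w hw], fun w => ?_⟩
  obtain ⟨C, hw⟩ := hex w
  rw [← hb] at hw
  refine ⟨C, hw, fun C' hw' => ?_⟩
  rcases hw with hw | hw <;> rcases hw' with hw' | hw' <;> rw [hw] at hw'
  · exact (b.injective hw').symm
  · exact (basis_eq_of_eq_neg b hw').symm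
  · exact basis_eq_of_eq_neg b hw'.symm
  · exact (b.injective (neg_injective hw')).symm

end Trace

/-! ### Automorphisms of the affine arrangement -/

section Arrangement

variable {ι M N : Type*} [AddCommGroup M] [Module ℝ M] [AddCommGroup N] [Module ℝ N]
  (P : RootPairing ι ℝ M N)

theorem affineEquiv_add (g : N ≃ᵃ[ℝ] N) (v w : N) : g (v + w) = g.linear v + g w := by
  rw [add_comm v w]
  have := g.map_vadd w v
  simp only [vadd_eq_add] at this
  rw [add_comm w v, this]

theorem affineEquiv_sub (g : N ≃ᵃ[ℝ] N) (v w : N) : g.linear (v - w) = g v - g w := by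
  rw [eq_sub_iff_add_eq, ← affineEquiv_add, sub_add_cancel]

/-- The affine automorphisms that permute the affine roots `α - k`. -/
def arrangementAut : Subgroup (N ≃ᵃ[ℝ] N) where
  carrier := {g | ∃ (π : Equiv.Perm ι) (k : ι → ℤ), ∀ i v,
    P.root' i (g v) = P.root' (π i) v + k i}
  mul_mem' := by
    rintro g h ⟨π, k, hg⟩ ⟨π', k', hh⟩
    refine ⟨π.trans π', fun i => k' (π i) + k i, fun i v => ?_⟩
    rw [AffineEquiv.mul_def, AffineEquiv.trans_apply, hg, hh]
    push_cast
    rw [Equiv.trans_apply, add_assoc]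
  one_mem' := ⟨1, 0, fun i v => by simp⟩
  inv_mem' := by
    rintro g ⟨π, k, hg⟩
    refine ⟨π.symm, fun i => -k (π.symm i), fun i v => ?_⟩
    have := hg (π.symm i) (g⁻¹ v)
    rw [Equiv.apply_symm_apply] at this
    have e : g (g⁻¹ v) = v := g.apply_symm_apply v
    rw [e] at this
    rw [this]
    push_cast
    ring

variable {P}

theorem root'_linear {g : N ≃ᵃ[ℝ] N} {i j : ι} {k : ℤ}
    (hg : ∀ v, P.root' i (g v) = P.root' j v + k) (v : N) :
    P.root' i (g.linear v) = P.root' j v := by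
  have h1 := hg v
  have h2 := hg 0
  rw [← sub_zero v, affineEquiv_sub, map_sub, h1, h2, sub_zero, map_zero]
  ring

theorem root'_coroot (i j : ι) : P.root' i (P.coroot j) = P.pairing i j := rfl

theorem root'_coroot_self (i : ι) : P.root' i (P.coroot i) = 2 := P.root_coroot_two i

theorem root'_affineReflection (i j : ι) (k : ℤ) (v : N) :
    P.root' i (affineReflection P j k v) = P.root' i v - (P.root' j v - k) * P.pairing i j := by
  rw [affineReflection_apply, map_sub, map_smul, root'_coroot, smul_eq_mul]

theorem root'_affineReflection_self (i : ι) (k : ℤ) (v : N) :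
    P.root' i (affineReflection P i k v) = 2 * k - P.root' i v := by
  rw [root'_affineReflection, P.pairing_same]
  ring

theorem affineReflection_affineReflection (i : ι) (k : ℤ) (v : N) :
    affineReflection P i k (affineReflection P i k v) = v := by
  rw [affineReflection_apply P i k (affineReflection P i k v), root'_affineReflection_self,
    affineReflection_apply, sub_sub, ← add_smul]
  ring_nf
  simp

theorem affineReflection_mul_self (i : ι) (k : ℤ) :
    affineReflection P i k * affineReflection P i k = 1 :=
  AffineEquiv.ext fun v => affineReflection_affineReflection i k v

theorem affineReflection_inv (i : ι) (k : ℤ) :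
    (affineReflection P i k)⁻¹ = affineReflection P i k :=
  inv_eq_of_mul_eq_one_left (affineReflection_mul_self i k)

theorem root'_reflectionPerm (i j : ι) (v : N) :
    P.root' (P.reflectionPerm j i) v = P.root' i v - P.pairing i j * P.root' j v := by
  rw [RootPairing.root', P.root_reflectionPerm, P.reflection_apply_root, map_sub, map_smul]
  rfl

theorem exists_pairing_eq_int [P.IsCrystallographic] (i j : ι) : ∃ z : ℤ, P.pairing i j = z :=
  ⟨P.pairingIn ℤ i j, (P.algebraMap_pairingIn ℤ i j).symm⟩

theorem affineReflection_mem_arrangementAut [P.IsCrystallographic] (j : ι) (k : ℤ) :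
    affineReflection P j k ∈ arrangementAut P := by
  choose z hz using fun i => exists_pairing_eq_int (P := P) i j
  refine ⟨P.reflectionPerm j, fun i => k * z i, fun i v => ?_⟩
  rw [root'_affineReflection, root'_reflectionPerm, hz]
  push_cast
  ring

theorem affineWeylGroup_le_arrangementAut [P.IsCrystallographic] :
    affineWeylGroup P ≤ arrangementAut P := by
  rw [affineWeylGroup, Subgroup.closure_le]
  rintro _ ⟨i, k, rfl⟩
  exact affineReflection_mem_arrangementAut i k

theorem eq_zero_of_root'_eq_zero [P.IsRootSystem] {v : N} (hv : ∀ i, P.root' i v = 0) : v = 0 := by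
  have h0 : P.toLinearMap.flip v = 0 := by
    apply LinearMap.ext_on (RootPairing.IsRootSystem.span_root_eq_top (P := P))
    rintro _ ⟨i, rfl⟩
    exact hv i
  exact P.isPerfPair_toLinearMap.bijective_right.injective (by rw [h0, map_zero])

theorem corootForm_pos_iff [Fintype ι] [P.IsRootSystem] {v : N} (hv : P.CorootForm v v = 0) :
    v = 0 := by
  refine eq_zero_of_root'_eq_zero (P := P) fun i => ?_
  rw [P.corootForm_apply_apply] at hv
  have := (Finset.sum_eq_zero_iff_of_nonneg fun i _ => mul_self_nonneg _).1 hv i (Finset.mem_univ i)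
  exact mul_self_eq_zero.1 this

/-- Up to a scalar the coroot represents its root under the coroot form, so invariance of the form
transfers information from roots to coroots. -/
theorem corootForm_coroot [Fintype ι] (i : ι) (v : N) :
    P.CorootForm (P.coroot i) (P.coroot i) * P.root' i v = 2 * P.CorootForm (P.coroot i) v := by
  have := congrArg (fun f => P.toLinearMap f v) (P.corootForm_self_smul_root i)
  simp only [map_smul, LinearMap.smul_apply, smul_eq_mul, map_nsmul,
    P.toLinearMap_apply_CoPolarization, nsmul_eq_mul, Nat.cast_ofNat] at this
  exact this

theorem corootForm_linear [Fintype ι] {g : N ≃ᵃ[ℝ] N} (hg : g ∈ arrangementAut P) (v w : N) :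
    P.CorootForm (g.linear v) (g.linear w) = P.CorootForm v w := by
  obtain ⟨π, k, hg⟩ := hg
  simp only [P.corootForm_apply_apply, root'_linear (hg _)]
  exact Equiv.sum_comp π fun i => P.root' i v * P.root' i w

/-- Both vectors represent the same root up to their norms, for an invariant positive definite form.
Pairing them with each other shows that the norms agree. -/
theorem linear_coroot [Finite ι] [P.IsRootSystem] {g : N ≃ᵃ[ℝ] N} (hga : g ∈ arrangementAut P)
    {i j : ι} {k : ℤ} (hg : ∀ v, P.root' i (g v) = P.root' j v + k) :
    g.linear (P.coroot j) = P.coroot i := by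
  have := Fintype.ofFinite ι
  set x := g.linear (P.coroot j) with hx
  have h1 : ∀ w, 2 * P.CorootForm x w = P.CorootForm (P.coroot j) (P.coroot j) * P.root' i w := by
    intro w
    obtain ⟨v, rfl⟩ := g.linear.surjective w
    rw [hx, corootForm_linear hga, root'_linear hg, corootForm_coroot]
  have h2 := fun w => (corootForm_coroot (P := P) i w).symm
  have h3 : P.CorootForm (P.coroot i) (P.coroot i) = P.CorootForm (P.coroot j) (P.coroot j) := by
    have e1 := h1 (P.coroot i)
    have e2 := h2 x
    have e3 : P.root' i x = 2 := by rw [hx, root'_linear hg, root'_coroot_self]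
    have e4 : P.CorootForm x (P.coroot i) = P.CorootForm (P.coroot i) x := by
      simp only [P.corootForm_apply_apply, mul_comm]
    rw [root'_coroot_self] at e1
    rw [e3] at e2
    linarith
  rw [← sub_eq_zero]
  apply corootForm_pos_iff (P := P)
  have e1 := h1 (x - P.coroot i)
  have e2 := h2 (x - P.coroot i)
  rw [h3] at e2
  rw [LinearMap.map_sub₂]
  linarith

/-- Conjugating an affine reflection by an automorphism of the arrangement. -/
theorem conj_affineReflection [Finite ι] [P.IsRootSystem] {g : N ≃ᵃ[ℝ] N}
    (hga : g ∈ arrangementAut P) (i : ι) (k : ℤ) :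
    ∃ j m, (∀ v, P.root' j (g v) - (m : ℤ) = P.root' i v - k) ∧
      g * affineReflection P i k * g⁻¹ = affineReflection P j m := by
  obtain ⟨π, c, hg⟩ := id hga
  have hi := hg (π.symm i)
  rw [Equiv.apply_symm_apply] at hi
  refine ⟨π.symm i, k + c (π.symm i), fun v => by rw [hi]; push_cast; ring, ?_⟩
  rw [mul_inv_eq_iff_eq_mul]
  ext v
  simp only [AffineEquiv.mul_def, AffineEquiv.trans_apply]
  rw [affineReflection_apply, affineReflection_apply, hi, ← linear_coroot hga hi, sub_eq_add_neg v,
    add_comm v, affineEquiv_add, map_neg, map_smul]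
  push_cast
  rw [add_comm, ← sub_eq_add_neg]
  congr 2
  ring

/-! ### Hyperplanes -/

/-- Moving `v` along the `i`-th coroot by half the value of the affine root projects it to the first
hyperplane, where the second affine root vanishes. -/
theorem root'_eq_of_hyperplane_subset {i j : ι} {k m : ℤ}
    (h : hyperplane P i k ⊆ hyperplane P j m) (v : N) :
    P.root' j v - m = P.pairing j i / 2 * (P.root' i v - k) := by
  have h1 : v - ((P.root' i v - k) / 2) • P.coroot i ∈ hyperplane P i k := by
    rw [hyperplane, Set.mem_ofPred_eq, map_sub, map_smul, root'_coroot_self, smul_eq_mul]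
    ring
  have h2 : P.root' j (v - ((P.root' i v - k) / 2) • P.coroot i) = m := h h1
  rw [map_sub, map_smul, root'_coroot, smul_eq_mul] at h2
  linear_combination h2

theorem eq_of_hyperplane_subset [P.IsReduced] {i j : ι} {k m : ℤ}
    (h : hyperplane P i k ⊆ hyperplane P j m) :
    (j = i ∧ m = k) ∨ (P.root j = -P.root i ∧ m = -k) := by
  have h1 := root'_eq_of_hyperplane_subset h
  have hr : P.root j = (P.pairing j i / 2) • P.root i := by
    apply P.isPerfPair_toLinearMap.bijective_left.injective
    ext v
    have e1 := h1 v
    have e2 := h1 0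
    rw [map_zero, map_zero] at e2
    rw [map_smul, LinearMap.smul_apply, smul_eq_mul]
    change P.root' j v = _ * P.root' i v
    linear_combination e1 - e2
  have hd : ¬LinearIndependent ℝ ![P.root j, P.root i] := by
    rw [LinearIndependent.pair_iff]
    intro hli
    have := (hli 1 (-(P.pairing j i / 2)) (by rw [hr]; module)).1
    exact one_ne_zero this
  have e := h1 0
  rw [map_zero, map_zero] at e
  have hp : ∀ c : ℝ, P.root j = c • P.root i → P.pairing j i / 2 = c := by
    intro c hc
    have := congrArg (fun f => P.toLinearMap f (P.coroot i)) hc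
    simp only [map_smul, LinearMap.smul_apply, P.root_coroot_eq_pairing, P.pairing_same,
      smul_eq_mul] at this
    linarith
  rcases RootPairing.IsReduced.eq_or_eq_neg j i hd with h2 | h2
  · refine Or.inl ⟨P.root.injective h2, ?_⟩
    rw [hp 1 (by rw [h2, one_smul])] at e
    have : (m : ℝ) = k := by linarith
    exact_mod_cast this
  · refine Or.inr ⟨h2, ?_⟩
    rw [hp (-1) (by rw [h2, neg_one_smul])] at e
    have : (m : ℝ) = -k := by linarith
    exact_mod_cast this

theorem root'_of_root_eq_neg {i j : ι} (h : P.root j = -P.root i) (v : N) :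
    P.root' j v = -P.root' i v := by
  rw [RootPairing.root', h, map_neg]
  rfl

theorem hyperplane_eq_of_root_eq_neg {i j : ι} (h : P.root j = -P.root i) (k : ℤ) :
    hyperplane P j (-k) = hyperplane P i k := by
  ext v
  simp only [hyperplane, Set.mem_ofPred_eq, root'_of_root_eq_neg h]
  push_cast
  rw [neg_inj]

theorem hyperplane_eq_of_subset [P.IsReduced] {i j : ι} {k m : ℤ}
    (h : hyperplane P i k ⊆ hyperplane P j m) : hyperplane P j m = hyperplane P i k := by
  rcases eq_of_hyperplane_subset h with ⟨rfl, rfl⟩ | ⟨h1, rfl⟩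
  · rfl
  · exact hyperplane_eq_of_root_eq_neg h1 k

theorem coroot_eq_neg {i j : ι} (h : P.root j = -P.root i) :
    P.coroot j = -P.coroot i := by
  exact P.coroot_eq_neg_iff.2 (P.root_eq_neg_iff.1 h)

theorem affineReflection_eq_of_hyperplane_eq [P.IsReduced] {i j : ι} {k m : ℤ}
    (h : hyperplane P i k = hyperplane P j m) : affineReflection P i k = affineReflection P j m := by
  rcases eq_of_hyperplane_subset h.le with ⟨rfl, rfl⟩ | ⟨h1, rfl⟩
  · rfl
  · ext v
    rw [affineReflection_apply, affineReflection_apply, root'_of_root_eq_neg h1, coroot_eq_neg h1]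
    push_cast
    module

end Arrangement

/-! ### Alcoves and the number of separating hyperplanes -/

section Alcove

variable {ι M N : Type*} [AddCommGroup M] [Module ℝ M] [AddCommGroup N] [Module ℝ N]

/-- Two (regular) points lie in the same alcove. -/
def SameAlcove (P : RootPairing ι ℝ M N) (x y : N) : Prop :=
  ∀ i, ⌊P.root' i x⌋ = ⌊P.root' i y⌋

/-- Twice the number of hyperplanes that separate two regular points. -/
noncomputable def alcoveDist [Fintype ι] (P : RootPairing ι ℝ M N) (x y : N) : ℕ :=
  ∑ i, (⌊P.root' i x⌋ - ⌊P.root' i y⌋).natAbs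

variable {P : RootPairing ι ℝ M N} {x y z : N}

theorem IsRegularPoint.ne (hx : IsRegularPoint P x) (i : ι) (k : ℤ) : P.root' i x ≠ k := hx i k

theorem IsRegularPoint.sub_ne_zero (hx : IsRegularPoint P x) (i : ι) (k : ℤ) :
    P.root' i x - k ≠ 0 := _root_.sub_ne_zero.2 (hx i k)

/-- Away from the level itself, separation depends on floors only. The interval is half-open because
`k` lies below `r` exactly when `k ≤ ⌊r⌋`. -/
theorem mul_sub_neg_iff {r s : ℝ} {k : ℤ} (hr : r ≠ k) (hs : s ≠ k) :
    (r - k) * (s - k) < 0 ↔ k ∈ Finset.Ioc (min ⌊r⌋ ⌊s⌋) (max ⌊r⌋ ⌊s⌋) := by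
  rw [Finset.mem_Ioc, min_lt_iff, le_max_iff, Int.le_floor, Int.le_floor, Int.floor_lt,
    Int.floor_lt, mul_neg_iff]
  rcases lt_or_gt_of_ne hr with h1 | h1 <;> rcases lt_or_gt_of_ne hs with h2 | h2 <;>
    simp [h1, h2, h1.le, h2.le, h1.not_ge, h2.not_ge, h1.not_gt, h2.not_gt]

theorem card_Ioc_floor (a b : ℤ) : (Finset.Ioc (min a b) (max a b)).card = (a - b).natAbs := by
  rw [Int.card_Ioc]
  omega

theorem mul_sub_eq_of_hyperplane_eq [P.IsReduced] {i j : ι} {k m : ℤ}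
    (h : hyperplane P i k = hyperplane P j m) (x y : N) :
    (P.root' i x - k) * (P.root' i y - k) = (P.root' j x - m) * (P.root' j y - m) := by
  rcases eq_of_hyperplane_subset h.le with ⟨rfl, rfl⟩ | ⟨h1, rfl⟩
  · rfl
  · rw [root'_of_root_eq_neg h1, root'_of_root_eq_neg h1]
    push_cast
    ring

theorem mem_separatingHyperplanes [P.IsReduced] {i : ι} {k : ℤ} :
    hyperplane P i k ∈ separatingHyperplanes P x y ↔
      (P.root' i x - k) * (P.root' i y - k) < 0 := by
  refine ⟨?_, fun h => ⟨i, k, rfl, h⟩⟩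
  rintro ⟨j, m, h, hlt⟩
  rwa [mul_sub_eq_of_hyperplane_eq h]

theorem separatingHyperplanes_comm (x y : N) :
    separatingHyperplanes P x y = separatingHyperplanes P y x := by
  simp only [separatingHyperplanes, mul_comm]

/-- The affine roots that separate two points. -/
noncomputable def separatingRoots [Fintype ι] (P : RootPairing ι ℝ M N) (x y : N) :
    Finset (Σ _ : ι, ℤ) :=
  Finset.univ.sigma fun i => Finset.Ioc (min ⌊P.root' i x⌋ ⌊P.root' i y⌋)
    (max ⌊P.root' i x⌋ ⌊P.root' i y⌋)

theorem mem_separatingRoots [Fintype ι] (hx : IsRegularPoint P x) (hy : IsRegularPoint P y)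
    (a : Σ _ : ι, ℤ) : a ∈ separatingRoots P x y ↔
      (P.root' a.1 x - a.2) * (P.root' a.1 y - a.2) < 0 := by
  rw [separatingRoots, Finset.mem_sigma, mul_sub_neg_iff (hx.ne _ _) (hy.ne _ _)]
  simp

theorem separatingHyperplanes_eq_image [Fintype ι] (hx : IsRegularPoint P x)
    (hy : IsRegularPoint P y) :
    separatingHyperplanes P x y = (fun a : Σ _ : ι, ℤ => hyperplane P a.1 a.2) ''
      (separatingRoots P x y : Set (Σ _ : ι, ℤ)) := by
  ext H
  simp only [Set.mem_image, Finset.mem_coe, mem_separatingRoots hx hy]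
  constructor
  · rintro ⟨i, k, rfl, h⟩
    exact ⟨⟨i, k⟩, h, rfl⟩
  · rintro ⟨⟨i, k⟩, h, rfl⟩
    exact ⟨i, k, rfl, h⟩

theorem finite_separatingHyperplanes [Finite ι] (hx : IsRegularPoint P x)
    (hy : IsRegularPoint P y) : (separatingHyperplanes P x y).Finite := by
  have := Fintype.ofFinite ι
  rw [separatingHyperplanes_eq_image hx hy]
  exact (Finset.finite_toSet _).image _

/-- A hyperplane is cut out by `(α, k)` and `(-α, -k)` and, by reducedness, by no other affine root,
so each fibre of the map from separating affine roots to hyperplanes has two elements. -/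
theorem two_mul_ncard_separatingHyperplanes [Fintype ι] [P.IsReduced] (hx : IsRegularPoint P x)
    (hy : IsRegularPoint P y) :
    2 * (separatingHyperplanes P x y).ncard = alcoveDist P x y := by
  classical
  have h1 : (separatingRoots P x y).card = alcoveDist P x y := by
    rw [separatingRoots, Finset.card_sigma, alcoveDist]
    exact Finset.sum_congr rfl fun i _ => card_Ioc_floor _ _
  rw [← h1, separatingHyperplanes_eq_image hx hy, ← Finset.coe_image, Set.ncard_coe_finset,
    Finset.card_eq_sum_card_image (fun a : Σ _ : ι, ℤ => hyperplane P a.1 a.2),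
    Finset.sum_const_nat (m := 2), mul_comm]
  intro H hH
  obtain ⟨⟨i, k⟩, hik, rfl⟩ := Finset.mem_image.1 hH
  have hne : (⟨i, k⟩ : Σ _ : ι, ℤ) ≠ ⟨P.reflectionPerm i i, -k⟩ := by
    intro h
    exact P.ne_neg i (congrArg Sigma.fst h)
  have hneg : P.root (P.reflectionPerm i i) = -P.root i := P.root_eq_neg_iff.2 rfl
  rw [← Finset.card_pair hne]
  congr 1
  ext ⟨j, m⟩
  rw [Finset.mem_filter, Finset.mem_insert, Finset.mem_singleton, mem_separatingRoots hx hy]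
  rw [mem_separatingRoots hx hy] at hik
  constructor
  · rintro ⟨-, h⟩
    rcases eq_of_hyperplane_subset h.ge with ⟨rfl, rfl⟩ | ⟨h1, rfl⟩
    · exact Or.inl rfl
    · rw [P.root_eq_neg_iff] at h1
      subst h1
      exact Or.inr rfl
  · rintro (h | h)
    · cases h
      exact ⟨hik, rfl⟩
    · cases h
      have := hyperplane_eq_of_root_eq_neg hneg k
      exact ⟨by rw [← mul_sub_eq_of_hyperplane_eq this.symm]; exact hik, this⟩

theorem alcoveDist_comm [Fintype ι] (x y : N) : alcoveDist P x y = alcoveDist P y x :=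
  Finset.sum_congr rfl fun i _ => by omega

theorem alcoveDist_triangle [Fintype ι] (x y z : N) :
    alcoveDist P x z ≤ alcoveDist P x y + alcoveDist P y z := by
  rw [alcoveDist, alcoveDist, alcoveDist, ← Finset.sum_add_distrib]
  exact Finset.sum_le_sum fun i _ => by omega

theorem SameAlcove.symm (h : SameAlcove P x y) : SameAlcove P y x := fun i => (h i).symm

theorem alcoveDist_congr [Fintype ι] {x' y' : N} (hx : SameAlcove P x x')
    (hy : SameAlcove P y y') : alcoveDist P x y = alcoveDist P x' y' :=
  Finset.sum_congr rfl fun i _ => by rw [hx i, hy i]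

theorem alcoveDist_eq_zero [Fintype ι] : alcoveDist P x y = 0 ↔ SameAlcove P x y := by
  rw [alcoveDist, Finset.sum_eq_zero_iff]
  simp only [Finset.mem_univ, true_imp_iff, Int.natAbs_eq_zero, _root_.sub_eq_zero]
  rfl

theorem alcoveDist_map [Fintype ι] {g : N ≃ᵃ[ℝ] N} (hg : g ∈ arrangementAut P) (x y : N) :
    alcoveDist P (g x) (g y) = alcoveDist P x y := by
  obtain ⟨π, k, hg⟩ := hg
  simp only [alcoveDist, hg, Int.floor_add_intCast, add_sub_add_right_eq_sub]
  exact Equiv.sum_comp π fun i => (⌊P.root' i x⌋ - ⌊P.root' i y⌋).natAbs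

theorem SameAlcove.map {g : N ≃ᵃ[ℝ] N} (hg : g ∈ arrangementAut P) (h : SameAlcove P x y) :
    SameAlcove P (g x) (g y) := by
  obtain ⟨π, k, hg⟩ := hg
  intro i
  rw [hg, hg, Int.floor_add_intCast, Int.floor_add_intCast, h]

theorem IsRegularPoint.map {g : N ≃ᵃ[ℝ] N} (hg : g ∈ arrangementAut P) (h : IsRegularPoint P x) :
    IsRegularPoint P (g x) := by
  obtain ⟨π, k, hg⟩ := hg
  intro i m hm
  refine h (π i) (m - k i) ?_
  have : P.root' i (g x) = m := hm
  rw [hg] at this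
  rw [hyperplane, Set.mem_ofPred_eq]
  push_cast
  linarith

theorem ncard_separatingHyperplanes_map [Finite ι] [P.IsReduced] {g : N ≃ᵃ[ℝ] N}
    (hg : g ∈ arrangementAut P) (hx : IsRegularPoint P x) (hy : IsRegularPoint P y) :
    (separatingHyperplanes P (g x) (g y)).ncard = (separatingHyperplanes P x y).ncard := by
  have := Fintype.ofFinite ι
  have h1 := two_mul_ncard_separatingHyperplanes hx hy
  have h2 := two_mul_ncard_separatingHyperplanes (hx.map hg) (hy.map hg)
  rw [alcoveDist_map hg] at h2
  omega

/-- The hyperplane `⟨α_i, v⟩ = k` is the only one that separates `x` from `y`. -/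
structure IsAdjacent (P : RootPairing ι ℝ M N) (i : ι) (k : ℤ) (x y : N) : Prop where
  sep : (P.root' i x - k) * (P.root' i y - k) < 0
  same : ∀ j m, hyperplane P j m ≠ hyperplane P i k → 0 < (P.root' j x - m) * (P.root' j y - m)

theorem IsAdjacent.symm {i : ι} {k : ℤ} (h : IsAdjacent P i k x y) : IsAdjacent P i k y x :=
  ⟨by rw [mul_comm]; exact h.sep, fun j m hjm => by rw [mul_comm]; exact h.same j m hjm⟩

theorem mul_neg_of_mul_pos {a b c : ℝ} (h1 : 0 < a * b) (h2 : a * c < 0) : b * c < 0 := by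
  rcases mul_pos_iff.1 h1 with h | h <;> rcases mul_neg_iff.1 h2 with h' | h' <;>
    first
    | exact mul_neg_of_pos_of_neg (by linarith) (by linarith)
    | exact mul_neg_of_neg_of_pos (by linarith) (by linarith)

theorem mul_pos_of_mul_neg {a b c : ℝ} (h1 : a * b < 0) (h2 : a * c < 0) : 0 < b * c := by
  rcases mul_neg_iff.1 h1 with h | h <;> rcases mul_neg_iff.1 h2 with h' | h' <;>
    first
    | exact mul_pos (by linarith) (by linarith)
    | exact mul_pos_of_neg_of_neg (by linarith) (by linarith)

theorem IsAdjacent.ncard_eq [Finite ι] [P.IsReduced] {i : ι} {k : ℤ} (h : IsAdjacent P i k x y)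
    (hy : IsRegularPoint P y) (hz : IsRegularPoint P z)
    (hxz : (P.root' i x - k) * (P.root' i z - k) < 0) :
    (separatingHyperplanes P x z).ncard = (separatingHyperplanes P y z).ncard + 1 := by
  have e : separatingHyperplanes P x z = insert (hyperplane P i k) (separatingHyperplanes P y z) := by
    ext H
    rw [Set.mem_insert_iff]
    constructor
    · rintro ⟨j, m, rfl, hlt⟩
      by_cases hjm : hyperplane P j m = hyperplane P i k
      · exact Or.inl hjm
      · exact Or.inr ⟨j, m, rfl, mul_neg_of_mul_pos (h.same j m hjm) hlt⟩
    · rintro (rfl | ⟨j, m, rfl, hlt⟩)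
      · exact ⟨i, k, rfl, hxz⟩
      · by_cases hjm : hyperplane P j m = hyperplane P i k
        · exact ⟨i, k, hjm, hxz⟩
        · exact ⟨j, m, rfl, mul_neg_of_mul_pos (h.symm.same j m hjm) hlt⟩
  rw [e, Set.ncard_insert_of_notMem _ (finite_separatingHyperplanes hy hz)]
  rw [mem_separatingHyperplanes, not_lt]
  exact (mul_pos_of_mul_neg h.sep hxz).le

/-- The reflection in a wall of an alcove moves it to an adjacent one. -/
theorem IsWall.isAdjacent [Finite ι] [P.IsRootSystem] [P.IsCrystallographic]
    (hx : IsRegularPoint P x) {i : ι} {k : ℤ} (h : IsWall P x i k) :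
    IsAdjacent P i k x (affineReflection P i k x) := by
  obtain ⟨p, hp, hpos⟩ := h
  refine ⟨?_, fun j m hjm => ?_⟩
  · rw [root'_affineReflection_self]
    have := pow_pos (abs_pos.2 (hx.sub_ne_zero i k)) 2
    rw [sq_abs] at this
    linarith
  · obtain ⟨j', m', he, -⟩ := conj_affineReflection (P := P)
      (affineReflection_mem_arrangementAut i k) j m
    -- As the reflection fixes `p`, the affine root `(j, m)` and its reflection `(j', m')` agree at
    -- `p`. Since `x` is on the side of `p` for both, `x` and its mirror image are on the same side
    -- of `(j, m)`.
    have hpp : affineReflection P i k p = p := by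
      have : P.root' i p = k := hp
      rw [affineReflection_apply, this, sub_self, zero_smul, sub_zero]
    have hinv : ∀ v, P.root' j (affineReflection P i k v) - m = P.root' j' v - m' := fun v => by
      rw [← he, affineReflection_affineReflection]
    have hne : hyperplane P j' m' ≠ hyperplane P i k := by
      intro heq
      apply hjm
      ext v
      have h1 : v ∈ hyperplane P j m ↔ affineReflection P i k v ∈ hyperplane P j' m' := by
        simp only [hyperplane, Set.mem_ofPred_eq]
        rw [← _root_.sub_eq_zero, ← he, _root_.sub_eq_zero]
      rw [h1, heq]
      simp only [hyperplane, Set.mem_ofPred_eq, root'_affineReflection_self]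
      constructor <;> intro h <;> linarith
    have h1 := hpos j m hjm
    have h2 := hpos j' m' hne
    rw [← hinv p, hpp] at h2
    rw [hinv x]
    by_contra hcon
    have h3 : P.root' j' x - m' ≠ 0 := hx.sub_ne_zero _ _
    have h4 : (P.root' j x - m) * (P.root' j' x - m') < 0 :=
      lt_of_le_of_ne (not_lt.1 hcon) (mul_ne_zero (hx.sub_ne_zero _ _) h3)
    rw [mul_comm] at h1
    have h5 := mul_neg_of_mul_pos h1 h4
    linarith

end Alcove

/-! ### Walls that separate an alcove from a given point -/

section Walls

open Filter Topology

variable {ι M N : Type*} [AddCommGroup M] [Module ℝ M] [AddCommGroup N] [Module ℝ N]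
  {P : RootPairing ι ℝ M N} {x y z : N}

theorem IsRegularPoint.floor_lt (hx : IsRegularPoint P x) (i : ι) :
    (⌊P.root' i x⌋ : ℝ) < P.root' i x :=
  lt_of_le_of_ne (Int.floor_le _) (hx.ne i _).symm

/-- A regular point can be moved inside its alcove so as to avoid finitely many affine
hyperplanes. -/
theorem IsRegularPoint.exists_generic [Finite ι] (hz : IsRegularPoint P z) {κ : Type*} [Finite κ]
    (f : κ → Module.Dual ℝ N) (c : κ → ℝ) (hf : ∀ a, f a ≠ 0 ∨ f a z + c a ≠ 0) :
    ∃ z', SameAlcove P z z' ∧ IsRegularPoint P z' ∧ ∀ a, f a z' + c a ≠ 0 := by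
  -- A direction on which no nonzero form of the family vanishes: a small step along it leaves all
  -- the zero loci and stays in the alcove.
  obtain ⟨u, hu⟩ := Module.Dual.exists_forall_ne_zero_of_forall_exists
    (fun a : {a // f a ≠ 0} => f a.1) fun a => by
      by_contra! h
      exact a.2 (LinearMap.ext h)
  have hlim : ∀ g : Module.Dual ℝ N, Tendsto (fun ε : ℝ => g (z + ε • u)) (𝓝[>] 0) (𝓝 (g z)) := by
    intro g
    have : Continuous fun ε : ℝ => g (z + ε • u) := by
      simp only [map_add, map_smul, smul_eq_mul]
      fun_prop
    have h := this.tendsto 0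
    simp only [zero_smul, add_zero] at h
    exact h.mono_left nhdsWithin_le_nhds
  have h1 : ∀ᶠ ε : ℝ in 𝓝[>] 0, ∀ i, P.root' i (z + ε • u) ∈
      Set.Ioo (⌊P.root' i z⌋ : ℝ) (⌊P.root' i z⌋ + 1) := by
    rw [eventually_all]
    exact fun i => (hlim (P.root' i)).eventually
      (Ioo_mem_nhds (hz.floor_lt i) (Int.lt_floor_add_one _))
  have h2 : ∀ᶠ ε : ℝ in 𝓝[>] 0, ∀ a, f a (z + ε • u) + c a ≠ 0 := by
    rw [eventually_all]
    intro a
    by_cases h0 : f a z + c a = 0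
    · have hfa : f a ≠ 0 := (hf a).resolve_right (not_not.2 h0)
      filter_upwards [self_mem_nhdsWithin] with ε hε
      have : f a (z + ε • u) + c a = ε * f a u := by
        rw [map_add, map_smul, smul_eq_mul]
        linarith
      rw [this]
      exact mul_ne_zero (ne_of_gt hε) (hu ⟨a, hfa⟩)
    · exact ((hlim (f a)).add_const (c a)).eventually_ne h0
  obtain ⟨ε, h1, h2⟩ := (h1.and h2).exists
  have hfl : SameAlcove P z (z + ε • u) := fun i =>
    (Int.floor_eq_iff.2 ⟨(h1 i).1.le, (h1 i).2⟩).symm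
  refine ⟨z + ε • u, hfl, fun i k hk => ?_, h2⟩
  have hk : P.root' i (z + ε • u) = k := hk
  have h3 := h1 i
  rw [hfl i, hk, Int.floor_intCast] at h3
  exact lt_irrefl _ h3.1

theorem SameAlcove.mul_sub_neg_iff (hx : IsRegularPoint P x) (hy : IsRegularPoint P y)
    (hz : IsRegularPoint P z) (h : SameAlcove P y z) {i : ι} {k : ℤ} :
    (P.root' i x - k) * (P.root' i y - k) < 0 ↔ (P.root' i x - k) * (P.root' i z - k) < 0 := by
  rw [IwahoriWeyl.mul_sub_neg_iff (hx.ne _ _) (hy.ne _ _),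
    IwahoriWeyl.mul_sub_neg_iff (hx.ne _ _) (hz.ne _ _), h i]

theorem exists_mul_sub_neg (hx : IsRegularPoint P x) (hy : IsRegularPoint P y)
    (h : ¬SameAlcove P x y) : ∃ (i : ι) (k : ℤ), (P.root' i x - k) * (P.root' i y - k) < 0 := by
  simp only [SameAlcove, not_forall] at h
  obtain ⟨i, hi⟩ := h
  refine ⟨i, max ⌊P.root' i x⌋ ⌊P.root' i y⌋, ?_⟩
  rw [mul_sub_neg_iff (hx.ne _ _) (hy.ne _ _), Finset.mem_Ioc]
  exact ⟨min_lt_max.2 hi, le_rfl⟩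

theorem not_sameAlcove (hx : IsRegularPoint P x) (hy : IsRegularPoint P y) {i : ι} {k : ℤ}
    (h : (P.root' i x - k) * (P.root' i y - k) < 0) : ¬SameAlcove P x y := by
  intro hs
  rw [mul_sub_neg_iff (hx.ne _ _) (hy.ne _ _), hs i] at h
  simp at h

/-- If two regular points lie in different alcoves, then a wall of the alcove of the first point
separates them. -/
theorem exists_isWall [Finite ι] [P.IsReduced] (hx : IsRegularPoint P x) (hz : IsRegularPoint P z)
    (hxz : ¬SameAlcove P x z) :
    ∃ (i : ι) (k : ℤ), IsWall P x i k ∧ (P.root' i x - k) * (P.root' i z - k) < 0 := by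
  have := Fintype.ofFinite ι
  let T := separatingRoots P x z
  let κ := {p : T × T // hyperplane P p.1.1.1 p.1.1.2 ≠ hyperplane P p.2.1.1 p.2.1.2}
  -- The segment from `x` should meet distinct separating hyperplanes at distinct times. If an
  -- affine root has values `a` and `b` at the ends, the time is `a / (a - b)`; the affine form
  -- below vanishes exactly when two such times agree.
  obtain ⟨z', hzz', hz', hgen⟩ := hz.exists_generic (κ := κ)
    (fun p => (P.root' p.1.1.1.1 x - p.1.1.1.2) • P.root' p.1.2.1.1 -
      (P.root' p.1.2.1.1 x - p.1.2.1.2) • P.root' p.1.1.1.1)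
    (fun p => (P.root' p.1.2.1.1 x - p.1.2.1.2) * p.1.1.1.2 -
      (P.root' p.1.1.1.1 x - p.1.1.1.2) * p.1.2.1.2) (by
    rintro ⟨⟨⟨⟨i, k⟩, hik⟩, ⟨⟨j, m⟩, hjm⟩⟩, hne⟩
    by_contra! hcon
    obtain ⟨h1, h2⟩ := hcon
    apply hne
    refine (hyperplane_eq_of_subset fun y hy => ?_).symm
    have hy : P.root' i y = k := hy
    have h1 := congrArg (fun g => g (y - z)) h1
    simp only [LinearMap.sub_apply, LinearMap.smul_apply, map_sub, smul_eq_mul,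
      LinearMap.zero_apply] at h1 h2
    have h3 : (P.root' i x - k) * (P.root' j y - m) = 0 := by
      rw [hy] at h1
      linear_combination h1 + h2
    have h4 := (mul_eq_zero.1 h3).resolve_left (hx.sub_ne_zero i k)
    exact _root_.sub_eq_zero.1 h4)
  simp only [LinearMap.sub_apply, LinearMap.smul_apply, smul_eq_mul] at hgen
  have hT : ∀ a : Σ _ : ι, ℤ, a ∈ T ↔ (P.root' a.1 x - a.2) * (P.root' a.1 z' - a.2) < 0 :=
    fun a => (mem_separatingRoots hx hz a).trans (hzz'.mul_sub_neg_iff hx hz hz')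
  obtain ⟨i₀, k₀, h₀⟩ := exists_mul_sub_neg hx hz hxz
  let τ : (Σ _ : ι, ℤ) → ℝ := fun a =>
    (P.root' a.1 x - a.2) / ((P.root' a.1 x - a.2) - (P.root' a.1 z' - a.2))
  -- The hyperplane that is met first is a wall, witnessed by the point where the segment meets it.
  obtain ⟨⟨i, k⟩, hikT, hmin⟩ := Finset.exists_min_image T τ
    ⟨⟨i₀, k₀⟩, (mem_separatingRoots hx hz _).2 h₀⟩
  have hik := (hT _).1 hikT
  refine ⟨i, k, ⟨x + τ ⟨i, k⟩ • (z' - x), ?_, fun j m hjm => ?_⟩,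
    (mem_separatingRoots hx hz ⟨i, k⟩).1 hikT⟩
  · have hd : (P.root' i x - k) - (P.root' i z' - k) ≠ 0 := by
      rcases mul_neg_iff.1 hik with h | h
      · exact ne_of_gt (by linarith [h.1, h.2])
      · exact ne_of_lt (by linarith [h.1, h.2])
    rw [hyperplane, Set.mem_ofPred_eq, map_add, map_smul, map_sub, smul_eq_mul]
    simp only [τ]
    have e : P.root' i z' - P.root' i x = -((P.root' i x - k) - (P.root' i z' - k)) := by ring
    rw [e, mul_neg, div_mul_cancel₀ _ hd]
    ring
  · have hpos : ∀ a ∈ T, 0 < τ a ∧ τ a < 1 := by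
      intro a ha
      rcases mul_neg_iff.1 ((hT a).1 ha) with h | h
      · exact ⟨div_pos h.1 (by linarith [h.1, h.2]),
          (div_lt_one (by linarith [h.1, h.2])).2 (by linarith [h.1, h.2])⟩
      · exact ⟨div_pos_of_neg_of_neg h.1 (by linarith [h.1, h.2]),
          (div_lt_one_of_neg (by linarith [h.1, h.2])).2 (by linarith [h.1, h.2])⟩
    obtain ⟨hτ0, hτ1⟩ := hpos _ hikT
    set t := τ ⟨i, k⟩ with ht
    have e : P.root' j (x + t • (z' - x)) - m =
        (1 - t) * (P.root' j x - m) + t * (P.root' j z' - m) := by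
      rw [map_add, map_smul, map_sub, smul_eq_mul]
      ring
    rw [e]
    set a := P.root' j x - m with ha
    set b := P.root' j z' - m with hb
    have ha0 : a ≠ 0 := hx.sub_ne_zero j m
    have hb0 : b ≠ 0 := hz'.sub_ne_zero j m
    have ha2 : 0 < a * a := mul_self_pos.2 ha0
    by_cases hab : a * b < 0
    · have hjT : (⟨j, m⟩ : Σ _ : ι, ℤ) ∈ T := (hT _).2 hab
      have hle : t ≤ a / (a - b) := hmin _ hjT
      have hd : a - b ≠ 0 := by
        rcases mul_neg_iff.1 hab with h | h
        · exact ne_of_gt (by linarith [h.1, h.2])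
        · exact ne_of_lt (by linarith [h.1, h.2])
      have hd' : (P.root' i x - k) - (P.root' i z' - k) ≠ 0 := by
        rcases mul_neg_iff.1 hik with h | h
        · exact ne_of_gt (by linarith [h.1, h.2])
        · exact ne_of_lt (by linarith [h.1, h.2])
      have hne : t ≠ a / (a - b) := by
        intro heq
        have hgen' := hgen ⟨⟨⟨⟨i, k⟩, hikT⟩, ⟨⟨j, m⟩, hjT⟩⟩, hjm.symm⟩
        apply hgen'
        simp only [ht, τ] at heq
        rw [div_eq_div_iff hd' hd] at heq
        simp only [ha, hb] at heq
        simp only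
        linear_combination -heq
      have hlt : t < a / (a - b) := lt_of_le_of_ne hle hne
      have : ((1 - t) * a + t * b) * a = (a / (a - b) - t) * ((a - b) * a) := by
        field_simp
        ring
      rw [this]
      exact mul_pos (by linarith) (by nlinarith)
    · have hab' : 0 < a * b := lt_of_le_of_ne (not_lt.1 hab) (mul_ne_zero ha0 hb0).symm
      nlinarith [mul_pos hτ0 hab', mul_pos (sub_pos.2 hτ1) ha2]

end Walls

/-! ### The affine Weyl group as a Coxeter group -/

section Coxeter

variable {ι M N : Type*} [AddCommGroup M] [Module ℝ M] [AddCommGroup N] [Module ℝ N]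
  {P : RootPairing ι ℝ M N} {x₀ : N}

/-- The affine reflections as elements of the affine Weyl group. -/
def affineReflection' (P : RootPairing ι ℝ M N) (i : ι) (k : ℤ) : affineWeylGroup P :=
  ⟨affineReflection P i k, Subgroup.subset_closure ⟨i, k, rfl⟩⟩

theorem coe_mul_apply (v w : affineWeylGroup P) (x : N) :
    ((v * w : affineWeylGroup P) : N ≃ᵃ[ℝ] N) x = (v : N ≃ᵃ[ℝ] N) ((w : N ≃ᵃ[ℝ] N) x) := rfl

theorem coe_one_apply (x : N) : ((1 : affineWeylGroup P) : N ≃ᵃ[ℝ] N) x = x := rfl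

theorem affineReflection'_mul_self (i : ι) (k : ℤ) :
    affineReflection' P i k * affineReflection' P i k = 1 :=
  Subtype.ext (affineReflection_mul_self i k)

theorem mem_affineSimpleReflections {s : affineWeylGroup P} :
    s ∈ affineSimpleReflections P x₀ ↔ ∃ i k, IsWall P x₀ i k ∧ s = affineReflection' P i k :=
  exists_congr fun _ => exists_congr fun _ => and_congr_right fun _ => by
    rw [Subtype.ext_iff]; rfl

theorem affineLength_one : affineLength P x₀ 1 = 0 := by
  rw [affineLength, coe_one_apply]
  convert Set.ncard_empty (Set N)
  rw [Set.eq_empty_iff_forall_notMem]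
  rintro H ⟨i, k, -, h⟩
  exact absurd h (not_lt.2 (mul_self_nonneg _))

theorem coe_mem_arrangementAut [P.IsCrystallographic] (w : affineWeylGroup P) : (w : N ≃ᵃ[ℝ] N) ∈ arrangementAut P :=
  affineWeylGroup_le_arrangementAut w.2

theorem affineReflection_mul_self_pos (hx : IsRegularPoint P x₀) (i : ι) (k : ℤ) :
    (P.root' i x₀ - k) * (P.root' i (affineReflection P i k x₀) - k) < 0 := by
  rw [root'_affineReflection_self]
  have := mul_self_pos.2 (hx.sub_ne_zero i k)
  linarith

theorem ncard_separatingHyperplanes_eq_zero [Finite ι] [P.IsReduced] (hx : IsRegularPoint P x₀) {y : N}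
    (hy : IsRegularPoint P y) :
    (separatingHyperplanes P x₀ y).ncard = 0 ↔ SameAlcove P x₀ y := by
  have := Fintype.ofFinite ι
  rw [← alcoveDist_eq_zero, ← two_mul_ncard_separatingHyperplanes hx hy]
  omega

theorem affineReflection'_eq_of_hyperplane_eq [P.IsReduced] {i j : ι} {k m : ℤ}
    (h : hyperplane P i k = hyperplane P j m) :
    affineReflection' P i k = affineReflection' P j m :=
  Subtype.ext (affineReflection_eq_of_hyperplane_eq h)

theorem affineSimpleReflections_mul_self {s : affineWeylGroup P}
    (hs : s ∈ affineSimpleReflections P x₀) : s * s = 1 := by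
  obtain ⟨i, k, -, rfl⟩ := mem_affineSimpleReflections.1 hs
  exact affineReflection'_mul_self i k

theorem IsRegularPoint.smul [P.IsCrystallographic] (hx : IsRegularPoint P x₀) (w : affineWeylGroup P) :
    IsRegularPoint P ((w : N ≃ᵃ[ℝ] N) x₀) := hx.map (coe_mem_arrangementAut w)

theorem conj_affineReflection' [Finite ι] [P.IsRootSystem] [P.IsCrystallographic] (w : affineWeylGroup P) (i : ι) (k : ℤ) :
    ∃ j m, (∀ v, P.root' j ((w : N ≃ᵃ[ℝ] N) v) - (m : ℤ) = P.root' i v - k) ∧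
      w * affineReflection' P i k * w⁻¹ = affineReflection' P j m := by
  obtain ⟨j, m, h1, h2⟩ := conj_affineReflection (coe_mem_arrangementAut w) i k
  exact ⟨j, m, h1, Subtype.ext h2⟩

set_option linter.unusedSectionVars false

variable [Finite ι] [P.IsRootSystem] [P.IsCrystallographic] [P.IsReduced]

/-- Applying the reflection `s` turns the separation of `x₀` from `s w x₀` into that of `s x₀` from
`w x₀`, and `s x₀` is adjacent to `x₀`. -/
theorem affineLength_wall_mul (hx : IsRegularPoint P x₀) {i : ι} {k : ℤ} (h : IsWall P x₀ i k)
    (w : affineWeylGroup P) :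
    ((P.root' i x₀ - k) * (P.root' i ((w : N ≃ᵃ[ℝ] N) x₀) - k) < 0 →
      affineLength P x₀ w = affineLength P x₀ (affineReflection' P i k * w) + 1) ∧
    (¬(P.root' i x₀ - k) * (P.root' i ((w : N ≃ᵃ[ℝ] N) x₀) - k) < 0 →
      affineLength P x₀ (affineReflection' P i k * w) = affineLength P x₀ w + 1) := by
  have hadj := h.isAdjacent hx
  have hs := affineReflection_mem_arrangementAut (P := P) i k
  have e : affineLength P x₀ (affineReflection' P i k * w) =
      (separatingHyperplanes P (affineReflection P i k x₀) ((w : N ≃ᵃ[ℝ] N) x₀)).ncard := by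
    rw [← ncard_separatingHyperplanes_map hs (hx.map hs) (hx.smul w),
      affineReflection_affineReflection]
    rfl
  rw [e]
  refine ⟨fun hsep => hadj.ncard_eq (hx.map hs) (hx.smul w) hsep, fun hsep => ?_⟩
  refine hadj.symm.ncard_eq hx (hx.smul w) ?_
  have h1 : 0 < (P.root' i x₀ - k) * (P.root' i ((w : N ≃ᵃ[ℝ] N) x₀) - k) :=
    lt_of_le_of_ne (not_lt.1 hsep)
      (mul_ne_zero (hx.sub_ne_zero i k) ((hx.smul w).sub_ne_zero i k)).symm
  rw [mul_comm]
  exact mul_neg_of_mul_pos h1 hadj.sep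

theorem affineLength_simple_mul (hx : IsRegularPoint P x₀) {s : affineWeylGroup P}
    (hs : s ∈ affineSimpleReflections P x₀) (w : affineWeylGroup P) :
    affineLength P x₀ (s * w) = affineLength P x₀ w + 1 ∨
      affineLength P x₀ w = affineLength P x₀ (s * w) + 1 := by
  obtain ⟨i, k, hik, rfl⟩ := mem_affineSimpleReflections.1 hs
  have := affineLength_wall_mul hx hik w
  by_cases hsep : (P.root' i x₀ - k) * (P.root' i ((w : N ≃ᵃ[ℝ] N) x₀) - k) < 0
  · exact Or.inr (this.1 hsep)
  · exact Or.inl (this.2 hsep)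

theorem affineLength_inv (hx : IsRegularPoint P x₀) (w : affineWeylGroup P) :
    affineLength P x₀ w⁻¹ = affineLength P x₀ w := by
  rw [affineLength, ← ncard_separatingHyperplanes_map (coe_mem_arrangementAut w) hx (hx.smul _),
    ← coe_mul_apply, mul_inv_cancel, coe_one_apply, separatingHyperplanes_comm, affineLength]

theorem exists_descent_affine (hx : IsRegularPoint P x₀) (w : affineWeylGroup P)
    (hw : affineLength P x₀ w ≠ 0) :
    ∃ s ∈ affineSimpleReflections P x₀, affineLength P x₀ (s * w) < affineLength P x₀ w := by
  obtain ⟨i, k, hik, hsep⟩ := exists_isWall hx (hx.smul w)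
    fun h => hw ((ncard_separatingHyperplanes_eq_zero hx (hx.smul w)).2 h)
  refine ⟨_, mem_affineSimpleReflections.2 ⟨i, k, hik, rfl⟩, ?_⟩
  have := (affineLength_wall_mul hx hik w).1 hsep
  omega

/-- Induction on the length of the reflection `r`. Some wall of the base alcove, with reflection
`s`, separates `x₀` from `r x₀`. Either `r = s`, or `s r s` is a reflection whose length is smaller
by two. -/
theorem affineReflection'_mem_closure (hx : IsRegularPoint P x₀) (i : ι) (k : ℤ) :
    affineReflection' P i k ∈ Subgroup.closure (affineSimpleReflections P x₀) := by
  induction hn : affineLength P x₀ (affineReflection' P i k) using Nat.strong_induction_on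
    generalizing i k with
  | _ n ih =>
    subst hn
    set r := affineReflection' P i k with hr
    have hsep := affineReflection_mul_self_pos hx i k
    obtain ⟨j, m, hw, hjm⟩ := exists_isWall hx (hx.smul r) (not_sameAlcove hx (hx.smul r) hsep)
    set s := affineReflection' P j m with hs
    have hsS : s ∈ affineSimpleReflections P x₀ := mem_affineSimpleReflections.2 ⟨j, m, hw, rfl⟩
    by_cases heq : hyperplane P i k = hyperplane P j m
    · rw [hr, affineReflection'_eq_of_hyperplane_eq heq]
      exact Subgroup.subset_closure hsS
    · have hss : s * s = 1 := affineReflection'_mul_self j m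
      have hsi : s⁻¹ = s := inv_eq_of_mul_eq_one_left hss
      have hri : r⁻¹ = r := inv_eq_of_mul_eq_one_left (affineReflection'_mul_self i k)
      obtain ⟨i', k', -, hc⟩ := conj_affineReflection' s i k
      obtain ⟨j', m', hc1, hc2⟩ := conj_affineReflection' r j m
      -- If `r` stabilized the wall, either the roots would be orthogonal and `r x₀` would stay on
      -- the side of `x₀`, or the wall would be contained in the mirror of `r`. Both are excluded.
      have hne : hyperplane P j' m' ≠ hyperplane P j m := by
        intro h
        have hp : P.pairing j i ≠ 0 := by
          intro h0
          have : P.root' j ((r : N ≃ᵃ[ℝ] N) x₀) = P.root' j x₀ := by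
            rw [hr, affineReflection', root'_affineReflection, h0, mul_zero, sub_zero]
          rw [this] at hjm
          exact absurd hjm (not_lt.2 (mul_self_nonneg _))
        apply heq
        apply hyperplane_eq_of_subset
        intro v hv
        have hv' : P.root' j v = m := hv
        have h1 : (r : N ≃ᵃ[ℝ] N) v ∈ hyperplane P j m := by
          rw [← h, hyperplane, Set.mem_ofPred_eq, ← _root_.sub_eq_zero, hc1, hv', sub_self]
        have h2 : P.root' j ((r : N ≃ᵃ[ℝ] N) v) = m := h1
        rw [hr, affineReflection', root'_affineReflection, hv'] at h2
        have h3 : (P.root' i v - k) * P.pairing j i = 0 := by linarith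
        exact _root_.sub_eq_zero.1 ((mul_eq_zero.1 h3).resolve_right hp)
      have hr1 : ∀ v, P.root' j ((r : N ≃ᵃ[ℝ] N) v) - m = P.root' j' v - m' := fun v => by
        rw [← hc1, hr, affineReflection', affineReflection_affineReflection]
      have hadj := (hw.isAdjacent hx).same j' m' hne
      have hsep2 : (P.root' j x₀ - m) *
          (P.root' j (((r * s : affineWeylGroup P) : N ≃ᵃ[ℝ] N) x₀) - m) < 0 := by
        rw [coe_mul_apply, hr1]
        rw [hr1, mul_comm] at hjm
        rw [mul_comm]
        exact mul_neg_of_mul_pos hadj hjm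
      have l1 := (affineLength_wall_mul hx hw r).1 hjm
      have l2 := (affineLength_wall_mul hx hw (r * s)).1 hsep2
      have l3 : affineLength P x₀ (s * r) = affineLength P x₀ (r * s) := by
        rw [← affineLength_inv hx (s * r), mul_inv_rev, hri, hsi]
      rw [← hs] at l1 l2
      have hmem := ih (affineLength P x₀ (affineReflection' P i' k')) (by
        rw [← hc, hsi, ← hr, mul_assoc]; omega) i' k' rfl
      have e : r = s⁻¹ * affineReflection' P i' k' * s := by rw [← hc, ← hr]; group
      rw [e]
      have hsm := Subgroup.subset_closure (k := affineSimpleReflections P x₀) hsS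
      exact mul_mem (mul_mem (inv_mem hsm) hmem) hsm

theorem closure_affineSimpleReflections (hx : IsRegularPoint P x₀) :
    Subgroup.closure (affineSimpleReflections P x₀) = ⊤ := by
  rw [eq_top_iff]
  rintro ⟨w, hw⟩ -
  induction hw using Subgroup.closure_induction with
  | mem g hg =>
    obtain ⟨i, k, rfl⟩ := hg
    exact affineReflection'_mem_closure hx i k
  | one => exact one_mem _
  | mul a b ha hb h1 h2 => exact mul_mem h1 h2
  | inv a ha h1 => exact inv_mem h1

theorem exists_word (hx : IsRegularPoint P x₀) (w : affineWeylGroup P) :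
    ∃ l : List (affineWeylGroup P), (∀ s ∈ l, s ∈ affineSimpleReflections P x₀) ∧ l.prod = w := by
  have hw : w ∈ Subgroup.closure (affineSimpleReflections P x₀) := by
    rw [closure_affineSimpleReflections hx]; trivial
  induction hw using Subgroup.closure_induction with
  | mem s hs => exact ⟨[s], by simpa using hs, by simp⟩
  | one => exact ⟨[], by simp, rfl⟩
  | mul a b _ _ ha hb =>
    obtain ⟨l, hl, rfl⟩ := ha
    obtain ⟨l', hl', rfl⟩ := hb
    exact ⟨l ++ l', fun s hs => (List.mem_append.1 hs).elim (hl s) (hl' s), List.prod_append⟩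
  | inv a _ ha =>
    obtain ⟨l, hl, rfl⟩ := ha
    refine ⟨(l.map fun x => x⁻¹).reverse, fun s hs => ?_, (List.prod_inv_reverse l).symm⟩
    obtain ⟨a, ha, rfl⟩ := List.mem_map.1 (List.mem_reverse.1 hs)
    rw [inv_eq_of_mul_eq_one_left (affineSimpleReflections_mul_self (hl a ha))]
    exact hl a ha

/-- The word is a gallery that crosses the hyperplane somewhere. If this happens at the first step,
the first letter `s` is deleted; otherwise the hyperplane moved by `s` separates `x₀` from the end
of the remaining gallery. -/
theorem exchange (hx : IsRegularPoint P x₀) (l : List (affineWeylGroup P))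
    (hl : ∀ s ∈ l, s ∈ affineSimpleReflections P x₀) (i : ι) (k : ℤ)
    (h : (P.root' i x₀ - k) * (P.root' i ((l.prod : N ≃ᵃ[ℝ] N) x₀) - k) < 0) :
    ∃ l' : List (affineWeylGroup P), (∀ s ∈ l', s ∈ affineSimpleReflections P x₀) ∧
      l'.length < l.length ∧ affineReflection' P i k * l.prod = l'.prod := by
  induction l generalizing i k with
  | nil => exact absurd h (not_lt.2 (mul_self_nonneg _))
  | cons s l ih =>
    have hlS : ∀ s ∈ l, s ∈ affineSimpleReflections P x₀ := fun s hs => hl s (List.mem_cons_of_mem _ hs)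
    have hsS := hl s List.mem_cons_self
    obtain ⟨j, m, hw, hs⟩ := mem_affineSimpleReflections.1 hsS
    rw [List.prod_cons] at h ⊢
    by_cases heq : hyperplane P i k = hyperplane P j m
    · refine ⟨l, hlS, by simp, ?_⟩
      rw [affineReflection'_eq_of_hyperplane_eq heq, ← hs, ← mul_assoc,
        affineSimpleReflections_mul_self hsS, one_mul]
    · obtain ⟨i', k', hc1, hc2⟩ := conj_affineReflection' s i k
      have hss := affineSimpleReflections_mul_self hsS
      have hsi : s⁻¹ = s := inv_eq_of_mul_eq_one_left hss
      have hsv : ∀ v, (s : N ≃ᵃ[ℝ] N) ((s : N ≃ᵃ[ℝ] N) v) = v := fun v => by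
        rw [← coe_mul_apply, hss, coe_one_apply]
      have h1 : ∀ v, P.root' i' v - k' = P.root' i ((s : N ≃ᵃ[ℝ] N) v) - k := fun v => by
        rw [← hc1, hsv]
      have hadj := (hw.isAdjacent hx).same i k heq
      have e : affineReflection P j m x₀ = (s : N ≃ᵃ[ℝ] N) x₀ := by rw [hs]; rfl
      rw [e] at hadj
      obtain ⟨l', hl', hlen, hprod⟩ := ih hlS i' k' (by
        rw [h1, h1, ← coe_mul_apply]
        exact mul_neg_of_mul_pos hadj h)
      refine ⟨s :: l', ?_, by simpa using hlen, ?_⟩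
      · intro a ha
        rcases List.mem_cons.1 ha with rfl | ha
        · exact hsS
        · exact hl' a ha
      · rw [List.prod_cons, ← hprod, ← hc2, hsi]
        simp only [mul_assoc]
        rw [← mul_assoc s s, hss, one_mul]

theorem affineLength_prod_le (hx : IsRegularPoint P x₀) (l : List (affineWeylGroup P))
    (hl : ∀ s ∈ l, s ∈ affineSimpleReflections P x₀) : affineLength P x₀ l.prod ≤ l.length := by
  induction l with
  | nil => rw [List.prod_nil, affineLength_one]; exact Nat.zero_le _
  | cons s l ih =>
    have h1 := ih fun s hs => hl s (List.mem_cons_of_mem _ hs)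
    have h2 := affineLength_simple_mul hx (hl s List.mem_cons_self) l.prod
    rw [List.prod_cons, List.length_cons]
    omega

theorem exists_reduced_word_of_word (hx : IsRegularPoint P x₀) (l : List (affineWeylGroup P))
    (hl : ∀ s ∈ l, s ∈ affineSimpleReflections P x₀) :
    ∃ l' : List (affineWeylGroup P), (∀ s ∈ l', s ∈ affineSimpleReflections P x₀) ∧
      l'.prod = l.prod ∧ l'.length = affineLength P x₀ l.prod := by
  induction l with
  | nil => exact ⟨[], by simp, rfl, by rw [List.prod_nil, affineLength_one]; rfl⟩
  | cons s l ih =>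
    have hsS := hl s List.mem_cons_self
    obtain ⟨l', hl', hprod, hlen⟩ := ih fun s hs => hl s (List.mem_cons_of_mem _ hs)
    obtain ⟨i, k, hw, hs⟩ := mem_affineSimpleReflections.1 hsS
    have hlen' := affineLength_wall_mul hx hw l.prod
    rw [← hs] at hlen'
    rw [List.prod_cons]
    by_cases hsep : (P.root' i x₀ - k) * (P.root' i ((l.prod : N ≃ᵃ[ℝ] N) x₀) - k) < 0
    · obtain ⟨l'', hl'', hlt, hp⟩ := exchange hx l' hl' i k (by rwa [hprod])
      rw [← hs, hprod] at hp
      refine ⟨l'', hl'', hp.symm, ?_⟩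
      have h1 := affineLength_prod_le hx l'' hl''
      have h2 := hlen'.1 hsep
      rw [← hp] at h1
      omega
    · refine ⟨s :: l', ?_, by rw [List.prod_cons, hprod], ?_⟩
      · intro a ha
        rcases List.mem_cons.1 ha with rfl | ha
        · exact hsS
        · exact hl' a ha
      · rw [hlen'.2 hsep, List.length_cons, hlen]

theorem exists_reduced_word (hx : IsRegularPoint P x₀) (w : affineWeylGroup P) :
    ∃ l : List (affineWeylGroup P), (∀ s ∈ l, s ∈ affineSimpleReflections P x₀) ∧
      l.prod = w ∧ l.length = affineLength P x₀ w := by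
  obtain ⟨l, hl, rfl⟩ := exists_word hx w
  exact exists_reduced_word_of_word hx l hl

/-- The action on alcoves is free: a reduced word of length zero is empty. -/
theorem eq_one_of_affineLength_eq_zero (hx : IsRegularPoint P x₀) {w : affineWeylGroup P}
    (hw : affineLength P x₀ w = 0) : w = 1 := by
  obtain ⟨l, -, rfl, hlen⟩ := exists_reduced_word hx w
  rw [List.length_eq_zero_iff.1 (hlen.trans hw), List.prod_nil]

/-- An automorphism that preserves the simple reflections preserves the length. -/
theorem affineLength_map (hx : IsRegularPoint P x₀) (δ : MulAut (affineWeylGroup P))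
    (hδ : ∀ s, s ∈ affineSimpleReflections P x₀ → δ s ∈ affineSimpleReflections P x₀)
    (w : affineWeylGroup P) : affineLength P x₀ (δ w) ≤ affineLength P x₀ w := by
  obtain ⟨l, hl, rfl, hlen⟩ := exists_reduced_word hx w
  rw [← hlen, map_list_prod]
  refine (affineLength_prod_le hx _ fun s hs => ?_).trans_eq (List.length_map _)
  obtain ⟨a, ha, rfl⟩ := List.mem_map.1 hs
  exact hδ a (hl a ha)

theorem affineLength_reflection_mul_lt (hx : IsRegularPoint P x₀) {i : ι} {k : ℤ}
    {w : affineWeylGroup P}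
    (h : (P.root' i x₀ - k) * (P.root' i ((w : N ≃ᵃ[ℝ] N) x₀) - k) < 0) :
    affineLength P x₀ (affineReflection' P i k * w) < affineLength P x₀ w := by
  obtain ⟨l, hl, rfl, hlen⟩ := exists_reduced_word hx w
  obtain ⟨l', hl', hlt, hp⟩ := exchange hx l hl i k h
  rw [hp]
  exact (affineLength_prod_le hx l' hl').trans_lt (hlen ▸ hlt)

theorem affineLength_lt_reflection_mul_iff (hx : IsRegularPoint P x₀) {i : ι} {k : ℤ}
    {w : affineWeylGroup P} :
    affineLength P x₀ w < affineLength P x₀ (affineReflection' P i k * w) ↔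
      0 < (P.root' i x₀ - k) * (P.root' i ((w : N ≃ᵃ[ℝ] N) x₀) - k) := by
  have hne := mul_ne_zero (hx.sub_ne_zero i k) ((hx.smul w).sub_ne_zero i k)
  constructor
  · intro h
    rcases lt_or_gt_of_ne hne with h1 | h1
    · exact absurd (affineLength_reflection_mul_lt hx h1) (by omega)
    · exact h1
  · intro h
    have := affineLength_reflection_mul_lt hx (i := i) (k := k)
      (w := affineReflection' P i k * w) (by
        rw [coe_mul_apply]
        change _ * (P.root' i (affineReflection P i k _) - k) < 0
        rw [root'_affineReflection_self]
        linarith)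
    rwa [← mul_assoc, affineReflection'_mul_self, one_mul] at this

/-- All the reflections of the affine Weyl group. -/
def affineReflections (P : RootPairing ι ℝ M N) : Set (affineWeylGroup P) :=
  {r | ∃ i k, r = affineReflection' P i k}

theorem conj_mem_affineReflections {r : affineWeylGroup P} (hr : r ∈ affineReflections P)
    (w : affineWeylGroup P) : w * r * w⁻¹ ∈ affineReflections P := by
  obtain ⟨i, k, rfl⟩ := hr
  obtain ⟨j, m, -, h⟩ := conj_affineReflection' w i k
  exact ⟨j, m, h⟩

/-- By `affineLength_lt_reflection_mul_iff` lengths compare according to sides of mirrors. As `s`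
moves `x₀` across its own wall only, the side criterion for `r` and `w` carries over to `s r s` and
`s w`. -/
theorem affineLength_lift (hx : IsRegularPoint P x₀) {r s : affineWeylGroup P}
    (hr : r ∈ affineReflections P) (hs : s ∈ affineSimpleReflections P x₀) (hrs : r ≠ s)
    {w : affineWeylGroup P} (h : affineLength P x₀ w < affineLength P x₀ (r * w)) :
    affineLength P x₀ (s * w) < affineLength P x₀ (s * r * w) := by
  obtain ⟨i, k, rfl⟩ := hr
  obtain ⟨j, m, hw, hsj⟩ := mem_affineSimpleReflections.1 hs
  obtain ⟨i', k', hc1, hc2⟩ := conj_affineReflection' s i k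
  have hss := affineSimpleReflections_mul_self hs
  have hsv : ∀ v, (s : N ≃ᵃ[ℝ] N) ((s : N ≃ᵃ[ℝ] N) v) = v := fun v => by
    rw [← coe_mul_apply, hss, coe_one_apply]
  have e : s * affineReflection' P i k * w = affineReflection' P i' k' * (s * w) := by
    rw [← hc2]; group
  rw [affineLength_lt_reflection_mul_iff hx] at h
  rw [e, affineLength_lt_reflection_mul_iff hx, coe_mul_apply, hc1]
  have hne : hyperplane P i k ≠ hyperplane P j m := fun heq =>
    hrs (by rw [hsj, affineReflection'_eq_of_hyperplane_eq heq])
  have hadj := (hw.isAdjacent hx).same i k hne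
  have e : affineReflection P j m x₀ = (s : N ≃ᵃ[ℝ] N) x₀ := by rw [hsj]; rfl
  have e2 : P.root' i ((s : N ≃ᵃ[ℝ] N) x₀) - k = P.root' i' x₀ - k' := by rw [← hc1, hsv]
  rw [e, e2] at hadj
  rcases mul_pos_iff.1 h with h1 | h1 <;> rcases mul_pos_iff.1 hadj with h2 | h2
  · exact mul_pos h2.2 h1.2
  · linarith [h1.1, h2.1]
  · linarith [h1.1, h2.1]
  · exact mul_pos_of_neg_of_neg h2.2 h1.2

/-- Every affine reflection is conjugate to a simple one. -/
theorem exists_conj_simple (hx : IsRegularPoint P x₀) {r : affineWeylGroup P}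
    (hr : r ∈ affineReflections P) :
    ∃ s ∈ affineSimpleReflections P x₀, ∃ w, r = w * s * w⁻¹ := by
  obtain ⟨i, k, rfl⟩ := hr
  have key : ∀ l : List (affineWeylGroup P), (∀ s ∈ l, s ∈ affineSimpleReflections P x₀) →
      ∀ i k, (P.root' i x₀ - (k : ℤ)) * (P.root' i ((l.prod : N ≃ᵃ[ℝ] N) x₀) - k) < 0 →
      ∃ s ∈ affineSimpleReflections P x₀, ∃ w, affineReflection' P i k = w * s * w⁻¹ := by
    intro l hl
    induction l with
    | nil => exact fun i k h => absurd h (not_lt.2 (mul_self_nonneg _))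
    | cons s l ih =>
      intro i k h
      have hsS := hl s List.mem_cons_self
      obtain ⟨j, m, hw, hs⟩ := mem_affineSimpleReflections.1 hsS
      rw [List.prod_cons] at h
      by_cases heq : hyperplane P i k = hyperplane P j m
      · exact ⟨s, hsS, 1, by rw [affineReflection'_eq_of_hyperplane_eq heq, ← hs]; group⟩
      · obtain ⟨i', k', hc1, hc2⟩ := conj_affineReflection' s i k
        have hss := affineSimpleReflections_mul_self hsS
        have hsv : ∀ v, (s : N ≃ᵃ[ℝ] N) ((s : N ≃ᵃ[ℝ] N) v) = v := fun v => by
          rw [← coe_mul_apply, hss, coe_one_apply]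
        have h1 : ∀ v, P.root' i' v - k' = P.root' i ((s : N ≃ᵃ[ℝ] N) v) - k := fun v => by
          rw [← hc1, hsv]
        have hadj := (hw.isAdjacent hx).same i k heq
        have e : affineReflection P j m x₀ = (s : N ≃ᵃ[ℝ] N) x₀ := by rw [hs]; rfl
        rw [e] at hadj
        obtain ⟨a, ha, w, haw⟩ := ih (fun s hs => hl s (List.mem_cons_of_mem _ hs)) i' k' (by
          rw [h1, h1, ← coe_mul_apply]
          exact mul_neg_of_mul_pos hadj h)
        refine ⟨a, ha, s⁻¹ * w, ?_⟩
        have : affineReflection' P i k = s⁻¹ * affineReflection' P i' k' * s := by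
          rw [← hc2]; group
        rw [this, haw]
        group
  obtain ⟨l, hl, hp⟩ := exists_word hx (affineReflection' P i k)
  exact key l hl i k (by rw [hp]; exact affineReflection_mul_self_pos hx i k)

/-- Reflections are the conjugates of simple reflections, a description that `δ` respects. -/
theorem map_mem_affineReflections (hx : IsRegularPoint P x₀) (δ : MulAut (affineWeylGroup P))
    (hδ : ∀ s, s ∈ affineSimpleReflections P x₀ → δ s ∈ affineSimpleReflections P x₀)
    {r : affineWeylGroup P} (hr : r ∈ affineReflections P) : δ r ∈ affineReflections P := by
  obtain ⟨s, hs, w, rfl⟩ := exists_conj_simple hx hr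
  obtain ⟨i, k, -, h⟩ := mem_affineSimpleReflections.1 (hδ s hs)
  rw [map_mul, map_mul, map_inv]
  exact conj_mem_affineReflections ⟨i, k, h⟩ _

end Coxeter

/-! ### An alcove is determined by its walls -/

section WallComparison

variable {ι M N : Type*} [AddCommGroup M] [Module ℝ M] [AddCommGroup N] [Module ℝ N]
  {P : RootPairing ι ℝ M N} {x y : N}

theorem IsWall.congr {i j : ι} {k m : ℤ} (h : IsWall P x i k)
    (e : hyperplane P j m = hyperplane P i k) : IsWall P x j m := by
  obtain ⟨p, hp, hpos⟩ := h
  exact ⟨p, e ▸ hp, fun j' m' h' => hpos j' m' (e ▸ h')⟩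

theorem mem_hyperplane_iff_of_sub_eq {g : N ≃ᵃ[ℝ] N} {i j : ι} {k m : ℤ}
    (h : ∀ v, P.root' j (g v) - m = P.root' i v - k) (v : N) :
    g v ∈ hyperplane P j m ↔ v ∈ hyperplane P i k := by
  rw [hyperplane, hyperplane, Set.mem_ofPred_eq, Set.mem_ofPred_eq, ← sub_eq_zero, h, sub_eq_zero]

theorem IsWall.map {g : N ≃ᵃ[ℝ] N} (hg : g ∈ arrangementAut P) {i j : ι} {k m : ℤ}
    (h : IsWall P x i k) (hjm : ∀ v, P.root' j (g v) - m = P.root' i v - k) :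
    IsWall P (g x) j m := by
  obtain ⟨p, hp, hpos⟩ := h
  obtain ⟨π, c, hg⟩ := hg
  refine ⟨g p, (mem_hyperplane_iff_of_sub_eq hjm p).2 hp, fun j' m' hne => ?_⟩
  have e : ∀ v, P.root' j' (g v) - m' = P.root' (π j') v - (m' - c j' : ℤ) := fun v => by
    rw [hg]; push_cast; ring
  rw [e, e]
  refine hpos _ _ fun heq => hne ?_
  ext v
  obtain ⟨v, rfl⟩ := g.surjective v
  rw [mem_hyperplane_iff_of_sub_eq hjm, mem_hyperplane_iff_of_sub_eq e, heq]

variable [Finite ι] [P.IsRootSystem] [P.IsCrystallographic]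

/-- The angles between the walls of an alcove are not obtuse. -/
theorem IsWall.pairing_mul_nonpos (hx : IsRegularPoint P x) {i j : ι} {k m : ℤ}
    (h1 : IsWall P x i k) (h2 : IsWall P x j m) (hne : hyperplane P j m ≠ hyperplane P i k) :
    P.pairing j i * ((P.root' i x - k) * (P.root' j x - m)) ≤ 0 := by
  have hsame := (h1.isAdjacent hx).same j m hne
  obtain ⟨q, hq, hpos⟩ := h2
  have hq : P.root' j q = m := hq
  obtain ⟨j', m', he, -⟩ := conj_affineReflection (P := P)
    (affineReflection_mem_arrangementAut i k) j m
  have he' : ∀ v, P.root' j' v - m' = P.root' j (affineReflection P i k v) - m := fun v => by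
    rw [← he, affineReflection_affineReflection]
  have hi := hpos i k hne.symm
  -- If the first reflection stabilizes the second hyperplane, the roots are orthogonal. Otherwise
  -- the point `q` of the second wall is strictly on the side of `x` for the reflected affine root,
  -- whose value at `q` is `-(⟨α_i, q⟩ - k)` times the pairing.
  by_cases heq : hyperplane P j' m' = hyperplane P j m
  · have : q ∈ hyperplane P j' m' := heq ▸ hq
    have h3 : P.root' j' q = m' := this
    have h4 := he' q
    rw [h3, root'_affineReflection, hq] at h4
    have h5 : (P.root' i q - k) * P.pairing j i = 0 := by linarith
    have h6 := (mul_eq_zero.1 h5).resolve_left (left_ne_zero_of_mul hi.ne')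
    rw [h6, zero_mul]
  · have h3 := hpos j' m' heq
    rw [he', he' x, root'_affineReflection _ _ _ q, hq] at h3
    set a := P.root' i x - k
    set b := P.root' j x - m
    set c := P.root' i q - k
    set d := P.root' j (affineReflection P i k x) - m
    have h4 := mul_pos (mul_pos h3 hsame) hi
    by_contra! hcon
    nlinarith [mul_nonneg hcon.le (sq_nonneg (c * d))]

variable [P.IsReduced]

/-- If all the walls of one alcove are walls of another one, then the alcoves are equal. -/
theorem sameAlcove_of_isWall (hx : IsRegularPoint P x) (hy : IsRegularPoint P y)
    (h : ∀ i k, IsWall P x i k → IsWall P y i k) : SameAlcove P x y := by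
  have := Fintype.ofFinite ι
  obtain ⟨b⟩ := P.nonempty_base
  have : FiniteDimensional ℝ N := b.toCoweightBasis.finiteDimensional_of_finite
  by_contra hxy
  -- The span of the coroots of those walls of `x` that separate it from `y`. With `u` the
  -- orthogonal projection of `y - x` to it, the ray `x - r u` turns out never to leave the alcove
  -- of `x`, although some root is nonconstant on it.
  set S : Submodule ℝ N := Submodule.span ℝ {c | ∃ (i : ι) (k : ℤ), IsWall P x i k ∧
    (P.root' i x - k) * (P.root' i y - k) < 0 ∧ c = P.coroot i} with hS
  have hcompl : IsCompl S (P.CorootForm.orthogonal S) := by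
    rw [LinearMap.BilinForm.isCompl_orthogonal_iff_disjoint]
    · rw [Submodule.disjoint_def]
      intro v hv hv'
      exact corootForm_pos_iff (P := P) (hv' v hv)
    · intro v w hvw
      rw [← hvw]
      simp only [P.corootForm_apply_apply, mul_comm]
  obtain ⟨u, hu, u', hu', huu⟩ := Submodule.mem_sup.1
    (hcompl.sup_eq_top.ge (Submodule.mem_top (x := y - x)))
  have hsep : ∀ (i : ι) (k : ℤ), IsWall P x i k → (P.root' i x - k) * (P.root' i y - k) < 0 →
      P.root' i u = P.root' i y - P.root' i x := by
    intro i k hw hlt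
    have h1 : P.CorootForm (P.coroot i) u' = 0 :=
      hu' _ (Submodule.subset_span ⟨i, k, hw, hlt, rfl⟩)
    have h2 := corootForm_coroot (P := P) i u'
    rw [h1, mul_zero] at h2
    have h3 := (mul_eq_zero.1 h2).resolve_left fun h0 => by
      have := congrArg (P.root' i) (corootForm_pos_iff (P := P) h0)
      rw [root'_coroot_self, map_zero] at this
      norm_num at this
    rw [← map_sub, ← huu, map_add, h3, add_zero]
  -- A separating and a nonseparating wall are orthogonal: both are walls at `x` and at `y`, and the
  -- angle condition gives opposite signs of the pairing at the two points.
  have hnsep : ∀ (j : ι) (m : ℤ), IsWall P x j m → ¬(P.root' j x - m) * (P.root' j y - m) < 0 →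
      P.root' j u = 0 := by
    intro j m hw hnlt
    have : S ≤ LinearMap.ker (P.root' j) := by
      rw [hS, Submodule.span_le]
      rintro _ ⟨i, k, hi, hlt, rfl⟩
      rw [SetLike.mem_coe, LinearMap.mem_ker, root'_coroot]
      have hne : hyperplane P j m ≠ hyperplane P i k := fun heq =>
        hnlt (by rwa [mul_sub_eq_of_hyperplane_eq heq])
      have h1 := hi.pairing_mul_nonpos hx hw hne
      have h2 := (h _ _ hi).pairing_mul_nonpos hy (h _ _ hw) hne
      have h3 : 0 < (P.root' j x - m) * (P.root' j y - m) := lt_of_le_of_ne (not_lt.1 hnlt)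
        (mul_ne_zero (hx.sub_ne_zero _ _) (hy.sub_ne_zero _ _)).symm
      have h4 := mul_neg_of_neg_of_pos hlt h3
      by_contra hp
      nlinarith [mul_nonneg_of_nonpos_of_nonpos h1 h2, mul_self_pos.2 hp]
    exact this hu
  obtain ⟨i, k, hw, hlt⟩ := exists_isWall hx hy hxy
  have hiu := hsep i k hw hlt
  have hne : P.root' i u ≠ 0 := by
    intro h0
    rw [h0] at hiu
    have : P.root' i y = P.root' i x := by linarith
    rw [this] at hlt
    exact absurd hlt (not_lt.2 (mul_self_nonneg _))
  -- Only countably many points of the ray are irregular, so a regular one can be found arbitrarily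
  -- far away.
  have hcount : {r : ℝ | ¬IsRegularPoint P (x - r • u)}.Countable := by
    have : {r : ℝ | ¬IsRegularPoint P (x - r • u)} ⊆
        ⋃ (j : ι), ⋃ (m : ℤ), {r : ℝ | P.root' j (x - r • u) = m} := by
      intro r hr
      simp only [IsRegularPoint, not_forall, not_not, Set.mem_ofPred_eq] at hr
      obtain ⟨j, m, h⟩ := hr
      exact Set.mem_iUnion.2 ⟨j, Set.mem_iUnion.2 ⟨m, h⟩⟩
    refine Set.Countable.mono this (Set.countable_iUnion fun j => Set.countable_iUnion fun m =>
      Set.Subsingleton.countable ?_)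
    intro r hr r' hr'
    simp only [Set.mem_ofPred_eq, map_sub, map_smul, smul_eq_mul] at hr hr'
    by_contra hrr
    have h1 : (r - r') * P.root' j u = 0 := by linarith
    have h2 := (mul_eq_zero.1 h1).resolve_left (sub_ne_zero.2 hrr)
    rw [h2, mul_zero, sub_zero] at hr
    exact hx j m hr
  obtain ⟨r, hr, hrgt⟩ := (hcount.dense_compl ℝ).exists_gt (1 / |P.root' i u|)
  have hr : IsRegularPoint P (x - r • u) := not_not.1 hr
  have hr0 : 0 < r := lt_trans (by positivity) hrgt
  have hsame : SameAlcove P x (x - r • u) := by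
    by_contra hns
    obtain ⟨j, m, hj, hjlt⟩ := exists_isWall hx hr hns
    rw [map_sub, map_smul, smul_eq_mul] at hjlt
    have ha := mul_self_pos.2 (hx.sub_ne_zero j m)
    by_cases hs : (P.root' j x - m) * (P.root' j y - m) < 0
    · rw [hsep j m hj hs] at hjlt
      nlinarith [mul_pos hr0 ha, mul_pos hr0 (neg_pos.2 hs)]
    · rw [hnsep j m hj hs, mul_zero, sub_zero] at hjlt
      linarith
  have h1 := Int.abs_sub_lt_one_of_floor_eq_floor (hsame i)
  rw [map_sub, map_smul, sub_sub_cancel, smul_eq_mul, abs_mul, abs_of_pos hr0] at h1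
  rw [div_lt_iff₀ (abs_pos.2 hne)] at hrgt
  linarith

end WallComparison

/-! ### Automorphisms of the affine Weyl group are induced by affine transformations -/

section Realization

variable {ι M N : Type*} [AddCommGroup M] [Module ℝ M] [AddCommGroup N] [Module ℝ N]
  {P : RootPairing ι ℝ M N}

theorem affineEquiv_eq_linear_add (g : N ≃ᵃ[ℝ] N) (v : N) : g v = g.linear v + g 0 := by
  rw [← affineEquiv_add, add_zero]

/-- Linear parts act through permutations of the finite spanning set of roots, so the order of the
symmetric group is a common exponent. -/
theorem exists_linear_pow_eq_one [Finite ι] [P.IsRootSystem] :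
    ∃ n : ℕ, n ≠ 0 ∧ ∀ g ∈ arrangementAut P, g.linear ^ n = 1 := by
  refine ⟨Nat.card (Equiv.Perm ι), Nat.card_pos.ne', ?_⟩
  rintro g ⟨π, k, hg⟩
  have key : ∀ (n : ℕ) (i : ι) (v : N), P.root' i ((g.linear ^ n) v) = P.root' ((π ^ n) i) v := by
    intro n
    induction n with
    | zero => exact fun i v => rfl
    | succ n ih =>
      intro i v
      rw [pow_succ', LinearEquiv.mul_apply, root'_linear (hg i), ih, pow_succ]
      rfl
  ext v
  rw [← sub_eq_zero]
  refine eq_zero_of_root'_eq_zero (P := P) fun i => ?_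
  rw [map_sub, key, pow_card_eq_one']
  exact sub_self _

theorem linear_pow_apply (g : N ≃ᵃ[ℝ] N) (n : ℕ) : (g ^ n).linear = g.linear ^ n :=
  map_pow (AffineEquiv.linearHom : (N ≃ᵃ[ℝ] N) →* _) g n

/-- An element of the affine Weyl group that is a translation. -/
def IsTranslation (w : affineWeylGroup P) : Prop :=
  ∀ v, (w : N ≃ᵃ[ℝ] N) v = v + (w : N ≃ᵃ[ℝ] N) 0

theorem isTranslation_iff {w : affineWeylGroup P} :
    IsTranslation w ↔ ∀ v, (w : N ≃ᵃ[ℝ] N).linear v = v := by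
  refine forall_congr' fun v => ?_
  rw [affineEquiv_eq_linear_add (w : N ≃ᵃ[ℝ] N) v, add_left_inj]

theorem IsTranslation.mul {v w : affineWeylGroup P} (hv : IsTranslation v) (hw : IsTranslation w) :
    IsTranslation (v * w) ∧ ((v * w : affineWeylGroup P) : N ≃ᵃ[ℝ] N) 0 =
      (v : N ≃ᵃ[ℝ] N) 0 + (w : N ≃ᵃ[ℝ] N) 0 := by
  have h : ∀ x, ((v * w : affineWeylGroup P) : N ≃ᵃ[ℝ] N) x =
      x + (w : N ≃ᵃ[ℝ] N) 0 + (v : N ≃ᵃ[ℝ] N) 0 := fun x => by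
    rw [coe_mul_apply, hv, hw]
  refine ⟨fun x => ?_, ?_⟩
  · rw [h, h]; abel
  · rw [h]; abel

theorem isTranslation_one : IsTranslation (1 : affineWeylGroup P) := fun v => by
  rw [coe_one_apply, coe_one_apply, add_zero]

theorem coe_inv_apply_eq_iff {w : affineWeylGroup P} {x y : N} :
    ((w⁻¹ : affineWeylGroup P) : N ≃ᵃ[ℝ] N) x = y ↔ x = (w : N ≃ᵃ[ℝ] N) y := by
  constructor
  · rintro rfl
    rw [← coe_mul_apply, mul_inv_cancel, coe_one_apply]
  · rintro rfl
    rw [← coe_mul_apply, inv_mul_cancel, coe_one_apply]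

theorem IsTranslation.inv {w : affineWeylGroup P} (hw : IsTranslation w) :
    IsTranslation w⁻¹ ∧ ((w⁻¹ : affineWeylGroup P) : N ≃ᵃ[ℝ] N) 0 = -(w : N ≃ᵃ[ℝ] N) 0 := by
  have h : ∀ x, ((w⁻¹ : affineWeylGroup P) : N ≃ᵃ[ℝ] N) x = x - (w : N ≃ᵃ[ℝ] N) 0 := fun x => by
    rw [coe_inv_apply_eq_iff, hw, sub_add_cancel]
  refine ⟨fun x => ?_, ?_⟩
  · rw [h, h]; abel
  · rw [h]; abel

theorem IsTranslation.conj {t : affineWeylGroup P} (ht : IsTranslation t) (w : affineWeylGroup P) :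
    IsTranslation (w * t * w⁻¹) ∧ ((w * t * w⁻¹ : affineWeylGroup P) : N ≃ᵃ[ℝ] N) 0 =
      (w : N ≃ᵃ[ℝ] N).linear ((t : N ≃ᵃ[ℝ] N) 0) := by
  have h : ∀ x, ((w * t * w⁻¹ : affineWeylGroup P) : N ≃ᵃ[ℝ] N) x =
      x + (w : N ≃ᵃ[ℝ] N).linear ((t : N ≃ᵃ[ℝ] N) 0) := fun x => by
    rw [coe_mul_apply, coe_mul_apply, ht, add_comm, affineEquiv_add, ← coe_mul_apply,
      mul_inv_cancel, coe_one_apply, add_comm]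
  refine ⟨fun x => ?_, ?_⟩
  · rw [h, h, zero_add]
  · rw [h, zero_add]

theorem IsTranslation.ext {v w : affineWeylGroup P} (hv : IsTranslation v) (hw : IsTranslation w)
    (h : (v : N ≃ᵃ[ℝ] N) 0 = (w : N ≃ᵃ[ℝ] N) 0) : v = w :=
  Subtype.ext (AffineEquiv.ext fun x => by rw [hv, hw, h])

/-- The translation by a coroot. -/
def corootTranslation (P : RootPairing ι ℝ M N) (i : ι) : affineWeylGroup P :=
  affineReflection' P i 1 * affineReflection' P i 0

theorem corootTranslation_apply (i : ι) (v : N) :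
    (corootTranslation P i : N ≃ᵃ[ℝ] N) v = v + P.coroot i := by
  rw [corootTranslation, coe_mul_apply]
  change affineReflection P i 1 (affineReflection P i 0 v) = _
  rw [affineReflection_apply P i 1, root'_affineReflection_self, affineReflection_apply]
  push_cast
  module

theorem corootTranslation_zero (i : ι) :
    (corootTranslation P i : N ≃ᵃ[ℝ] N) 0 = P.coroot i := by
  rw [corootTranslation_apply, zero_add]

theorem isTranslation_corootTranslation (i : ι) : IsTranslation (corootTranslation P i) :=
  fun v => by rw [corootTranslation_apply, corootTranslation_zero]

theorem coe_pow (w : affineWeylGroup P) (n : ℕ) :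
    ((w ^ n : affineWeylGroup P) : N ≃ᵃ[ℝ] N) = (w : N ≃ᵃ[ℝ] N) ^ n := rfl

theorem IsTranslation.pow {w : affineWeylGroup P} (hw : IsTranslation w) (n : ℕ) :
    IsTranslation (w ^ n) ∧ ((w ^ n : affineWeylGroup P) : N ≃ᵃ[ℝ] N) 0 =
      n • (w : N ≃ᵃ[ℝ] N) 0 := by
  induction n with
  | zero => exact ⟨by rw [pow_zero]; exact isTranslation_one, by rw [pow_zero, zero_smul]; rfl⟩
  | succ n ih =>
    rw [pow_succ, succ_nsmul, ← ih.2]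
    exact ih.1.mul hw

theorem exists_root'_eq_int_of_mem_span [P.IsCrystallographic] {v : N}
    (hv : v ∈ AddSubgroup.closure (Set.range P.coroot)) (i : ι) : ∃ z : ℤ, P.root' i v = z := by
  induction hv using AddSubgroup.closure_induction with
  | mem x hx =>
    obtain ⟨j, rfl⟩ := hx
    exact exists_pairing_eq_int i j
  | zero => exact ⟨0, by simp⟩
  | add x y _ _ hx hy =>
    obtain ⟨a, ha⟩ := hx
    obtain ⟨b, hb⟩ := hy
    exact ⟨a + b, by rw [map_add, ha, hb]; push_cast; rfl⟩
  | neg x _ hx =>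
    obtain ⟨a, ha⟩ := hx
    exact ⟨-a, by rw [map_neg, ha]; push_cast; rfl⟩

set_option linter.unusedSectionVars false

variable [Finite ι] [P.IsRootSystem] [P.IsCrystallographic]

/-- A purely group-theoretic description of translations, hence one invariant under automorphisms.
All `n`-th powers are translations, and commuting with the `n`-th powers of the coroot translations
makes the linear part trivial. -/
theorem isTranslation_iff_commute {n : ℕ} (hn0 : n ≠ 0)
    (hn : ∀ g ∈ arrangementAut P, g.linear ^ n = 1) {w : affineWeylGroup P} :
    IsTranslation w ↔ ∀ x : affineWeylGroup P, w * x ^ n = x ^ n * w := by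
  constructor
  · intro hw x
    have hx : IsTranslation (x ^ n) := isTranslation_iff.2 fun v => by
      rw [coe_pow, linear_pow_apply, hn _ (coe_mem_arrangementAut x)]
      rfl
    refine (hw.mul hx).1.ext (hx.mul hw).1 ?_
    rw [(hw.mul hx).2, (hx.mul hw).2, add_comm]
  · intro h
    rw [isTranslation_iff]
    have : (w : N ≃ᵃ[ℝ] N).linear.toLinearMap = LinearMap.id := by
      refine LinearMap.ext_on (RootPairing.IsRootSystem.span_coroot_eq_top (P := P)) ?_
      rintro _ ⟨i, rfl⟩
      have ht := (isTranslation_corootTranslation (P := P) i).pow n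
      have h1 := (ht.1.conj w).2
      rw [h, mul_inv_cancel_right, ht.2, corootTranslation_zero, map_nsmul] at h1
      rw [← Nat.cast_smul_eq_nsmul ℝ, ← Nat.cast_smul_eq_nsmul ℝ] at h1
      exact (smul_right_injective N (Nat.cast_ne_zero.2 hn0) h1).symm
    exact fun v => congrArg (fun f => f v) this

theorem IsTranslation.map {w : affineWeylGroup P} (hw : IsTranslation w)
    (δ : MulAut (affineWeylGroup P)) : IsTranslation (δ w) := by
  obtain ⟨n, hn0, hn⟩ := exists_linear_pow_eq_one (P := P)
  rw [isTranslation_iff_commute hn0 hn] at hw ⊢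
  intro x
  obtain ⟨x, rfl⟩ := δ.surjective x
  rw [← map_pow, ← map_mul, hw, map_mul]

theorem apply_mem_closure_coroot (w : affineWeylGroup P) :
    ∀ v ∈ AddSubgroup.closure (Set.range P.coroot),
      (w : N ≃ᵃ[ℝ] N) v ∈ AddSubgroup.closure (Set.range P.coroot) := by
  have hg : ∀ i k, ∀ v ∈ AddSubgroup.closure (Set.range P.coroot),
      affineReflection P i k v ∈ AddSubgroup.closure (Set.range P.coroot) := by
    intro i k v hv
    obtain ⟨z, hz⟩ := exists_root'_eq_int_of_mem_span hv i
    rw [affineReflection_apply, hz, ← Int.cast_sub, Int.cast_smul_eq_zsmul]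
    exact sub_mem hv (zsmul_mem (AddSubgroup.subset_closure (Set.mem_range_self i)) _)
  obtain ⟨w, hw⟩ := w
  induction hw using Subgroup.closure_induction'' with
  | mem x hx => obtain ⟨i, k, rfl⟩ := hx; exact hg i k
  | inv_mem x hx =>
    obtain ⟨i, k, rfl⟩ := hx
    intro v hv
    change (affineReflection P i k)⁻¹ v ∈ _
    rw [affineReflection_inv]
    exact hg i k v hv
  | one => exact fun v hv => hv
  | mul x y _ _ hx hy => exact fun v hv => hx _ (hy _ hv)

variable [P.IsReduced]

/-- On translations `δ` is an additive map of the coroot lattice. The simple coroots are a basis of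
the lattice and of the space, so this map extends linearly. -/
theorem exists_linearMap_realization (δ : MulAut (affineWeylGroup P)) :
    ∃ D : N →ₗ[ℝ] N, ∀ v ∈ AddSubgroup.closure (Set.range P.coroot),
      ∃ w : affineWeylGroup P, IsTranslation w ∧ (w : N ≃ᵃ[ℝ] N) 0 = v ∧
        (δ w : N ≃ᵃ[ℝ] N) 0 = D v := by
  obtain ⟨b⟩ := P.nonempty_base
  refine ⟨b.toCoweightBasis.constr ℝ fun j => (δ (corootTranslation P j) : N ≃ᵃ[ℝ] N) 0,
    fun v hv => ?_⟩
  have hv' : v ∈ AddSubgroup.closure (P.coroot '' b.support) := by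
    rw [← Submodule.span_int_eq_addSubgroupClosure]
    refine (AddSubgroup.closure_le
      (K := (Submodule.span ℤ (P.coroot '' b.support)).toAddSubgroup)).2 ?_ hv
    rintro _ ⟨i, rfl⟩
    exact b.coroot_mem_span_int i
  clear hv
  induction hv' using AddSubgroup.closure_induction with
  | mem x hx =>
    obtain ⟨j, hj, rfl⟩ := hx
    refine ⟨corootTranslation P j, isTranslation_corootTranslation j, corootTranslation_zero j, ?_⟩
    have := b.toCoweightBasis.constr_basis ℝ
      (fun j => (δ (corootTranslation P j) : N ≃ᵃ[ℝ] N) 0) ⟨j, hj⟩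
    rw [b.toCoweightBasis_apply] at this
    exact this.symm
  | zero => exact ⟨1, isTranslation_one, rfl, by rw [map_one δ, LinearMap.map_zero]; rfl⟩
  | add x y _ _ hx hy =>
    obtain ⟨u, hu1, hu2, hu3⟩ := hx
    obtain ⟨w, hw1, hw2, hw3⟩ := hy
    exact ⟨u * w, (hu1.mul hw1).1, by rw [(hu1.mul hw1).2, hu2, hw2], by
      rw [map_mul, ((hu1.map δ).mul (hw1.map δ)).2, hu3, hw3, map_add]⟩
  | neg x _ hx =>
    obtain ⟨u, hu1, hu2, hu3⟩ := hx
    exact ⟨u⁻¹, hu1.inv.1, by rw [hu1.inv.2, hu2], by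
      rw [map_inv, (hu1.map δ).inv.2, hu3, map_neg]⟩

/-- The linear maps obtained from `δ` and `δ⁻¹` are inverse to each other on coroots. This uses that
the group maps the coroot lattice to itself, so that the two can be composed. -/
theorem exists_linearEquiv_realization (δ : MulAut (affineWeylGroup P)) :
    ∃ D : N ≃ₗ[ℝ] N, ∀ v ∈ AddSubgroup.closure (Set.range P.coroot),
      ∃ w : affineWeylGroup P, IsTranslation w ∧ (w : N ≃ᵃ[ℝ] N) 0 = v ∧
        (δ w : N ≃ᵃ[ℝ] N) 0 = D v := by
  have key : ∀ (δ δ' : MulAut (affineWeylGroup P)) (D D' : N →ₗ[ℝ] N),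
      (∀ w, δ' (δ w) = w) →
      (∀ v ∈ AddSubgroup.closure (Set.range P.coroot),
        ∃ w : affineWeylGroup P, IsTranslation w ∧ (w : N ≃ᵃ[ℝ] N) 0 = v ∧
          (δ w : N ≃ᵃ[ℝ] N) 0 = D v) →
      (∀ v ∈ AddSubgroup.closure (Set.range P.coroot),
        ∃ w : affineWeylGroup P, IsTranslation w ∧ (w : N ≃ᵃ[ℝ] N) 0 = v ∧
          (δ' w : N ≃ᵃ[ℝ] N) 0 = D' v) → D' ∘ₗ D = LinearMap.id := by
    intro δ δ' D D' hδ hD hD'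
    refine LinearMap.ext_on (RootPairing.IsRootSystem.span_coroot_eq_top (P := P)) ?_
    rintro _ ⟨i, rfl⟩
    obtain ⟨w, hw1, hw2, hw3⟩ := hD _ (AddSubgroup.subset_closure ⟨i, rfl⟩)
    obtain ⟨u, hu1, hu2, hu3⟩ := hD' (D (P.coroot i)) (by
      rw [← hw3]
      exact apply_mem_closure_coroot _ _ (zero_mem _))
    have e : u = δ w := hu1.ext (hw1.map δ) (by rw [hu2, hw3])
    rw [e, hδ, hw2] at hu3
    exact hu3.symm
  obtain ⟨D, hD⟩ := exists_linearMap_realization δ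
  obtain ⟨D', hD'⟩ := exists_linearMap_realization δ⁻¹
  exact ⟨LinearEquiv.ofLinearMap D D' (key _ _ _ _ (fun w => MulAut.apply_inv_self _ δ w) hD' hD)
    (key _ _ _ _ (fun w => MulAut.inv_apply_self _ δ w) hD hD'), hD⟩

/-- The elements of the affine Weyl group that fix the origin. -/
def originStabilizer (P : RootPairing ι ℝ M N) : Subgroup (affineWeylGroup P) where
  carrier := {w | (w : N ≃ᵃ[ℝ] N) 0 = 0}
  mul_mem' := fun {a b} ha hb => by
    have ha : (a : N ≃ᵃ[ℝ] N) 0 = 0 := ha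
    have hb : (b : N ≃ᵃ[ℝ] N) 0 = 0 := hb
    rw [Set.mem_ofPred_eq, coe_mul_apply, hb, ha]
  one_mem' := rfl
  inv_mem' := fun {a} ha => coe_inv_apply_eq_iff.2 (Eq.symm ha)

theorem finite_originStabilizer : Finite (originStabilizer P) := by
  have h : ∀ w : originStabilizer P, ∃ π : Equiv.Perm ι, ∀ i v,
      P.root' i (((w : affineWeylGroup P) : N ≃ᵃ[ℝ] N) v) = P.root' (π i) v := by
    rintro ⟨w, hw⟩
    have hw : (w : N ≃ᵃ[ℝ] N) 0 = 0 := hw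
    obtain ⟨π, k, h⟩ := coe_mem_arrangementAut w
    refine ⟨π, fun i v => ?_⟩
    have h0 := h i 0
    rw [hw, map_zero, map_zero, zero_add] at h0
    rw [h, ← h0, add_zero]
  choose π hπ using h
  refine Finite.of_injective π fun u w huw => ?_
  refine Subtype.ext (Subtype.ext (AffineEquiv.ext fun v => ?_))
  rw [← sub_eq_zero]
  refine eq_zero_of_root'_eq_zero (P := P) fun i => ?_
  rw [map_sub, hπ, hπ, huw, sub_self]

/-- The stabilizer of the origin is finite; `q` is the centroid of the orbit of the origin under its
image. -/
theorem exists_fixed_point (δ : MulAut (affineWeylGroup P)) :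
    ∃ q : N, ∀ w ∈ originStabilizer P, (δ w : N ≃ᵃ[ℝ] N) q = q := by
  have := finite_originStabilizer (P := P)
  have := Fintype.ofFinite (originStabilizer P)
  set c := Fintype.card (originStabilizer P) with hc
  have hc0 : (c : ℝ) ≠ 0 := Nat.cast_ne_zero.2 Fintype.card_ne_zero
  refine ⟨(c : ℝ)⁻¹ • ∑ y : originStabilizer P, (δ y : N ≃ᵃ[ℝ] N) 0, fun w hw => ?_⟩
  have h1 : ∑ y : originStabilizer P, (δ y : N ≃ᵃ[ℝ] N) 0 =
      ∑ y : originStabilizer P, ((δ w : N ≃ᵃ[ℝ] N).linear ((δ y : N ≃ᵃ[ℝ] N) 0) +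
        (δ w : N ≃ᵃ[ℝ] N) 0) := by
    rw [← Equiv.sum_comp (Equiv.mulLeft (⟨w, hw⟩ : originStabilizer P))]
    refine Finset.sum_congr rfl fun y _ => ?_
    rw [← affineEquiv_eq_linear_add, ← coe_mul_apply, ← map_mul]
    rfl
  rw [Finset.sum_add_distrib, Finset.sum_const, Finset.card_univ, ← hc, ← map_sum] at h1
  conv_rhs => rw [h1]
  rw [affineEquiv_eq_linear_add, map_smul, smul_add, ← Nat.cast_smul_eq_nsmul ℝ, smul_smul,
    inv_mul_cancel₀ hc0, one_smul]

/-- Every automorphism of the affine Weyl group is the conjugation by an affine transformation. -/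
theorem exists_affineEquiv_realization (δ : MulAut (affineWeylGroup P)) :
    ∃ d : N ≃ᵃ[ℝ] N, ∀ w v, (δ w : N ≃ᵃ[ℝ] N) (d v) = d ((w : N ≃ᵃ[ℝ] N) v) := by
  obtain ⟨D, hD⟩ := exists_linearEquiv_realization δ
  obtain ⟨q, hq⟩ := exists_fixed_point δ
  -- Conjugation by `w` acts on translation vectors through the linear part of `w`, and `δ` respects
  -- conjugation; the coroots span.
  have hlin : ∀ w v, (δ w : N ≃ᵃ[ℝ] N).linear (D v) = D ((w : N ≃ᵃ[ℝ] N).linear v) := by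
    intro w
    have : (δ w : N ≃ᵃ[ℝ] N).linear.toLinearMap ∘ₗ D.toLinearMap =
        D.toLinearMap ∘ₗ (w : N ≃ᵃ[ℝ] N).linear.toLinearMap := by
      refine LinearMap.ext_on (RootPairing.IsRootSystem.span_coroot_eq_top (P := P)) ?_
      rintro _ ⟨i, rfl⟩
      obtain ⟨t, ht1, ht2, ht3⟩ := hD _ (AddSubgroup.subset_closure ⟨i, rfl⟩)
      have h1 := (ht1.conj w).2
      have h2 := ((ht1.map δ).conj (δ w)).2
      obtain ⟨u, hu1, hu2, hu3⟩ := hD ((w : N ≃ᵃ[ℝ] N).linear (P.coroot i)) (by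
        rw [← ht2, ← h1]
        exact apply_mem_closure_coroot _ _ (zero_mem _))
      have e : u = w * t * w⁻¹ := hu1.ext (ht1.conj w).1 (by rw [hu2, h1, ht2])
      rw [e, map_mul, map_mul, map_inv, h2, ht3] at hu3
      exact hu3
    exact fun v => congrArg (fun f => f v) this
  refine ⟨D.toAffineEquiv.trans (AffineEquiv.constVAdd ℝ N q), fun w v => ?_⟩
  simp only [AffineEquiv.trans_apply, LinearEquiv.coe_toAffineEquiv, AffineEquiv.constVAdd_apply,
    vadd_eq_add]
  obtain ⟨t, ht1, ht2, ht3⟩ := hD ((w : N ≃ᵃ[ℝ] N) 0) (apply_mem_closure_coroot _ _ (zero_mem _))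
  -- Here `t` is the translation with the value of `w` at the origin, so `x` fixes the origin and `δ
  -- x` fixes `q`.
  obtain ⟨x, rfl⟩ : ∃ x, w = t * x := ⟨t⁻¹ * w, by group⟩
  have hx : x ∈ originStabilizer P := by
    have h1 : (x : N ≃ᵃ[ℝ] N) 0 + (t : N ≃ᵃ[ℝ] N) 0 = (t : N ≃ᵃ[ℝ] N) 0 := by
      rw [← ht1, ← coe_mul_apply, ht2]
    exact add_eq_right.1 h1
  have hx0 : (x : N ≃ᵃ[ℝ] N) 0 = 0 := hx
  rw [map_mul, coe_mul_apply, coe_mul_apply, add_comm q, affineEquiv_add, hq x hx, hlin,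
    ht1.map δ, ht1, ht3, map_add, ← ht2, affineEquiv_eq_linear_add (x : N ≃ᵃ[ℝ] N) v, hx0, add_zero]
  abel

end Realization

/-! ### Affine transformations that normalize the reflections -/

section DiagramAutomorphism

variable {ι M N : Type*} [AddCommGroup M] [Module ℝ M] [AddCommGroup N] [Module ℝ N]
  {P : RootPairing ι ℝ M N}

theorem root'_injective {i j : ι} (h : ∀ v, P.root' i v = P.root' j v) : i = j := by
  apply P.root.injective
  apply P.isPerfPair_toLinearMap.bijective_left.injective
  exact LinearMap.ext h

theorem affineReflection_eq_self_iff {i : ι} {k : ℤ} {v : N} :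
    affineReflection P i k v = v ↔ v ∈ hyperplane P i k := by
  rw [affineReflection_apply, sub_eq_self, smul_eq_zero, or_iff_left (P.ne_zero' i), sub_eq_zero]
  rfl

theorem hyperplane_eq_of_affineReflection_eq {i j : ι} {k m : ℤ}
    (h : affineReflection P i k = affineReflection P j m) : hyperplane P i k = hyperplane P j m := by
  ext v
  rw [← affineReflection_eq_self_iff, ← affineReflection_eq_self_iff, h]

/-- The map `d` carries mirror to mirror, so the pulled back affine root vanishes on the first
mirror and is a multiple of its affine root. -/
theorem exists_slope {d : N ≃ᵃ[ℝ] N} {i j : ι} {k m : ℤ}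
    (h : ∀ v, affineReflection P j m (d v) = d (affineReflection P i k v)) :
    ∀ v, P.root' j (d v) = P.root' j (d.linear (P.coroot i)) / 2 * (P.root' i v - k) + m := by
  intro v
  have h1 : v - ((P.root' i v - k) / 2) • P.coroot i ∈ hyperplane P i k := by
    rw [hyperplane, Set.mem_ofPred_eq, map_sub, map_smul, root'_coroot_self, smul_eq_mul]
    ring
  have h2 := h (v - ((P.root' i v - k) / 2) • P.coroot i)
  rw [affineReflection_eq_self_iff.2 h1, affineReflection_eq_self_iff] at h2
  have h2 : P.root' j (d _) = m := h2
  rw [sub_eq_neg_add, affineEquiv_add, map_add, map_neg, map_smul, map_neg, map_smul,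
    smul_eq_mul] at h2
  linear_combination h2

theorem slope_ne_zero {d : N ≃ᵃ[ℝ] N} {i j : ι} {k m : ℤ}
    (h : ∀ v, affineReflection P j m (d v) = d (affineReflection P i k v)) :
    P.root' j (d.linear (P.coroot i)) / 2 ≠ 0 := by
  intro h0
  have h1 := exists_slope h
  obtain ⟨v, hv⟩ := d.surjective ((((m : ℝ) + 1) / 2) • P.coroot j)
  have h2 := h1 v
  rw [h0, zero_mul, zero_add, hv, map_smul, root'_coroot_self, smul_eq_mul] at h2
  linarith

variable [P.IsReduced]

/-- The levels `0` and `1` of a root go to parallel mirrors, whose roots agree up to sign. After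
matching the signs, the difference of the integral levels is the slope. -/
theorem exists_int_slope {d : N ≃ᵃ[ℝ] N}
    (h : ∀ i (k : ℤ), ∃ j, ∃ m : ℤ, ∀ v,
      affineReflection P j m (d v) = d (affineReflection P i k v)) (i : ι) :
    ∃ j, ∃ c m : ℤ, ∀ v, P.root' j (d v) = c * P.root' i v + m := by
  obtain ⟨j, m, h1⟩ := h i 0
  obtain ⟨j', m', h2⟩ := h i 1
  have e1 := exists_slope h1
  have e2 := exists_slope h2
  have hc := slope_ne_zero h1
  set c := P.root' j (d.linear (P.coroot i)) / 2 with hcdef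
  set c' := P.root' j' (d.linear (P.coroot i)) / 2 with hcdef'
  have l1 : ∀ v, P.root' j (d.linear v) = c * P.root' i v := fun v => by
    have a := e1 v
    have b := e1 0
    rw [affineEquiv_eq_linear_add, map_add] at a
    rw [map_zero (P.root' i)] at b
    linear_combination a - b
  have l2 : ∀ v, P.root' j' (d.linear v) = c' * P.root' i v := fun v => by
    have a := e2 v
    have b := e2 0
    rw [affineEquiv_eq_linear_add, map_add] at a
    rw [map_zero (P.root' i)] at b
    linear_combination a - b
  have hsub : hyperplane P j 0 ⊆ hyperplane P j' 0 := by
    intro v hv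
    obtain ⟨v, rfl⟩ := d.linear.surjective v
    have hv : P.root' j (d.linear v) = ((0 : ℤ) : ℝ) := hv
    rw [l1, Int.cast_zero] at hv
    change P.root' j' (d.linear v) = ((0 : ℤ) : ℝ)
    rw [l2, (mul_eq_zero.1 hv).resolve_left hc, mul_zero, Int.cast_zero]
  push_cast at e1 e2
  rcases eq_of_hyperplane_subset hsub with ⟨rfl, -⟩ | ⟨hneg, -⟩
  · have hcc : c = ((m' - m : ℤ) : ℝ) := by
      have a := e1 0
      have b := e2 0
      rw [map_zero (P.root' i)] at a b
      push_cast
      linear_combination b - a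
    exact ⟨j', m' - m, m, fun v => by rw [e1, ← hcc]; ring⟩
  · have hcc' : c' = -c := by
      rw [hcdef', hcdef, root'_of_root_eq_neg hneg]
      ring
    have hcc : c = ((-(m' + m) : ℤ) : ℝ) := by
      have a := e1 0
      have b := e2 0
      rw [map_zero (P.root' i)] at a b
      rw [root'_of_root_eq_neg hneg, hcc'] at b
      push_cast
      linear_combination -b - a
    exact ⟨j, -(m' + m), m, fun v => by rw [e1, ← hcc]; ring⟩

/-- The integral slopes of `d` and of its inverse multiply to `1` or `-1`, so they are units; a
slope `-1` is absorbed by replacing the root by its negative. -/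
theorem exists_root'_apply_eq {d : N ≃ᵃ[ℝ] N}
    (h : ∀ i (k : ℤ), ∃ j, ∃ m : ℤ, ∀ v,
      affineReflection P j m (d v) = d (affineReflection P i k v))
    (h' : ∀ i (k : ℤ), ∃ j, ∃ m : ℤ, ∀ v,
      affineReflection P j m (d.symm v) = d.symm (affineReflection P i k v)) (i : ι) :
    ∃ j, ∃ m : ℤ, ∀ v, P.root' j (d v) = P.root' i v + m := by
  obtain ⟨j, c, m, h1⟩ := exists_int_slope h i
  obtain ⟨i', c', m', h2⟩ := exists_int_slope h' j
  have h3 : ∀ v, P.root' i' v = (c' * c : ℤ) * P.root' i v := fun v => by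
    have a := h2 (d v)
    have b := h2 (d 0)
    rw [d.symm_apply_apply, h1] at a b
    rw [map_zero (P.root' i), map_zero (P.root' i')] at b
    push_cast
    linear_combination a - b
  have hsub : hyperplane P i 0 ⊆ hyperplane P i' 0 := by
    intro v hv
    have hv : P.root' i v = ((0 : ℤ) : ℝ) := hv
    change P.root' i' v = ((0 : ℤ) : ℝ)
    rw [h3, hv, Int.cast_zero, mul_zero]
  have hunit : c' * c = 1 ∨ c' * c = -1 := by
    have a := h3 (P.coroot i)
    rw [root'_coroot_self] at a
    rcases eq_of_hyperplane_subset hsub with ⟨rfl, -⟩ | ⟨hneg, -⟩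
    · left
      rw [root'_coroot_self] at a
      have : ((c' * c : ℤ) : ℝ) = (1 : ℤ) := by push_cast at a ⊢; linarith
      exact_mod_cast this
    · right
      rw [root'_of_root_eq_neg hneg, root'_coroot_self] at a
      have : ((c' * c : ℤ) : ℝ) = (-1 : ℤ) := by push_cast at a ⊢; linarith
      exact_mod_cast this
  have hc : IsUnit c := by
    refine isUnit_of_mul_isUnit_right (x := c') ?_
    rcases hunit with h | h <;> rw [h] <;> simp
  rcases Int.isUnit_iff.1 hc with rfl | rfl
  · exact ⟨j, m, fun v => by rw [h1]; push_cast; ring⟩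
  · have hneg : P.root (P.reflectionPerm j j) = -P.root j := P.root_eq_neg_iff.2 rfl
    exact ⟨P.reflectionPerm j j, -m, fun v => by
      rw [root'_of_root_eq_neg hneg, h1]; push_cast; ring⟩

variable [Finite ι]

/-- An affine transformation that permutes the reflections permutes the affine roots. -/
theorem mem_arrangementAut_of_conj {d : N ≃ᵃ[ℝ] N}
    (h : ∀ i (k : ℤ), ∃ j, ∃ m : ℤ, ∀ v,
      affineReflection P j m (d v) = d (affineReflection P i k v))
    (h' : ∀ i (k : ℤ), ∃ j, ∃ m : ℤ, ∀ v,
      affineReflection P j m (d.symm v) = d.symm (affineReflection P i k v)) :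
    d ∈ arrangementAut P := by
  have h1 : ∀ i, ∃ j, ∃ m : ℤ, ∀ v, P.root' j (d.symm v) = P.root' i v + m :=
    exists_root'_apply_eq h' h
  choose π k hπ using h1
  have h2 : ∀ i v, P.root' i (d v) = P.root' (π i) v - k i := fun i v => by
    rw [eq_sub_iff_add_eq, ← hπ, d.symm_apply_apply]
  have hinj : Function.Injective π := by
    intro i i' hii
    have h3 : ∀ v, P.root' i v = P.root' i' v + (k i' - k i) := fun v => by
      have a := hπ i v
      rw [hii, hπ] at a
      linear_combination -a
    have h4 := h3 0
    rw [map_zero, map_zero, zero_add] at h4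
    exact root'_injective fun v => by rw [h3, ← h4, add_zero]
  refine ⟨Equiv.ofBijective π (Finite.injective_iff_bijective.1 hinj), fun i => -k i, fun i v => ?_⟩
  rw [h2, Equiv.ofBijective_apply]
  push_cast
  ring

variable [P.IsRootSystem] [P.IsCrystallographic] {x₀ : N}

/-- An automorphism of the affine Weyl group that preserves the simple reflections is induced by
an automorphism of the arrangement that stabilizes the base alcove. -/
theorem exists_realization (hx : IsRegularPoint P x₀) (δ : MulAut (affineWeylGroup P))
    (hδ : ∀ s, δ s ∈ affineSimpleReflections P x₀ ↔ s ∈ affineSimpleReflections P x₀) :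
    ∃ d ∈ arrangementAut P, (∀ w v, (δ w : N ≃ᵃ[ℝ] N) (d v) = d ((w : N ≃ᵃ[ℝ] N) v)) ∧
      SameAlcove P (d x₀) x₀ := by
  obtain ⟨d, hd⟩ := exists_affineEquiv_realization δ
  have hda : d ∈ arrangementAut P := by
    refine mem_arrangementAut_of_conj (fun i k => ?_) (fun i k => ?_)
    · obtain ⟨j, m, h⟩ := map_mem_affineReflections hx δ (fun s => (hδ s).2)
        (r := affineReflection' P i k) ⟨i, k, rfl⟩
      refine ⟨j, m, fun v => ?_⟩
      have := hd (affineReflection' P i k) v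
      rw [h] at this
      exact this
    · obtain ⟨j, m, h⟩ := map_mem_affineReflections hx δ⁻¹
        (fun s hs => (hδ _).1 (by rwa [MulAut.apply_inv_self]))
        (r := affineReflection' P i k) ⟨i, k, rfl⟩
      refine ⟨j, m, fun v => ?_⟩
      have := hd (affineReflection' P j m) (d.symm v)
      rw [← h, MulAut.apply_inv_self, d.apply_symm_apply, h] at this
      rw [d.eq_symm_apply]
      exact this.symm
  refine ⟨d, hda, hd, sameAlcove_of_isWall (hx.map hda) hx fun j m hw => ?_⟩
  obtain ⟨i, k, h1, h2⟩ := conj_affineReflection (P := P) (inv_mem hda) j m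
  have hw' : IsWall P x₀ i k := by
    have := hw.map (inv_mem hda) h1
    have e : d⁻¹ (d x₀) = x₀ := d.symm_apply_apply x₀
    rwa [e] at this
  have hs : affineReflection' P i k ∈ affineSimpleReflections P x₀ := ⟨i, k, hw', rfl⟩
  obtain ⟨j', m', hw'', h3⟩ := (hδ _).2 hs
  refine hw''.congr (hyperplane_eq_of_affineReflection_eq ?_)
  rw [← h3]
  ext v
  obtain ⟨v, rfl⟩ := d.surjective v
  rw [hd]
  change _ = d (affineReflection P i k v)
  rw [← h2, inv_inv]
  change _ = d (d.symm (affineReflection P j m (d v)))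
  rw [d.apply_symm_apply]

end DiagramAutomorphism

/-! ### Counting sign changes -/

section Counting

theorem sum_natAbs_of_monotone {a : ℕ → ℤ} (h : Monotone a) (n : ℕ) :
    ((∑ j ∈ Finset.range n, (a j - a (j + 1)).natAbs : ℕ) : ℤ) = a n - a 0 := by
  induction n with
  | zero => simp
  | succ n ih =>
    rw [Finset.sum_range_succ, Nat.cast_add, ih]
    have := h n.le_succ
    rw [Nat.succ_eq_add_one] at this
    omega

theorem sum_natAbs_of_antitone {a : ℕ → ℤ} (h : Antitone a) (n : ℕ) :
    ((∑ j ∈ Finset.range n, (a j - a (j + 1)).natAbs : ℕ) : ℤ) = a 0 - a n := by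
  induction n with
  | zero => simp
  | succ n ih =>
    rw [Finset.sum_range_succ, Nat.cast_add, ih]
    have := h n.le_succ
    rw [Nat.succ_eq_add_one] at this
    omega

theorem abs_floor_sub_floor_sub_le (r s : ℝ) : |((⌊r⌋ - ⌊s⌋ : ℤ) : ℝ) - (r - s)| ≤ 1 := by
  rw [abs_le]
  push_cast
  constructor <;>
    linarith [Int.floor_le r, Int.floor_le s, Int.lt_floor_add_one r, Int.lt_floor_add_one s]

/-- Up to a bounded error, the variation of `⌊x j⌋` is linear if `x` is monotone and linear up to
a bounded error. -/
theorem abs_sum_natAbs_floor_sub_le {x : ℕ → ℝ} (h : Monotone x ∨ Antitone x) {r C : ℝ}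
    (hC : ∀ n : ℕ, |x n - x 0 - n * r| ≤ C) (n : ℕ) :
    |((∑ j ∈ Finset.range n, (⌊x j⌋ - ⌊x (j + 1)⌋).natAbs : ℕ) : ℝ) - n * (|r|)| ≤ C + 1 := by
  have key : |(((∑ j ∈ Finset.range n, (⌊x j⌋ - ⌊x (j + 1)⌋).natAbs : ℕ) : ℤ) : ℝ)| =
      |((⌊x n⌋ - ⌊x 0⌋ : ℤ) : ℝ)| := by
    rcases h with h | h
    · rw [sum_natAbs_of_monotone (a := fun j => ⌊x j⌋) (Int.floor_mono.comp h)]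
    · rw [sum_natAbs_of_antitone (a := fun j => ⌊x j⌋) (Int.floor_mono.comp_antitone h),
        ← abs_neg]
      congr 1
      push_cast
      ring
  rw [Int.cast_natCast, abs_of_nonneg (Nat.cast_nonneg _)] at key
  have e : (n : ℝ) * |r| = |n * r| := by rw [abs_mul, Nat.abs_cast]
  rw [key, e]
  refine (abs_abs_sub_abs_le_abs_sub _ _).trans ?_
  have h1 := abs_floor_sub_floor_sub_le (x n) (x 0)
  have h2 := hC n
  rw [abs_le] at h1 h2 ⊢
  constructor <;> linarith [h1.1, h1.2, h2.1, h2.2]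

/-- The floor counts half-periods; the shift by `1 / 2` puts its jumps at the zeros of the cosine.
-/
theorem cos_pos_iff_even_floor {x : ℝ} (hx : Real.cos x ≠ 0) :
    0 < Real.cos x ↔ Even ⌊x / Real.pi + 1 / 2⌋ := by
  have hpi := Real.pi_pos
  set k := ⌊x / Real.pi + 1 / 2⌋ with hk
  have h1 : (k : ℝ) ≤ x / Real.pi + 1 / 2 := Int.floor_le _
  have h2 : x / Real.pi + 1 / 2 < k + 1 := Int.lt_floor_add_one _
  have e : x = (x - k * Real.pi) + k * Real.pi := by ring
  have h3 : x / Real.pi * Real.pi = x := div_mul_cancel₀ _ hpi.ne'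
  have h4 : 0 ≤ Real.cos (x - k * Real.pi) := by
    apply Real.cos_nonneg_of_mem_Icc
    constructor <;> nlinarith
  rw [e, Real.cos_add_int_mul_pi] at hx ⊢
  have h5 := lt_of_le_of_ne h4 (right_ne_zero_of_mul hx).symm
  rcases Int.even_or_odd k with hk | hk
  · rw [hk.neg_one_zpow, one_mul]
    exact iff_of_true h5 hk
  · rw [hk.neg_one_zpow]
    refine iff_of_false (by linarith) (Int.not_even_iff_odd.2 hk)

/-- A solution of the recursion `z (j + 2) + z j = 2 cos θ z (j + 1)` is a sampled cosine. -/
theorem exists_eq_mul_cos {z : ℕ → ℝ} {θ : ℝ} (hθ : Real.sin θ ≠ 0)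
    (hz : ∀ j, z (j + 2) + z j = 2 * Real.cos θ * z (j + 1)) :
    ∃ A φ : ℝ, 0 ≤ A ∧ ∀ j : ℕ, z j = A * Real.cos (j * θ + φ) := by
  -- Norm and argument of `w` are the amplitude and the phase. Its parts are dictated by `z 0 = A
  -- cos φ` and `z 1 = A cos (θ + φ)`, which suffices for a recursion of order two.
  set w : ℂ := ⟨z 0, (z 0 * Real.cos θ - z 1) / Real.sin θ⟩ with hw
  refine ⟨‖w‖, w.arg, norm_nonneg _, ?_⟩
  have h1 : ‖w‖ * Real.cos w.arg = z 0 := Complex.norm_mul_cos_arg w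
  have h2 : ‖w‖ * Real.sin w.arg = (z 0 * Real.cos θ - z 1) / Real.sin θ :=
    Complex.norm_mul_sin_arg w
  rw [eq_div_iff hθ] at h2
  have key : ∀ j : ℕ, z j = ‖w‖ * Real.cos (j * θ + w.arg) ∧
      z (j + 1) = ‖w‖ * Real.cos ((j + 1 : ℕ) * θ + w.arg) := by
    intro j
    induction j with
    | zero =>
      refine ⟨by simpa using h1.symm, ?_⟩
      rw [zero_add, Nat.cast_one, one_mul, Real.cos_add]
      linear_combination Real.cos θ * (-h1) + h2
    | succ j ih =>
      refine ⟨ih.2, ?_⟩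
      have e : Real.cos ((j + 1 + 1 : ℕ) * θ + w.arg) + Real.cos (j * θ + w.arg) =
          2 * Real.cos θ * Real.cos ((j + 1 : ℕ) * θ + w.arg) := by
        have e1 : ((j + 1 + 1 : ℕ) : ℝ) * θ + w.arg = ((j + 1 : ℕ) * θ + w.arg) + θ := by
          push_cast; ring
        have e2 : (j : ℝ) * θ + w.arg = ((j + 1 : ℕ) * θ + w.arg) - θ := by push_cast; ring
        rw [e1, e2, Real.cos_add, Real.cos_sub]
        ring
      have h3 := hz j
      rw [ih.1, ih.2] at h3
      linear_combination h3 - ‖w‖ * e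
  exact fun j => (key j).1

/-- The number of sign changes of a solution of `z (j + 2) + z j = μ z (j + 1)` grows linearly, at
a rate that depends on `μ` only. -/
theorem exists_abs_sum_sign_sub_le {z : ℕ → ℝ} {μ : ℝ} (h1 : -2 ≤ μ) (h2 : μ < 2)
    (hz : ∀ j, z (j + 2) + z j = μ * z (j + 1)) (h3 : μ = -2 → ∀ j, z (j + 1) = -z j)
    (h0 : ∀ j, z j ≠ 0) {σ : ℕ → ℤ} (hσ : ∀ j, σ j = if 0 < z j then 0 else -1) :
    ∃ C : ℝ, ∀ n : ℕ, |((∑ j ∈ Finset.range n, (σ j - σ (j + 1)).natAbs : ℕ) : ℝ) -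
      n * (Real.arccos (μ / 2) / Real.pi)| ≤ C := by
  -- For `μ = -2` the angle is `π`, its sine vanishes and the cosine formula is unavailable; the
  -- sign then changes at every step, at rate `1`.
  rcases h1.eq_or_lt with rfl | h1
  · refine ⟨0, fun n => ?_⟩
    have e : ∀ j, (σ j - σ (j + 1)).natAbs = 1 := by
      intro j
      rw [hσ, hσ, h3 rfl]
      rcases lt_or_gt_of_ne (h0 j) with h | h
      · rw [if_neg h.not_gt, if_pos (by linarith)]; rfl
      · rw [if_pos h, if_neg (by linarith)]; rfl
    have e2 : (-2 : ℝ) / 2 = -1 := by norm_num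
    simp only [e, Finset.sum_const, Finset.card_range, smul_eq_mul, mul_one]
    rw [e2, Real.arccos_neg_one, div_self Real.pi_ne_zero, mul_one, sub_self, abs_zero]
  · set θ := Real.arccos (μ / 2) with hθ
    have hpi := Real.pi_pos
    have hcos : Real.cos θ = μ / 2 := Real.cos_arccos (by linarith) (by linarith)
    have hθ0 : 0 < θ := Real.arccos_pos.2 (by linarith)
    have hθ1 : θ < Real.pi := lt_of_le_of_ne (Real.arccos_le_pi _) fun h => by
      rw [h, Real.cos_pi] at hcos
      linarith
    obtain ⟨A, φ, hA, hzA⟩ := exists_eq_mul_cos (Real.sin_pos_of_pos_of_lt_pi hθ0 hθ1).ne'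
      (z := z) (fun j => by rw [hz, hcos]; ring)
    -- The parity of `⌊F j⌋` is the sign of `z j`. Since `θ < π` the floor grows by at most one per
    -- step, so its variation counts the sign changes.
    set F : ℕ → ℝ := fun j => (j * θ + φ) / Real.pi + 1 / 2 with hF
    have hA' : 0 < A := lt_of_le_of_ne hA fun h => h0 0 (by rw [hzA, ← h, zero_mul])
    have hsign : ∀ j, 0 < z j ↔ Even ⌊F j⌋ := fun j => by
      rw [← cos_pos_iff_even_floor (fun h => h0 j (by rw [hzA, h, mul_zero])), hzA,
        mul_pos_iff_of_pos_left hA']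
    have hstep : ∀ j, F (j + 1) = F j + θ / Real.pi := fun j => by
      simp only [hF]
      push_cast
      ring
    have hr0 : 0 < θ / Real.pi := div_pos hθ0 hpi
    have hr1 : θ / Real.pi < 1 := (div_lt_one hpi).2 hθ1
    have hmono : Monotone F := monotone_nat_of_le_succ fun j => by rw [hstep]; linarith
    have e : ∀ j, (σ j - σ (j + 1)).natAbs = (⌊F j⌋ - ⌊F (j + 1)⌋).natAbs := by
      intro j
      have a1 : ⌊F j⌋ ≤ ⌊F (j + 1)⌋ := Int.floor_mono (hmono j.le_succ)
      have a2 : ⌊F (j + 1)⌋ ≤ ⌊F j⌋ + 1 := by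
        rw [hstep, ← Int.floor_add_one]
        exact Int.floor_mono (by linarith)
      rw [hσ, hσ]
      simp only [hsign]
      rcases (by omega : ⌊F (j + 1)⌋ = ⌊F j⌋ ∨ ⌊F (j + 1)⌋ = ⌊F j⌋ + 1) with h | h
      · rw [h]
        split_ifs <;> simp
      · rw [h]
        have hiff : Even (⌊F j⌋ + 1) ↔ ¬Even ⌊F j⌋ := Int.even_add_one
        by_cases hev : Even ⌊F j⌋
        · rw [if_pos hev, if_neg (fun h' => hiff.1 h' hev)]
          omega
        · rw [if_neg hev, if_pos (hiff.2 hev)]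
          omega
    refine ⟨0 + 1, fun n => ?_⟩
    simp only [e]
    rw [← abs_of_pos hr0]
    refine abs_sum_natAbs_floor_sub_le (Or.inl hmono) (fun n => ?_) n
    simp only [hF]
    rw [abs_nonpos_iff]
    push_cast
    ring

end Counting

/-! ### The spectral decomposition of an isometry and the associated flow -/

section Flow

open Filter Topology

variable {E : Type*} [NormedAddCommGroup E] [InnerProductSpace ℝ E]

/-- The eigenvectors of `γ + γ⁻¹` with eigenvalue `2 - e`. -/
def IsEigen (γ : E ≃ₗ[ℝ] E) (e : ℝ) (x : E) : Prop :=
  γ x + γ.symm x = (2 - e) • x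

/-- An orthonormal basis of eigenvectors of `γ + γ⁻¹`; the eigenvalues are written `2 - c k`. -/
structure SpectralBasis (γ : E ≃ₗ[ℝ] E) where
  basis : OrthonormalBasis (Fin (Module.finrank ℝ E)) ℝ E
  exponent : Fin (Module.finrank ℝ E) → ℝ
  isEigen : ∀ k, IsEigen γ (exponent k) (basis k)

variable {γ : E ≃ₗ[ℝ] E}

theorem inner_symm_left (hγ : ∀ v w, inner ℝ (γ v) (γ w) = inner ℝ v w) (v w : E) :
    inner ℝ (γ.symm v) w = inner ℝ v (γ w) := by
  rw [← hγ, γ.apply_symm_apply]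

theorem inner_symm_right (hγ : ∀ v w, inner ℝ (γ v) (γ w) = inner ℝ v w) (v w : E) :
    inner ℝ v (γ.symm w) = inner ℝ (γ v) w := by
  rw [← hγ, γ.apply_symm_apply]

theorem norm_apply_eq (hγ : ∀ v w, inner ℝ (γ v) (γ w) = inner ℝ v w) (v : E) : ‖γ v‖ = ‖v‖ := by
  rw [@norm_eq_sqrt_real_inner, @norm_eq_sqrt_real_inner, hγ]

theorem norm_pow_apply_eq (hγ : ∀ v w, inner ℝ (γ v) (γ w) = inner ℝ v w) (n : ℕ) (v : E) :
    ‖(γ ^ n) v‖ = ‖v‖ := by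
  induction n with
  | zero => rfl
  | succ n ih => rw [pow_succ', LinearEquiv.mul_apply, norm_apply_eq hγ, ih]

theorem nonempty_spectralBasis [FiniteDimensional ℝ E]
    (hγ : ∀ v w, inner ℝ (γ v) (γ w) = inner ℝ v w) : Nonempty (SpectralBasis γ) := by
  have hT : (γ.toLinearMap + γ.symm.toLinearMap).IsSymmetric := by
    intro v w
    simp only [LinearMap.add_apply, LinearEquiv.coe_coe, inner_add_left, inner_add_right,
      inner_symm_left hγ, inner_symm_right hγ]
    rw [add_comm]
  refine ⟨⟨hT.eigenvectorBasis rfl, fun k => 2 - hT.eigenvalues rfl k, fun k => ?_⟩⟩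
  have := hT.apply_eigenvectorBasis rfl k
  rw [IsEigen, sub_sub_cancel]
  exact this

theorem IsEigen.map {e : ℝ} {x : E} (h : IsEigen γ e x) : IsEigen γ e (γ x) := by
  have := congrArg γ h
  rw [map_add, γ.apply_symm_apply, map_smul] at this
  rw [IsEigen, γ.symm_apply_apply, this]

theorem IsEigen.pow {e : ℝ} {x : E} (h : IsEigen γ e x) (n : ℕ) : IsEigen γ e ((γ ^ n) x) := by
  induction n with
  | zero => exact h
  | succ n ih => rw [pow_succ', LinearEquiv.mul_apply]; exact ih.map

/-- For an eigenvector of exponent `e` one has `‖γ x - x‖² = e ‖x‖²`; the other end of the range, `e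
= 4`, corresponds to `γ x = -x`. -/
theorem isEigen_zero_iff (hγ : ∀ v w, inner ℝ (γ v) (γ w) = inner ℝ v w) {x : E} :
    IsEigen γ 0 x ↔ γ x = x := by
  constructor
  · intro h
    have h1 := congrArg (inner ℝ x) h
    rw [inner_add_right, inner_symm_right hγ, inner_smul_right, real_inner_comm x (γ x)] at h1
    rw [← sub_eq_zero, ← inner_self_eq_zero (𝕜 := ℝ), inner_sub_left, inner_sub_right,
      inner_sub_right, hγ, real_inner_comm x (γ x)]
    linarith
  · intro h
    have : γ.symm x = x := by rw [LinearEquiv.symm_apply_eq, h]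
    rw [IsEigen, h, this]
    module

theorem IsEigen.apply_eq_neg (hγ : ∀ v w, inner ℝ (γ v) (γ w) = inner ℝ v w) {x : E}
    (h : IsEigen γ 4 x) : γ x = -x := by
  have h1 := congrArg (inner ℝ x) h
  rw [inner_add_right, inner_symm_right hγ, inner_smul_right, real_inner_comm x (γ x)] at h1
  rw [← sub_eq_zero, sub_neg_eq_add, ← inner_self_eq_zero (𝕜 := ℝ), inner_add_left,
    inner_add_right, inner_add_right, hγ, real_inner_comm x (γ x)]
  linarith

theorem IsEigen.mem_Icc (hγ : ∀ v w, inner ℝ (γ v) (γ w) = inner ℝ v w) {e : ℝ} {x : E}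
    (h : IsEigen γ e x) (hx : x ≠ 0) : 0 ≤ e ∧ e ≤ 4 := by
  have h1 := congrArg (inner ℝ x) h
  rw [inner_add_right, inner_symm_right hγ, inner_smul_right, real_inner_comm x (γ x),
    real_inner_self_eq_norm_sq] at h1
  have h2 := abs_real_inner_le_norm x (γ x)
  rw [norm_apply_eq hγ, abs_le] at h2
  have h3 : 0 < ‖x‖ ^ 2 := pow_pos (norm_pos_iff.2 hx) 2
  constructor
  · by_contra! hcon
    nlinarith
  · by_contra! hcon
    nlinarith

namespace SpectralBasis

variable (B : SpectralBasis γ)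

/-- The functional calculus: the linear map that multiplies the `k`-th basis vector by
`f (c k)`. -/
noncomputable def calculus (f : ℝ → ℝ) : E →ₗ[ℝ] E :=
  ∑ k, f (B.exponent k) • (innerₗ E (B.basis k)).smulRight (B.basis k)

theorem calculus_apply (f : ℝ → ℝ) (z : E) :
    B.calculus f z = ∑ k, (f (B.exponent k) * inner ℝ (B.basis k) z) • B.basis k := by
  simp only [calculus, LinearMap.sum_apply, LinearMap.smul_apply, LinearMap.smulRight_apply,
    innerₗ_apply_apply, smul_smul]

theorem inner_calculus (f : ℝ → ℝ) (z : E) (k) :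
    inner ℝ (B.basis k) (B.calculus f z) = f (B.exponent k) * inner ℝ (B.basis k) z := by
  rw [calculus_apply, B.basis.orthonormal.inner_right_fintype]

theorem ext_inner {x y : E} (h : ∀ k, inner ℝ (B.basis k) x = inner ℝ (B.basis k) y) : x = y := by
  rw [← B.basis.sum_repr' x, ← B.basis.sum_repr' y]
  simp only [h]

theorem calculus_calculus (f g : ℝ → ℝ) (z : E) : B.calculus f (B.calculus g z) = B.calculus (f * g) z :=
  B.ext_inner fun k => by rw [inner_calculus, inner_calculus, inner_calculus, Pi.mul_apply, mul_assoc]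

theorem calculus_eq_self {f : ℝ → ℝ} (hf : ∀ e, f e = 1) (z : E) : B.calculus f z = z :=
  B.ext_inner fun k => by rw [inner_calculus, hf, one_mul]

theorem inner_eq_zero (hγ : ∀ v w, inner ℝ (γ v) (γ w) = inner ℝ v w) {e : ℝ} {x : E}
    (h : IsEigen γ e x) {k} (hk : B.exponent k ≠ e) : inner ℝ (B.basis k) x = 0 := by
  have h1 := congrArg (inner ℝ (B.basis k)) h
  have h2 := congrArg (fun y => inner ℝ y x) (B.isEigen k)
  rw [inner_add_right, inner_symm_right hγ, inner_smul_right] at h1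
  rw [inner_add_left, inner_symm_left hγ, inner_smul_left] at h2
  simp only [conj_trivial] at h2
  have h3 : (e - B.exponent k) * inner ℝ (B.basis k) x = 0 := by linear_combination h1 - h2
  exact (mul_eq_zero.1 h3).resolve_left (sub_ne_zero.2 hk.symm)

theorem calculus_of_isEigen (hγ : ∀ v w, inner ℝ (γ v) (γ w) = inner ℝ v w) (f : ℝ → ℝ) {e : ℝ}
    {x : E} (h : IsEigen γ e x) : B.calculus f x = f e • x :=
  B.ext_inner fun k => by
    rw [inner_calculus, inner_smul_right]
    by_cases hk : B.exponent k = e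
    · rw [hk]
    · rw [B.inner_eq_zero hγ h hk, mul_zero, mul_zero]

theorem apply_add_symm_apply (z : E) :
    γ z + γ.symm z = B.calculus (fun e => 2 - e) z := by
  conv_lhs => rw [← B.basis.sum_repr' z]
  rw [calculus_apply, map_sum, map_sum, ← Finset.sum_add_distrib]
  refine Finset.sum_congr rfl fun k _ => ?_
  have := B.isEigen k
  rw [IsEigen] at this
  rw [map_smul, map_smul, ← smul_add, this, smul_smul, mul_comm]

/-- The component of a vector in the eigenspace of exponent `e`. -/
noncomputable def component (e : ℝ) : E →ₗ[ℝ] E := B.calculus fun e' => if e' = e then 1 else 0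

theorem isEigen_component (e : ℝ) (z : E) : IsEigen γ e (B.component e z) := by
  rw [IsEigen, B.apply_add_symm_apply, component, calculus_calculus]
  refine B.ext_inner fun k => ?_
  rw [inner_calculus, inner_smul_right, inner_calculus, Pi.mul_apply]
  by_cases h : B.exponent k = e
  · rw [if_pos h, h, mul_assoc]
  · rw [if_neg h]; ring

theorem component_of_isEigen (hγ : ∀ v w, inner ℝ (γ v) (γ w) = inner ℝ v w) {e : ℝ} {x : E}
    (h : IsEigen γ e x) : B.component e x = x := by
  rw [component, B.calculus_of_isEigen hγ _ h, if_pos rfl, one_smul]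

/-- The gradient flow of `x ↦ -‖γ x - x‖²`. -/
noncomputable def flow (t : ℝ) : E →ₗ[ℝ] E := B.calculus fun e => Real.exp (-(e * t))

theorem flow_zero (z : E) : B.flow 0 z = z := B.calculus_eq_self (fun e => by simp) z

theorem flow_neg_flow (t : ℝ) (z : E) : B.flow (-t) (B.flow t z) = z := by
  rw [flow, flow, calculus_calculus]
  refine B.calculus_eq_self (fun e => ?_) z
  rw [Pi.mul_apply, ← Real.exp_add]
  simp

theorem contDiff_flow {F : Type*} [NormedAddCommGroup F] [NormedSpace ℝ F] {τ : F → ℝ} {x : F → E}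
    (hτ : ContDiff ℝ 1 τ) (hx : ContDiff ℝ 1 x) : ContDiff ℝ 1 fun p => B.flow (τ p) (x p) := by
  simp only [flow, calculus_apply]
  refine ContDiff.sum fun k _ => ContDiff.smul (ContDiff.mul ?_ (contDiff_const.inner ℝ hx))
    contDiff_const
  fun_prop

theorem hasDerivAt_flow (z : E) (t : ℝ) :
    HasDerivAt (fun t => B.flow t z)
      (γ (B.flow t z) + γ.symm (B.flow t z) - (2 : ℝ) • B.flow t z) t := by
  have h1 : γ (B.flow t z) + γ.symm (B.flow t z) - (2 : ℝ) • B.flow t z =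
      ∑ k, (Real.exp (-(B.exponent k * t)) * -(B.exponent k * 1) * inner ℝ (B.basis k) z) •
        B.basis k := by
    rw [B.apply_add_symm_apply]
    refine B.ext_inner fun k => ?_
    rw [inner_sub_right, inner_calculus, inner_smul_right, flow, inner_calculus,
      B.basis.orthonormal.inner_right_fintype]
    ring
  rw [h1]
  simp only [flow, calculus_apply]
  refine HasDerivAt.fun_sum fun k _ => ?_
  refine HasDerivAt.smul_const (HasDerivAt.mul_const ?_ _) _
  exact ((hasDerivAt_id t).const_mul (B.exponent k)).neg.exp

theorem exponent_nonneg (hγ : ∀ v w, inner ℝ (γ v) (γ w) = inner ℝ v w) (k) :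
    0 ≤ B.exponent k :=
  ((B.isEigen k).mem_Icc hγ (B.basis.orthonormal.ne_zero k)).1

theorem tendsto_exp_neg_mul {a : ℝ} (ha : 0 < a) :
    Tendsto (fun t : ℝ => Real.exp (-(a * t))) atTop (𝓝 0) :=
  Real.tendsto_exp_neg_atTop_nhds_zero.comp (tendsto_id.const_mul_atTop ha)

theorem tendsto_flow (hγ : ∀ v w, inner ℝ (γ v) (γ w) = inner ℝ v w) (z : E) :
    Tendsto (fun t => B.flow t z) atTop (𝓝 (B.component 0 z)) := by
  simp only [flow, component, calculus_apply]
  refine tendsto_finsetSum _ fun k _ => Tendsto.smul_const (Tendsto.mul_const _ ?_) _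
  split_ifs with h
  · simp only [h, zero_mul, neg_zero, Real.exp_zero]
    exact tendsto_const_nhds
  · exact tendsto_exp_neg_mul (lt_of_le_of_ne (B.exponent_nonneg hγ k) (Ne.symm h))

/-- The sign of a linear form along the flow is eventually that of its leading term. -/
theorem eventually_mul_pos {α : E →ₗ[ℝ] ℝ} {e : ℝ} (he : ∀ e' < e, ∀ x, IsEigen γ e' x → α x = 0)
    {z : E} (hz : α (B.component e z) ≠ 0) :
    ∀ᶠ t in atTop, 0 < α (B.flow t z) * α (B.component e z) := by
  -- After rescaling, the terms of exponent above `e` decay, and those below `e` are killed by `α`.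
  have h1 : Tendsto (fun t => Real.exp (e * t) * α (B.flow t z)) atTop
      (𝓝 (α (B.component e z))) := by
    simp only [flow, component, calculus_apply, map_sum, map_smul, smul_eq_mul, Finset.mul_sum]
    refine tendsto_finsetSum _ fun k _ => ?_
    rcases lt_trichotomy (B.exponent k) e with h | h | h
    · rw [he _ h _ (B.isEigen k)]
      simp
    · rw [if_pos h]
      have : ∀ t, Real.exp (e * t) * (Real.exp (-(B.exponent k * t)) * inner ℝ (B.basis k) z *
          α (B.basis k)) = 1 * inner ℝ (B.basis k) z * α (B.basis k) := fun t => by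
        rw [h, ← mul_assoc, ← mul_assoc, ← Real.exp_add, add_neg_cancel, Real.exp_zero]
      simp only [this]
      exact tendsto_const_nhds
    · rw [if_neg h.ne']
      have : ∀ t, Real.exp (e * t) * (Real.exp (-(B.exponent k * t)) * inner ℝ (B.basis k) z *
          α (B.basis k)) = Real.exp (-((B.exponent k - e) * t)) * inner ℝ (B.basis k) z *
          α (B.basis k) := fun t => by
        rw [← mul_assoc, ← mul_assoc, ← Real.exp_add]
        ring_nf
      simp only [this]
      exact ((tendsto_exp_neg_mul (sub_pos.2 h)).mul_const _).mul_const _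
  have h2 := (h1.mul_const (α (B.component e z))).eventually_const_lt (mul_self_pos.2 hz)
  filter_upwards [h2] with t ht
  rw [mul_assoc] at ht
  exact pos_of_mul_pos_right ht (Real.exp_pos _).le

/-- The leading exponent of a nonzero linear form. -/
theorem exists_leading (B : SpectralBasis γ) (hγ : ∀ v w, inner ℝ (γ v) (γ w) = inner ℝ v w) {α : E →ₗ[ℝ] ℝ}
    (hα : α ≠ 0) : ∃ e, (∃ x, IsEigen γ e x ∧ α x ≠ 0) ∧ ∀ e' < e, ∀ x, IsEigen γ e' x → α x = 0 := by
  have hne : (Finset.univ.filter fun k => α (B.basis k) ≠ 0).Nonempty := by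
    by_contra! h
    apply hα
    rw [Finset.filter_eq_empty_iff] at h
    refine B.basis.toBasis.ext fun k => ?_
    rw [OrthonormalBasis.coe_toBasis]
    exact not_not.1 (h (Finset.mem_univ k))
  obtain ⟨k, hk, hmin⟩ := Finset.exists_min_image _ B.exponent hne
  refine ⟨B.exponent k, ⟨_, B.isEigen k, (Finset.mem_filter.1 hk).2⟩, fun e' he' x hx => ?_⟩
  rw [← B.basis.sum_repr' x, map_sum]
  refine Finset.sum_eq_zero fun l _ => ?_
  rw [map_smul, smul_eq_mul]
  by_cases hl : B.exponent l = e'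
  · have : α (B.basis l) = 0 := by
      by_contra h
      have := hmin l (Finset.mem_filter.2 ⟨Finset.mem_univ _, h⟩)
      linarith
    rw [this, mul_zero]
  · rw [B.inner_eq_zero hγ hx hl, zero_mul]

end SpectralBasis

end Flow

/-! ### The asymptotic displacement along the flow -/

section Asymptotics

open Filter Topology

variable {ι M E : Type*} [AddCommGroup M] [Module ℝ M] [NormedAddCommGroup E]
  [InnerProductSpace ℝ E]

/-- An affine isometry is the composition of a rotation about some point and a translation along
its axis. -/
theorem exists_axis [FiniteDimensional ℝ E] {g : E ≃ᵃ[ℝ] E}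
    (hγ : ∀ v w, inner ℝ (g.linear v) (g.linear w) = inner ℝ v w) :
    ∃ o ν : E, g o = o + ν ∧ g.linear ν = ν := by
  -- The component of `g 0` in the range of `1 - g.linear` is removed by moving the base point. The
  -- orthogonal complement of that range consists of fixed vectors, as `g.linear` is an isometry.
  obtain ⟨y, ⟨u, rfl⟩, ν, hν, h⟩ := Submodule.exists_add_mem_mem_orthogonal
    (K := (LinearMap.id - g.linear.toLinearMap).range) (g 0)
  refine ⟨u, ν, ?_, ?_⟩
  · rw [affineEquiv_eq_linear_add, h]
    simp only [LinearMap.sub_apply, LinearMap.id_apply, LinearEquiv.coe_coe]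
    abel
  · have h1 := (Submodule.mem_orthogonal _ _).1 hν _ ⟨ν, rfl⟩
    simp only [LinearMap.sub_apply, LinearMap.id_apply, LinearEquiv.coe_coe, inner_sub_left] at h1
    rw [← sub_eq_zero, ← inner_self_eq_zero (𝕜 := ℝ), inner_sub_left, inner_sub_right,
      inner_sub_right, hγ, real_inner_comm (g.linear ν) ν]
    linarith

theorem pow_apply_axis {g : E ≃ᵃ[ℝ] E} {o ν : E} (ho : g o = o + ν) (hν : g.linear ν = ν) (n : ℕ)
    (x : E) : (g ^ n) (o + x) = o + (n : ℝ) • ν + (g.linear ^ n) x := by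
  induction n with
  | zero => simp
  | succ n ih =>
    have e : (g ^ (n + 1)) (o + x) = g ((g ^ n) (o + x)) := by rw [pow_succ']; rfl
    rw [e, ih, add_assoc, add_comm o, affineEquiv_add, ho, map_add, map_smul, hν, pow_succ',
      LinearEquiv.mul_apply]
    push_cast
    module

variable {P : RootPairing ι ℝ M E}

theorem exists_root'_linear_pow {g : E ≃ᵃ[ℝ] E} (hg : g ∈ arrangementAut P) (n : ℕ) (i : ι) :
    ∃ j, ∀ v, P.root' i ((g.linear ^ n) v) = P.root' j v := by
  obtain ⟨π, k, h⟩ := pow_mem hg n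
  refine ⟨π i, fun v => ?_⟩
  rw [← linear_pow_apply]
  exact root'_linear (h i) v

/-- The starting points of the flow with a regular asymptotic behaviour. -/
structure IsGenericStart (P : RootPairing ι ℝ M E) {γ : E ≃ₗ[ℝ] E} (B : SpectralBasis γ) (o z : E) :
    Prop where
  leading : ∀ i e, P.root' i (B.component e z) = 0 → ∀ x, IsEigen γ e x → P.root' i x = 0
  integral : ∀ i (k : ℤ), P.root' i (o + B.component 0 z) = k → ∀ x, γ x = x → P.root' i x = 0

theorem exists_abs_le_mul_norm [FiniteDimensional ℝ E] (α : E →ₗ[ℝ] ℝ) :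
    ∃ K : ℝ, 0 ≤ K ∧ ∀ x, |α x| ≤ K * ‖x‖ :=
  ⟨‖LinearMap.toContinuousLinearMap α‖, norm_nonneg _,
    fun x => (LinearMap.toContinuousLinearMap α).le_opNorm x⟩

theorem eventually_abs_lt [FiniteDimensional ℝ E] {γ : E ≃ₗ[ℝ] E}
    (hγ : ∀ v w, inner ℝ (γ v) (γ w) = inner ℝ v w) (α : E →ₗ[ℝ] ℝ) {x : ℝ → E}
    (hx : Tendsto x atTop (𝓝 0)) {δ : ℝ} (hδ : 0 < δ) :
    ∀ᶠ t in atTop, ∀ j : ℕ, |α ((γ ^ j) (x t))| < δ := by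
  obtain ⟨K, hK, hα⟩ := exists_abs_le_mul_norm α
  have h := (hx.norm.const_mul K).eventually_lt_const (show K * ‖(0 : E)‖ < δ by simpa using hδ)
  filter_upwards [h] with t ht j
  have := hα ((γ ^ j) (x t))
  rw [norm_pow_apply_eq hγ] at this
  exact this.trans_lt ht

/-- The excluded case is that of a hyperplane that contains the whole fixed space through `o`, and
hence every possible limit of the flow. -/
theorem IsGenericStart.root'_ne {γ : E ≃ₗ[ℝ] E}
    (hγ : ∀ v w, inner ℝ (γ v) (γ w) = inner ℝ v w) {B : SpectralBasis γ} {o z : E}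
    (hz : IsGenericStart P B o z) {i : ι}
    (hi : ¬((∀ x, γ x = x → P.root' i x = 0) ∧ ∃ k : ℤ, P.root' i o = k)) (k : ℤ) :
    P.root' i (o + B.component 0 z) ≠ k := by
  intro h
  have h1 := hz.integral i k h
  refine hi ⟨h1, k, ?_⟩
  rw [map_add, h1 _ ((isEigen_zero_iff hγ).1 (B.isEigen_component 0 z)), add_zero] at h
  exact h

theorem root'_ne_zero (i : ι) : P.root' i ≠ 0 := fun h => by
  have := root'_coroot_self (P := P) i
  rw [h, LinearMap.zero_apply] at this
  norm_num at this

variable [FiniteDimensional ℝ E]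

/-- The flow converges to a point fixed by `γ` at which the root is not integral. The powers of `γ`
preserve the distance to it, so one estimate serves all `j`. -/
theorem IsGenericStart.eventually_mem_Ioo {γ : E ≃ₗ[ℝ] E}
    (hγ : ∀ v w, inner ℝ (γ v) (γ w) = inner ℝ v w) {B : SpectralBasis γ} {o z : E}
    (hz : IsGenericStart P B o z) {i : ι}
    (hi : ¬((∀ x, γ x = x → P.root' i x = 0) ∧ ∃ k : ℤ, P.root' i o = k)) :
    ∃ k : ℤ, ∀ᶠ t in atTop, ∀ j : ℕ,
      P.root' i o + P.root' i ((γ ^ j) (B.flow t z)) ∈ Set.Ioo (k : ℝ) (k + 1) := by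
  set z₀ := B.component 0 z with hz₀
  set β := P.root' i (o + z₀) with hβ
  have hfix : ∀ j : ℕ, (γ ^ j) z₀ = z₀ := by
    intro j
    induction j with
    | zero => rfl
    | succ j ih =>
      rw [pow_succ', LinearEquiv.mul_apply, ih]
      exact (isEigen_zero_iff hγ).1 (B.isEigen_component 0 z)
  have h1 : (⌊β⌋ : ℝ) < β := lt_of_le_of_ne (Int.floor_le _) (hz.root'_ne hγ hi _).symm
  have h2 : β < ⌊β⌋ + 1 := Int.lt_floor_add_one _
  have hlim : Tendsto (fun t => B.flow t z - z₀) atTop (𝓝 0) := by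
    rw [← sub_self z₀]
    exact (B.tendsto_flow hγ z).sub_const _
  refine ⟨⌊β⌋, ?_⟩
  filter_upwards [eventually_abs_lt hγ (P.root' i) hlim (sub_pos.2 h1),
    eventually_abs_lt hγ (P.root' i) hlim (sub_pos.2 h2)] with t ht1 ht2 j
  have a1 := ht1 j
  have a2 := ht2 j
  have hβ' : β = P.root' i o + P.root' i z₀ := map_add _ _ _
  rw [map_sub, map_sub, hfix, abs_lt] at a1 a2
  constructor <;> linarith [a1.1, a2.2]

/-- Powers of the linear part permute the roots and preserve the leading exponent, so uniformity in
`j` reduces to finitely many instances of `eventually_mul_pos`. -/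
theorem IsGenericStart.eventually_sign [Finite ι] {g : E ≃ᵃ[ℝ] E} (hg : g ∈ arrangementAut P)
    (hγ : ∀ v w, inner ℝ (g.linear v) (g.linear w) = inner ℝ v w) {B : SpectralBasis g.linear}
    {o z : E} (hz : IsGenericStart P B o z) {i : ι} (hi : ∀ x, g.linear x = x → P.root' i x = 0)
    {e : ℝ} (he : ∃ x, IsEigen g.linear e x ∧ P.root' i x ≠ 0)
    (he' : ∀ e' < e, ∀ x, IsEigen g.linear e' x → P.root' i x = 0) :
    ∀ᶠ t in atTop, ∀ j : ℕ, |P.root' i ((g.linear ^ j) (B.flow t z))| < 1 ∧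
      0 < P.root' i ((g.linear ^ j) (B.flow t z)) *
        P.root' i ((g.linear ^ j) (B.component e z)) := by
  have hsmall : ∀ᶠ t in atTop, ∀ j : ℕ, |P.root' i ((g.linear ^ j) (B.flow t z))| < 1 := by
    have hlim : Tendsto (fun t => B.flow t z - B.component 0 z) atTop (𝓝 0) := by
      rw [← sub_self (B.component 0 z)]
      exact (B.tendsto_flow hγ z).sub_const _
    filter_upwards [eventually_abs_lt hγ (P.root' i) hlim one_pos] with t ht j
    have := ht j
    rwa [map_sub, map_sub, hi ((g.linear ^ j) _) ((isEigen_zero_iff hγ).1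
      ((B.isEigen_component 0 z).pow j)), sub_zero] at this
  have hall : ∀ᶠ t in atTop, ∀ i' : ι,
      (∃ x, IsEigen g.linear e x ∧ P.root' i' x ≠ 0) →
      (∀ e' < e, ∀ x, IsEigen g.linear e' x → P.root' i' x = 0) →
      0 < P.root' i' (B.flow t z) * P.root' i' (B.component e z) := by
    rw [eventually_all]
    intro i'
    by_cases h1 : ∃ x, IsEigen g.linear e x ∧ P.root' i' x ≠ 0
    · by_cases h2 : ∀ e' < e, ∀ x, IsEigen g.linear e' x → P.root' i' x = 0
      · obtain ⟨x, hx, hx'⟩ := h1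
        filter_upwards [B.eventually_mul_pos h2 (z := z)
          fun h0 => hx' (hz.leading i' e h0 x hx)] with t ht _ _
        exact ht
      · exact Eventually.of_forall fun t _ h => absurd h h2
    · exact Eventually.of_forall fun t h => absurd h h1
  filter_upwards [hsmall, hall] with t h1 h2 j
  refine ⟨h1 j, ?_⟩
  obtain ⟨i', hi'⟩ := exists_root'_linear_pow hg j i
  rw [hi', hi']
  refine h2 i' ?_ fun e' h x hx => ?_
  · obtain ⟨x, hx, hx'⟩ := he
    have hs : ∀ (n : ℕ) {x : E}, IsEigen g.linear e x →
        ∃ y, IsEigen g.linear e y ∧ (g.linear ^ n) y = x := by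
      intro n
      induction n with
      | zero => exact fun {x} hx => ⟨x, hx, rfl⟩
      | succ n ih =>
        intro x hx
        have h3 : IsEigen g.linear e (g.linear.symm x) := by
          have := congrArg g.linear.symm hx
          rw [map_add, g.linear.symm_apply_apply, map_smul] at this
          rw [IsEigen, g.linear.apply_symm_apply, this]
        obtain ⟨y, hy, hyx⟩ := ih h3
        exact ⟨y, hy, by rw [pow_succ', LinearEquiv.mul_apply, hyx,
          g.linear.apply_symm_apply]⟩
    obtain ⟨y, hy, rfl⟩ := hs j hx
    exact ⟨y, hy, by rw [← hi']; exact hx'⟩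
  · rw [← hi']
    exact he' e' h _ (hx.pow j)

theorem IsGenericStart.eventually_isRegularPoint [Finite ι] {g : E ≃ᵃ[ℝ] E}
    (hg : g ∈ arrangementAut P) (hγ : ∀ v w, inner ℝ (g.linear v) (g.linear w) = inner ℝ v w)
    {B : SpectralBasis g.linear} {o z : E} (hz : IsGenericStart P B o z) :
    ∀ᶠ t in atTop, IsRegularPoint P (o + B.flow t z) := by
  rw [show (fun t => IsRegularPoint P (o + B.flow t z)) =
    fun t => ∀ i, ∀ k : ℤ, P.root' i (o + B.flow t z) ≠ k from rfl]
  have h0 : ∀ (r : ℝ) (k : ℤ), r ∈ Set.Ioo (k : ℝ) (k + 1) → ∀ m : ℤ, r ≠ m := by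
    rintro r k ⟨h1, h2⟩ m rfl
    have h3 : k < m := by exact_mod_cast h1
    have h4 : m < k + 1 := by exact_mod_cast h2
    omega
  rw [eventually_all]
  intro i
  by_cases hi : (∀ x, g.linear x = x → P.root' i x = 0) ∧ ∃ k : ℤ, P.root' i o = k
  · obtain ⟨hi, k, hk⟩ := hi
    obtain ⟨e, he, he'⟩ := B.exists_leading hγ (root'_ne_zero (P := P) i)
    filter_upwards [hz.eventually_sign hg hγ hi he he'] with t ht
    have h1 := (ht 0).1
    have h2 := left_ne_zero_of_mul (ht 0).2.ne'
    rw [pow_zero, LinearEquiv.coe_one, id] at h1 h2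
    rw [abs_lt] at h1
    rw [map_add, hk]
    rcases lt_or_gt_of_ne h2 with h2 | h2
    · refine h0 _ (k - 1) ⟨?_, ?_⟩ <;> push_cast <;> linarith
    · refine h0 _ k ⟨?_, ?_⟩ <;> linarith
  · obtain ⟨k, hk⟩ := hz.eventually_mem_Ioo hγ hi
    filter_upwards [hk] with t ht
    rw [map_add]
    exact h0 _ k (ht 0)

/-- The rate at which the iterates of a generic point cross the hyperplanes of a given
direction. -/
theorem exists_crossing_rate [Finite ι] {g : E ≃ᵃ[ℝ] E} (hg : g ∈ arrangementAut P)
    (hγ : ∀ v w, inner ℝ (g.linear v) (g.linear w) = inner ℝ v w) (B : SpectralBasis g.linear)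
    {o ν : E} (ho : g o = o + ν) (hν : g.linear ν = ν) (i : ι) :
    ∃ ρ : ℝ, ∀ z, IsGenericStart P B o z → ∀ᶠ t in atTop, ∃ C : ℝ, ∀ n : ℕ,
      |((∑ j ∈ Finset.range n, (⌊P.root' i ((g ^ j) (o + B.flow t z))⌋ -
        ⌊P.root' i ((g ^ (j + 1)) (o + B.flow t z))⌋).natAbs : ℕ) : ℝ) - n * ρ| ≤ C := by
  have hform : ∀ (j : ℕ) (x : E), P.root' i ((g ^ j) (o + x)) =
      P.root' i o + j * P.root' i ν + P.root' i ((g.linear ^ j) x) := fun j x => by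
    rw [pow_apply_axis ho hν, map_add, map_add, map_smul, smul_eq_mul]
  -- Three regimes. With a drift along the axis the rate is `|α(ν)|`. Without drift the orbit stays
  -- between two levels and the rate is `0`, unless the fixed space lies on a hyperplane: then the
  -- orbit oscillates about it, and the rate is the angle of the leading eigenspace over `π`.
  by_cases hν0 : P.root' i ν = 0
  · simp only [hform, hν0, mul_zero, add_zero]
    by_cases hi : (∀ x, g.linear x = x → P.root' i x = 0) ∧ ∃ k : ℤ, P.root' i o = k
    · obtain ⟨hi, k, hk⟩ := hi
      obtain ⟨e, he, he'⟩ := B.exists_leading hγ (root'_ne_zero (P := P) i)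
      refine ⟨Real.arccos ((2 - e) / 2) / Real.pi, fun z hz => ?_⟩
      filter_upwards [hz.eventually_sign hg hγ hi he he'] with t ht
      have hfloor : ∀ j : ℕ, ⌊P.root' i o + P.root' i ((g.linear ^ j) (B.flow t z))⌋ =
          k + if 0 < P.root' i ((g.linear ^ j) (B.component e z)) then 0 else -1 := by
        intro j
        obtain ⟨h1, h2⟩ := ht j
        rw [hk, Int.floor_intCast_add]
        rw [abs_lt] at h1
        congr 1
        split_ifs with h3
        · rw [Int.floor_eq_iff]
          have := pos_of_mul_pos_left h2 h3.le
          push_cast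
          constructor <;> linarith
        · rw [Int.floor_eq_iff]
          push_cast
          constructor
          · linarith
          · by_contra! hcon
            nlinarith [not_lt.1 h3]
      obtain ⟨x, hx, hx'⟩ := he
      have hbd := hx.mem_Icc hγ (fun h => hx' (by rw [h, map_zero]))
      have he0 : e ≠ 0 := by
        rintro rfl
        exact hx' (hi x ((isEigen_zero_iff hγ).1 hx))
      have hcomp := B.isEigen_component e z
      obtain ⟨C, hC⟩ := exists_abs_sum_sign_sub_le (μ := 2 - e) (by linarith)
        (by linarith [lt_of_le_of_ne hbd.1 he0.symm])
        (z := fun j => P.root' i ((g.linear ^ j) (B.component e z)))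
        (fun j => by
          have h1 := (hcomp.pow (j + 1))
          rw [IsEigen] at h1
          have e1 : (g.linear ^ (j + 2)) (B.component e z) =
              g.linear ((g.linear ^ (j + 1)) (B.component e z)) := by
            rw [pow_succ' _ (j + 1)]; rfl
          have e2 : (g.linear ^ j) (B.component e z) =
              g.linear.symm ((g.linear ^ (j + 1)) (B.component e z)) := by
            rw [LinearEquiv.eq_symm_apply, pow_succ']; rfl
          rw [e1, e2, ← map_add, h1, map_smul, smul_eq_mul])
        (fun h j => by
          have : e = 4 := by linarith
          subst this
          rw [pow_succ', LinearEquiv.mul_apply, (hcomp.pow j).apply_eq_neg hγ, map_neg])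
        (fun j => right_ne_zero_of_mul (ht j).2.ne') (fun j => rfl)
      refine ⟨C, fun n => ?_⟩
      simp only [hfloor, add_sub_add_left_eq_sub]
      exact hC n
    · refine ⟨0, fun z hz => ?_⟩
      obtain ⟨k, hk⟩ := hz.eventually_mem_Ioo hγ hi
      filter_upwards [hk] with t ht
      have hfloor : ∀ j : ℕ, ⌊P.root' i o + P.root' i ((g.linear ^ j) (B.flow t z))⌋ = k :=
        fun j => Int.floor_eq_iff.2 ⟨(ht j).1.le, (ht j).2⟩
      refine ⟨0, fun n => ?_⟩
      simp only [hfloor]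
      simp
  · refine ⟨|P.root' i ν|, fun z hz => ?_⟩
    -- Late in the flow the linear part almost fixes the point, so the drift dominates and the
    -- sequence of values is monotone.
    have hlim : Tendsto (fun t => g.linear (B.flow t z) - B.flow t z) atTop (𝓝 0) := by
      have h1 := (LinearMap.continuous_of_finiteDimensional g.linear.toLinearMap).tendsto
        (B.component 0 z)
      have h2 := (h1.comp (B.tendsto_flow hγ z)).sub (B.tendsto_flow hγ z)
      rw [LinearEquiv.coe_coe, (isEigen_zero_iff hγ).1 (B.isEigen_component 0 z), sub_self] at h2
      exact h2
    filter_upwards [eventually_abs_lt hγ (P.root' i) hlim (abs_pos.2 hν0)] with t ht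
    obtain ⟨K, hK, hKx⟩ := exists_abs_le_mul_norm (P.root' i)
    set x := B.flow t z
    refine ⟨2 * K * ‖x‖ + 1, ?_⟩
    have hstep : ∀ j : ℕ, P.root' i ((g ^ (j + 1)) (o + x)) - P.root' i ((g ^ j) (o + x)) =
        P.root' i ν + P.root' i ((g.linear ^ j) (g.linear x - x)) := fun j => by
      rw [hform, hform, map_sub, map_sub, pow_succ, LinearEquiv.mul_apply]
      push_cast
      ring
    refine abs_sum_natAbs_floor_sub_le (x := fun j => P.root' i ((g ^ j) (o + x))) ?_ fun n => ?_
    · rcases lt_or_gt_of_ne hν0 with h | h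
      · right
        refine antitone_nat_of_succ_le fun j => ?_
        have h1 := ht j
        rw [abs_of_neg h, abs_lt] at h1
        linarith [hstep j, h1.2]
      · left
        refine monotone_nat_of_le_succ fun j => ?_
        have h1 := ht j
        rw [abs_of_pos h, abs_lt] at h1
        linarith [hstep j, h1.1]
    · have h1 := hKx ((g.linear ^ n) x)
      have h2 := hKx x
      rw [norm_pow_apply_eq hγ] at h1
      rw [hform, hform]
      rw [abs_le] at h1 h2 ⊢
      push_cast
      rw [pow_zero, LinearEquiv.coe_one, id]
      constructor <;> linarith

theorem eq_of_abs_sub_mul_le {a b C : ℝ} (h : ∀ n : ℕ, |n * a - n * b| ≤ C) : a = b := by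
  by_contra hne
  have hpos := abs_pos.2 (sub_ne_zero.2 hne)
  obtain ⟨n, hn⟩ := exists_nat_gt (C / |a - b|)
  rw [div_lt_iff₀ hpos] at hn
  have := h n
  rw [← mul_sub, abs_mul, Nat.abs_cast] at this
  linarith

/-- Along the flow, the displacement of a generic point is eventually equal to a constant that does
not depend on the point. -/
theorem exists_alcoveDist_eventually_eq [Fintype ι] {g : E ≃ᵃ[ℝ] E} (hg : g ∈ arrangementAut P)
    (hγ : ∀ v w, inner ℝ (g.linear v) (g.linear w) = inner ℝ v w) (B : SpectralBasis g.linear)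
    {o ν : E} (ho : g o = o + ν) (hν : g.linear ν = ν) :
    ∃ ρ : ℝ, ∀ z, IsGenericStart P B o z → ∀ᶠ t in atTop, IsRegularPoint P (o + B.flow t z) ∧
      (alcoveDist P (o + B.flow t z) (g (o + B.flow t z)) : ℝ) = ρ := by
  choose ρ hρ using fun i => exists_crossing_rate hg hγ B ho hν i
  refine ⟨∑ i, ρ i, fun z hz => ?_⟩
  have hall : ∀ᶠ t in atTop, ∀ i, ∃ C : ℝ, ∀ n : ℕ,
      |((∑ j ∈ Finset.range n, (⌊P.root' i ((g ^ j) (o + B.flow t z))⌋ -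
        ⌊P.root' i ((g ^ (j + 1)) (o + B.flow t z))⌋).natAbs : ℕ) : ℝ) - n * ρ i| ≤ C := by
    rw [eventually_all]
    exact fun i => hρ i z hz
  filter_upwards [hz.eventually_isRegularPoint hg hγ, hall] with t h1 h2
  refine ⟨h1, ?_⟩
  choose C hC using h2
  set v := o + B.flow t z
  -- All steps of the orbit have the same displacement because `g` preserves it, so the displacement
  -- is the sum of the crossing rates.
  have hsum : ∀ n : ℕ, n * alcoveDist P v (g v) = ∑ i, ∑ j ∈ Finset.range n,
      (⌊P.root' i ((g ^ j) v)⌋ - ⌊P.root' i ((g ^ (j + 1)) v)⌋).natAbs := by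
    intro n
    rw [Finset.sum_comm]
    have : ∀ j, ∑ i, (⌊P.root' i ((g ^ j) v)⌋ - ⌊P.root' i ((g ^ (j + 1)) v)⌋).natAbs =
        alcoveDist P v (g v) := fun j => by
      rw [← alcoveDist_map (pow_mem hg j) v (g v), pow_succ]
      rfl
    simp only [this, Finset.sum_const, Finset.card_range, smul_eq_mul]
  refine eq_of_abs_sub_mul_le (C := ∑ i, C i) fun n => ?_
  rw [← Nat.cast_mul, hsum, Nat.cast_sum, Finset.mul_sum, ← Finset.sum_sub_distrib]
  exact (Finset.abs_sum_le_sum_abs _ _).trans (Finset.sum_le_sum fun i _ => hC i n)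

end Asymptotics

/-! ### Generic starting points of the flow -/

section Generic

open Module

variable {E : Type*} [NormedAddCommGroup E] [NormedSpace ℝ E]

theorem dimH_le_of_subset_range {K : Type*} [NormedAddCommGroup K] [NormedSpace ℝ K]
    [FiniteDimensional ℝ K] {f : K → E} (hf : ContDiff ℝ 1 f) (h : finrank ℝ K + 1 ≤ finrank ℝ E)
    {s : Set E} (hs : s ⊆ Set.range f) : dimH s ≤ (finrank ℝ E - 1 : ℕ) :=
  (dimH_mono hs).trans (hf.dimH_range_le.trans (by exact_mod_cast Nat.le_sub_one_of_lt h))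

theorem dimH_iUnion_le {X : Type*} [EMetricSpace X] {κ : Sort*} [Countable κ] {s : κ → Set X}
    {d : ENNReal} (h : ∀ i, dimH (s i) ≤ d) : dimH (⋃ i, s i) ≤ d := by
  rw [dimH_iUnion]
  exact iSup_le h

theorem dimH_le_of_nonempty_imp {X : Type*} [EMetricSpace X] {s : Set X} {d : ENNReal} (h : s.Nonempty → dimH s ≤ d) :
    dimH s ≤ d := by
  rcases s.eq_empty_or_nonempty with rfl | hs
  · rw [dimH_empty]; exact zero_le
  · exact h hs

theorem dimH_level_le [FiniteDimensional ℝ E] {β : E →ₗ[ℝ] ℝ} (hβ : β ≠ 0) (r : ℝ) :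
    dimH {z | β z = r} ≤ (finrank ℝ E - 1 : ℕ) := by
  refine dimH_le_of_nonempty_imp ?_
  rintro ⟨p, hp⟩
  have hp : β p = r := hp
  refine dimH_le_of_subset_range (f := fun w : LinearMap.ker β => p + w) ?_
    (Module.Dual.finrank_ker_add_one_of_ne_zero (f := β) hβ).le fun z hz => ?_
  · exact contDiff_const.add (LinearMap.ker β).subtypeL.contDiff
  · have hz : β z = r := hz
    exact ⟨⟨z - p, by rw [LinearMap.mem_ker, map_sub, hz, hp, sub_self]⟩, add_sub_cancel _ _⟩

end Generic

section GenericStart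

open Module

variable {ι M E : Type*} [AddCommGroup M] [Module ℝ M] [NormedAddCommGroup E]
  [InnerProductSpace ℝ E] [FiniteDimensional ℝ E] {P : RootPairing ι ℝ M E} [P.IsReduced]

/-- The bad points are reached by flowing backwards from an intersection of codimension at least
two; the time parameter adds only one dimension. -/
theorem dimH_flow_le {γ : E ≃ₗ[ℝ] E} (B : SpectralBasis γ) (o : E) {i j : ι} {k m : ℤ}
    (hne : hyperplane P j m ≠ hyperplane P i k) :
    dimH {z | ∃ t, o + B.flow t z ∈ hyperplane P i k ∧ o + B.flow t z ∈ hyperplane P j m} ≤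
      (finrank ℝ E - 1 : ℕ) := by
  refine dimH_le_of_nonempty_imp ?_
  rintro ⟨z₀, t₀, h1, h2⟩
  set p := o + B.flow t₀ z₀
  have h1 : P.root' i p = k := h1
  have h2 : P.root' j p = m := h2
  set K := LinearMap.ker (P.root' i) ⊓ LinearMap.ker (P.root' j) with hK
  have hlt : K < LinearMap.ker (P.root' i) := by
    refine lt_of_le_of_ne inf_le_left fun h => hne (hyperplane_eq_of_subset fun v hv => ?_)
    have hv : P.root' i v = k := hv
    have h3 : v - p ∈ LinearMap.ker (P.root' i) := by
      rw [LinearMap.mem_ker, map_sub, hv, h1, sub_self]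
    rw [← h, hK] at h3
    have h4 : P.root' j (v - p) = 0 := h3.2
    rw [map_sub, h2] at h4
    exact sub_eq_zero.1 h4
  have hrank := Submodule.finrank_lt_finrank_of_lt hlt
  have hker := Module.Dual.finrank_ker_add_one_of_ne_zero (f := P.root' i) (root'_ne_zero i)
  refine dimH_le_of_subset_range (K := ℝ × K) (f := fun q => B.flow (-q.1) (p - o + q.2)) ?_ ?_ ?_
  · exact B.contDiff_flow contDiff_fst.neg
      (contDiff_const.add (K.subtypeL.contDiff.comp contDiff_snd))
  · rw [finrank_prod, finrank_self]
    omega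
  · rintro z ⟨t, h3, h4⟩
    have h3 : P.root' i (o + B.flow t z) = k := h3
    have h4 : P.root' j (o + B.flow t z) = m := h4
    refine ⟨⟨t, ⟨o + B.flow t z - p, ?_, ?_⟩⟩, ?_⟩
    · rw [SetLike.mem_coe, LinearMap.mem_ker, map_sub, h1, h3, sub_self]
    · rw [SetLike.mem_coe, LinearMap.mem_ker, map_sub, h2, h4, sub_self]
    · simp only
      rw [show p - o + (o + B.flow t z - p) = B.flow t z by abel, B.flow_neg_flow]

variable [Finite ι]

/-- Every alcove contains a point whose flow line is generic and meets at most one hyperplane at a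
time. -/
theorem exists_isGenericStart {γ : E ≃ₗ[ℝ] E}
    (hγ : ∀ v w, inner ℝ (γ v) (γ w) = inner ℝ v w) (B : SpectralBasis γ) (o : E) {p : E}
    (hp : IsRegularPoint P p) :
    ∃ z, IsGenericStart P B o z ∧ SameAlcove P (o + z) p ∧ ∀ t i j (k m : ℤ),
      o + B.flow t z ∈ hyperplane P i k → o + B.flow t z ∈ hyperplane P j m →
      hyperplane P j m = hyperplane P i k := by
  rcases isEmpty_or_nonempty ι with hι | ⟨⟨i₀⟩⟩
  · exact ⟨0, ⟨fun i => hι.elim i, fun i => hι.elim i⟩, fun i => hι.elim i, fun t i => hι.elim i⟩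
  have hpos : 0 < finrank ℝ E := by
    have := Module.Dual.finrank_ker_add_one_of_ne_zero (f := P.root' i₀) (root'_ne_zero i₀)
    omega
  -- The three kinds of bad starting points: a leading coefficient vanishes, the limit lies on a
  -- hyperplane, or the flow line meets two hyperplanes at once. Each set is a countable union of
  -- sets of codimension at least one.
  set A₁ : Set E := ⋃ (i : ι), ⋃ (k : Fin (finrank ℝ E)),
    ⋃ (_ : P.root' i ∘ₗ B.component (B.exponent k) ≠ 0),
      {z | (P.root' i ∘ₗ B.component (B.exponent k)) z = 0} with hA₁
  set A₂ : Set E := ⋃ (i : ι), ⋃ (k : ℤ), ⋃ (_ : P.root' i ∘ₗ B.component 0 ≠ 0),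
      {z | (P.root' i ∘ₗ B.component 0) z = k - P.root' i o} with hA₂
  set A₃ : Set E := ⋃ (i : ι), ⋃ (j : ι), ⋃ (k : ℤ), ⋃ (m : ℤ),
    ⋃ (_ : hyperplane P j m ≠ hyperplane P i k),
      {z | ∃ t, o + B.flow t z ∈ hyperplane P i k ∧ o + B.flow t z ∈ hyperplane P j m} with hA₃
  have hdim : dimH (A₁ ∪ A₂ ∪ A₃) < finrank ℝ E := by
    refine lt_of_le_of_lt (b := ((finrank ℝ E - 1 : ℕ) : ENNReal)) ?_
      (by exact_mod_cast Nat.sub_lt hpos one_pos)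
    rw [dimH_union, dimH_union]
    refine max_le (max_le ?_ ?_) ?_
    · exact dimH_iUnion_le fun i => dimH_iUnion_le fun k => dimH_iUnion_le fun h =>
        dimH_level_le h _
    · exact dimH_iUnion_le fun i => dimH_iUnion_le fun k => dimH_iUnion_le fun h =>
        dimH_level_le h _
    · exact dimH_iUnion_le fun i => dimH_iUnion_le fun j => dimH_iUnion_le fun k =>
        dimH_iUnion_le fun m => dimH_iUnion_le fun h => dimH_flow_le B o h
  have hopen : IsOpen {z : E | ∀ i, P.root' i (o + z) ∈
      Set.Ioo (⌊P.root' i p⌋ : ℝ) (⌊P.root' i p⌋ + 1)} := by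
    simp only [Set.ofPred_forall]
    refine isOpen_iInter_of_finite fun i => isOpen_Ioo.preimage ?_
    exact (LinearMap.continuous_of_finiteDimensional (P.root' i)).comp
      (continuous_const.add continuous_id)
  obtain ⟨z, hz, hbad⟩ := (dense_compl_of_dimH_lt_finrank hdim).inter_open_nonempty _ hopen
    ⟨p - o, fun i => by
      rw [add_sub_cancel]
      exact ⟨hp.floor_lt i, Int.lt_floor_add_one _⟩⟩
  rw [Set.mem_compl_iff, Set.mem_union, Set.mem_union, not_or, not_or] at hbad
  obtain ⟨⟨h1, h2⟩, h3⟩ := hbad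
  simp only [hA₁, hA₂, hA₃, Set.mem_iUnion, not_exists] at h1 h2 h3
  refine ⟨z, ⟨fun i e he x hx => ?_, fun i k hk x hx => ?_⟩, fun i => ?_, fun t i j k m hi hj => ?_⟩
  · by_cases hk : ∃ k, B.exponent k = e
    · obtain ⟨k, rfl⟩ := hk
      have : P.root' i ∘ₗ B.component (B.exponent k) = 0 := by
        by_contra hne
        exact h1 i k hne he
      rw [← B.component_of_isEigen hγ hx]
      exact congrArg (fun f => f x) this
    · push Not at hk
      have : x = 0 := B.ext_inner fun k => by
        rw [B.inner_eq_zero hγ hx (hk k), inner_zero_right]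
      rw [this, map_zero]
  · have : P.root' i ∘ₗ B.component 0 = 0 := by
      by_contra hne
      refine h2 i k hne ?_
      rw [map_add] at hk
      rw [Set.mem_ofPred_eq, LinearMap.comp_apply]
      linarith
    rw [← B.component_of_isEigen hγ ((isEigen_zero_iff hγ).2 hx)]
    exact congrArg (fun f => f x) this
  · exact Int.floor_eq_iff.2 ⟨(hz i).1.le, (hz i).2⟩
  · by_contra hne
    exact h3 i j k m hne ⟨t, hi, hj⟩

end GenericStart

/-! ### Following a curve through the alcoves -/

section Crossing

open Filter Topology

variable {ι M N : Type*} [AddCommGroup M] [Module ℝ M] [AddCommGroup N] [Module ℝ N]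
  {P : RootPairing ι ℝ M N} {a b v : N} {g : N ≃ᵃ[ℝ] N}

/-- The closure of the alcove of a regular point. -/
def closedAlcove (P : RootPairing ι ℝ M N) (a : N) : Set N :=
  {v | ∀ i, (⌊P.root' i a⌋ : ℝ) ≤ P.root' i v ∧ P.root' i v ≤ ⌊P.root' i a⌋ + 1}

theorem closedAlcove_map (hg : g ∈ arrangementAut P) (h : v ∈ closedAlcove P a) :
    g v ∈ closedAlcove P (g a) := by
  obtain ⟨π, k, hg⟩ := hg
  intro i
  rw [hg, hg, Int.floor_add_intCast]
  push_cast
  have := h (π i)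
  constructor <;> linarith [this.1, this.2]

theorem SameAlcove.mem_closedAlcove (h : SameAlcove P v a) : v ∈ closedAlcove P a := fun i => by
  rw [← h i]
  exact ⟨Int.floor_le _, (Int.lt_floor_add_one _).le⟩

theorem IsRegularPoint.sameAlcove_of_mem (hv : IsRegularPoint P v) (h : v ∈ closedAlcove P a) :
    SameAlcove P v a := fun i =>
  Int.floor_eq_iff.2 ⟨(h i).1, lt_of_le_of_ne (h i).2 (by exact_mod_cast hv.ne i _)⟩

theorem mul_nonneg_of_mem_closedAlcove (h : v ∈ closedAlcove P a) (i : ι) (k : ℤ) :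
    0 ≤ (P.root' i a - k) * (P.root' i v - k) := by
  rcases lt_or_ge (P.root' i a) k with h1 | h1
  · have h2 : ⌊P.root' i a⌋ + 1 ≤ k := Int.add_one_le_iff.2 (Int.floor_lt.2 h1)
    have h3 : (⌊P.root' i a⌋ : ℝ) + 1 ≤ k := by exact_mod_cast h2
    exact mul_nonneg_of_nonpos_of_nonpos (by linarith) (by linarith [(h i).2])
  · have h2 : (k : ℝ) ≤ ⌊P.root' i a⌋ := by exact_mod_cast Int.le_floor.2 h1
    exact mul_nonneg (by linarith) (by linarith [(h i).1])

/-- The hyperplane `⟨α_i, v⟩ = k` is the only one that contains `v`. -/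
def IsOnlyHyperplane (P : RootPairing ι ℝ M N) (v : N) (i : ι) (k : ℤ) : Prop :=
  v ∈ hyperplane P i k ∧ ∀ j (m : ℤ), v ∈ hyperplane P j m → hyperplane P j m = hyperplane P i k

theorem IsOnlyHyperplane.isWall (ha : IsRegularPoint P a) (hv : v ∈ closedAlcove P a) {i : ι}
    {k : ℤ} (h : IsOnlyHyperplane P v i k) : IsWall P a i k := by
  refine ⟨v, h.1, fun j m hne => ?_⟩
  rw [mul_comm]
  refine lt_of_le_of_ne (mul_nonneg_of_mem_closedAlcove hv j m)
    (mul_ne_zero (ha.sub_ne_zero j m) fun h0 => hne (h.2 j m (sub_eq_zero.1 h0))).symm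

theorem IsAdjacent.map {i j : ι} {k m : ℤ} (h : IsAdjacent P i k a b) (hg : g ∈ arrangementAut P)
    (hjm : ∀ v, P.root' j (g v) - m = P.root' i v - k) : IsAdjacent P j m (g a) (g b) := by
  refine ⟨by rw [hjm, hjm]; exact h.sep, fun j' m' hne => ?_⟩
  obtain ⟨π, c, hg⟩ := hg
  have e : ∀ v, P.root' j' (g v) - m' = P.root' (π j') v - (m' - c j' : ℤ) := fun v => by
    rw [hg]; push_cast; ring
  rw [e, e]
  refine h.same _ _ fun heq => hne ?_
  ext v
  obtain ⟨v, rfl⟩ := g.surjective v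
  rw [mem_hyperplane_iff_of_sub_eq hjm, mem_hyperplane_iff_of_sub_eq e, heq]

variable [Fintype ι]

/-- A finite sequence of wall crossings none of which increases the displacement by `g`. -/
def Descends (P : RootPairing ι ℝ M N) (g : N ≃ᵃ[ℝ] N) : N → N → Prop :=
  Relation.ReflTransGen fun a b => ∃ i k, IsWall P a i k ∧ b = affineReflection P i k a ∧
    alcoveDist P b (g b) ≤ alcoveDist P a (g a)

theorem Descends.isRegularPoint [P.IsCrystallographic] (ha : IsRegularPoint P a) (h : Descends P g a b) :
    IsRegularPoint P b := by
  induction h with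
  | refl => exact ha
  | tail _ h ih =>
    obtain ⟨i, k, -, rfl, -⟩ := h
    exact ih.map (affineReflection_mem_arrangementAut i k)

theorem Descends.alcoveDist_le (h : Descends P g a b) :
    alcoveDist P b (g b) ≤ alcoveDist P a (g a) := by
  induction h with
  | refl => exact le_rfl
  | tail _ h ih =>
    obtain ⟨i, k, -, -, h⟩ := h
    exact h.trans ih

/-- For each root the integers nearest to its value on either side bound a neighbourhood that works
for all levels at once. -/
theorem eventually_side {v : ℝ → N} {t : ℝ} (hv : ∀ i, ContinuousAt (fun τ => P.root' i (v τ)) t) :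
    ∀ᶠ τ in 𝓝 t, ∀ i (k : ℤ), (P.root' i (v t) < k → P.root' i (v τ) < k) ∧
      ((k : ℝ) < P.root' i (v t) → (k : ℝ) < P.root' i (v τ)) := by
  have h : ∀ᶠ τ in 𝓝 t, ∀ i, P.root' i (v τ) ∈
      Set.Ioo ((⌈P.root' i (v t)⌉ - 1 : ℤ) : ℝ) ((⌊P.root' i (v t)⌋ + 1 : ℤ) : ℝ) := by
    rw [eventually_all]
    refine fun i => (hv i).eventually (Ioo_mem_nhds ?_ ?_)
    · exact Int.lt_ceil.1 (sub_one_lt _)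
    · exact Int.floor_lt.1 (Int.lt_succ _)
  filter_upwards [h] with τ hτ i k
  refine ⟨fun h1 => (hτ i).2.trans_le ?_, fun h1 => lt_of_le_of_lt ?_ (hτ i).1⟩
  · have := Int.floor_lt.2 h1
    exact_mod_cast Int.add_one_le_iff.2 this
  · have := Int.lt_ceil.2 h1
    exact_mod_cast Int.le_sub_one_of_lt this

variable [P.IsReduced]

theorem IsAdjacent.alcoveDist_eq {i : ι} {k : ℤ} (h : IsAdjacent P i k a b)
    (ha : IsRegularPoint P a) (hb : IsRegularPoint P b) (hv : IsRegularPoint P v)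
    (hsep : (P.root' i a - k) * (P.root' i v - k) < 0) :
    alcoveDist P a v = alcoveDist P b v + 2 := by
  rw [← two_mul_ncard_separatingHyperplanes ha hv, ← two_mul_ncard_separatingHyperplanes hb hv,
    h.ncard_eq hb hv hsep]
  ring

theorem IsAdjacent.alcoveDist_eq_two {i : ι} {k : ℤ} (h : IsAdjacent P i k a b)
    (ha : IsRegularPoint P a) (hb : IsRegularPoint P b) : alcoveDist P a b = 2 := by
  rw [h.alcoveDist_eq ha hb hb h.sep, alcoveDist_eq_zero.2 fun _ => rfl]

variable [P.IsRootSystem] [P.IsCrystallographic]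

/-- If crossing a wall at a point `v` increases the displacement, then the displacement field at
`v` points away from the wall. -/
theorem IsOnlyHyperplane.displacement_pos (hg : g ∈ arrangementAut P) (ha : IsRegularPoint P a)
    (hv : v ∈ closedAlcove P a) {i : ι} {k : ℤ} (h : IsOnlyHyperplane P v i k)
    (hlt : alcoveDist P a (g a) < alcoveDist P (affineReflection P i k a)
      (g (affineReflection P i k a))) :
    0 < (P.root' i a - k) * ((P.root' i (g v) - k) + (P.root' i (g⁻¹ v) - k)) := by
  have hr := affineReflection_mem_arrangementAut (P := P) i k
  have hadj := (h.isWall ha hv).isAdjacent ha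
  set a' := affineReflection P i k a with ha'
  have hra := ha.map hr
  obtain ⟨j, m, hjm, hconj⟩ := conj_affineReflection hg i k
  have hgg : ∀ x, g (g⁻¹ x) = x := g.apply_symm_apply
  have hgg' : ∀ x, g⁻¹ (g x) = x := g.symm_apply_apply
  -- If `g` stabilized the wall, it would commute with the reflection, and the crossing would not
  -- change the displacement.
  have hne : hyperplane P j m ≠ hyperplane P i k := by
    intro heq
    have e : g a' = affineReflection P i k (g a) := by
      rw [← affineReflection_eq_of_hyperplane_eq heq, ← hconj]
      change _ = g (affineReflection P i k (g⁻¹ (g a)))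
      rw [hgg']
    rw [e, ha', alcoveDist_map hr] at hlt
    exact lt_irrefl _ hlt
  have hadj' := hadj.map hg hjm
  have hga := ha.map hg
  have hga' := hra.map hg
  -- Otherwise the crossing brings `a` closer to `g a` by two, and passing from `g a` to the
  -- adjacent `g a'` costs at most two.
  have h1 : 0 < (P.root' i a - k) * (P.root' i (g a) - k) := by
    by_contra hcon
    have hsep := lt_of_le_of_ne (not_lt.1 hcon)
      (mul_ne_zero (ha.sub_ne_zero i k) (hga.sub_ne_zero i k))
    have e1 := hadj.alcoveDist_eq ha hra hga hsep
    have e2 := alcoveDist_triangle (P := P) a' (g a) (g a')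
    rw [hadj'.alcoveDist_eq_two hga hga'] at e2
    omega
  have h2 : 0 < (P.root' j (g a) - m) * (P.root' j a - m) := by
    by_contra hcon
    have hsep := lt_of_le_of_ne (not_lt.1 hcon)
      (mul_ne_zero (hga.sub_ne_zero j m) (ha.sub_ne_zero j m))
    have e1 := hadj'.alcoveDist_eq hga hga' ha hsep
    have e2 := alcoveDist_triangle (P := P) (g a') a a'
    rw [hadj.alcoveDist_eq_two ha hra] at e2
    rw [alcoveDist_comm (g a) a] at e1
    rw [alcoveDist_comm (g a') a'] at e2
    omega
  have hinv : P.root' j a - m = P.root' i (g⁻¹ a) - k := by rw [← hjm, hgg]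
  rw [hjm, hinv] at h2
  have hg' := inv_mem hg
  have w1 := mul_nonneg_of_mem_closedAlcove (closedAlcove_map hg hv) i k
  have w2 := mul_nonneg_of_mem_closedAlcove (closedAlcove_map hg' hv) i k
  -- One of the two terms has to be strictly positive. If `g v` were on the wall, `v` would lie on
  -- the preimage of the wall, which by uniqueness is the wall itself.
  have w0 : P.root' i (g v) - k ≠ 0 := by
    intro h0
    obtain ⟨j', m', hjm', -⟩ := conj_affineReflection hg' i k
    have e1 : v ∈ hyperplane P j' m' := by
      have := (mem_hyperplane_iff_of_sub_eq hjm' (g v)).2 (sub_eq_zero.1 h0)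
      rwa [hgg'] at this
    have e2 := h.2 _ _ e1
    apply hne
    ext x
    rw [← hgg x, mem_hyperplane_iff_of_sub_eq hjm, ← e2, mem_hyperplane_iff_of_sub_eq hjm', hgg, e2]
  have s1 : 0 < (P.root' i a - k) * (P.root' i (g v) - k) := by
    rcases mul_pos_iff.1 h1 with ⟨c1, c2⟩ | ⟨c1, c2⟩
    · exact mul_pos c1 (lt_of_le_of_ne (nonneg_of_mul_nonneg_right w1 c2) w0.symm)
    · refine mul_pos_of_neg_of_neg c1 (lt_of_le_of_ne ?_ w0)
      by_contra! hcon
      linarith [mul_neg_of_neg_of_pos c2 hcon]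
  have s2 : 0 ≤ (P.root' i a - k) * (P.root' i (g⁻¹ v) - k) := by
    rcases mul_pos_iff.1 h2 with ⟨c1, c2⟩ | ⟨c1, c2⟩
    · exact mul_nonneg c1.le (nonneg_of_mul_nonneg_right w2 c2)
    · refine mul_nonneg_of_nonpos_of_nonpos c1.le ?_
      by_contra! hcon
      linarith [mul_neg_of_neg_of_pos c2 hcon]
  rw [mul_add]
  linarith

theorem eventually_pos_of_hasDerivAt {f : ℝ → ℝ} {f' t : ℝ} (h : HasDerivAt f f' t) (h0 : f t = 0)
    (hf' : 0 < f') : ∀ᶠ τ in 𝓝[>] t, 0 < f τ := by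
  have h1 := (hasDerivAt_iff_tendsto_slope.1 h).eventually_const_lt hf'
  have h2 : 𝓝[>] t ≤ 𝓝[≠] t := nhdsWithin_mono _ fun x hx => ne_of_gt hx
  filter_upwards [h2 h1, self_mem_nhdsWithin] with τ h3 h4
  rw [slope_def_field, h0, sub_zero] at h3
  exact (div_pos_iff_of_pos_right (sub_pos.2 h4)).1 h3

/-- A curve that moves along the displacement field of `g` and meets at most one hyperplane at a
time can be followed by wall crossings that do not increase the displacement. -/
theorem exists_descends_of_curve (hg : g ∈ arrangementAut P) {v : ℝ → N}
    (hv : ∀ i t, HasDerivAt (fun τ => P.root' i (v τ))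
      (P.root' i (g (v t)) + P.root' i (g⁻¹ (v t)) - 2 * P.root' i (v t)) t)
    (hone : ∀ t i j (k m : ℤ), v t ∈ hyperplane P i k → v t ∈ hyperplane P j m →
      hyperplane P j m = hyperplane P i k)
    (ha : IsRegularPoint P a) (hv0 : v 0 ∈ closedAlcove P a) {T : ℝ} (hT : 0 ≤ T) :
    ∃ b, Descends P g a b ∧ v T ∈ closedAlcove P b := by
  set s : Set ℝ := {t | ∃ b, Descends P g a b ∧ v t ∈ closedAlcove P b} with hs
  have hcont : ∀ t i, ContinuousAt (fun τ => P.root' i (v τ)) t := fun t i => (hv i t).continuousAt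
  have hclosed : IsClosed s := by
    refine isClosed_of_closure_subset fun t ht => ?_
    obtain ⟨τ, ⟨b, hb, hτ⟩, hside⟩ :=
      ((mem_closure_iff_frequently.1 ht).and_eventually (eventually_side (hcont t))).exists
    refine ⟨b, hb, fun i => ⟨?_, ?_⟩⟩
    · by_contra! hcon
      exact absurd ((hside i _).1 hcon) (not_lt.2 (hτ i).1)
    · by_contra! hcon
      refine absurd ((hside i (⌊P.root' i b⌋ + 1)).2 ?_) (not_lt.2 ?_)
      · push_cast; exact hcon
      · push_cast; exact (hτ i).2
  -- Continuous induction on `[0, T]`: the set of good times is closed, and it extends to the right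
  -- of each of its points.
  refine (hclosed.inter isClosed_Icc).Icc_subset_of_forall_exists_gt (a := 0) (b := T)
    ⟨a, Relation.ReflTransGen.refl, hv0⟩ ?_ ⟨hT, le_rfl⟩
  rintro t ⟨⟨b, hb, hbt⟩, -⟩ y hy
  suffices h : ∀ᶠ τ in 𝓝[>] t, τ ∈ s by
    exact (h.and (Ioc_mem_nhdsGT hy)).exists
  have hbr := hb.isRegularPoint ha
  have hside := (eventually_side (hcont t)).filter_mono (nhdsWithin_le_nhds (s := Set.Ioi t))
  by_cases hreg : ∃ i k, v t ∈ hyperplane P i k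
  · obtain ⟨i, k, hik⟩ := hreg
    have honly : IsOnlyHyperplane P (v t) i k := ⟨hik, fun j m h => hone t i j k m hik h⟩
    have hr := affineReflection_mem_arrangementAut (P := P) i k
    have hwall := honly.isWall hbr hbt
    -- Just after `t` the hyperplane through `v t` is the only one that can be crossed, so its side
    -- alone decides.
    have key : ∀ c, IsRegularPoint P c → v t ∈ closedAlcove P c → ∀ᶠ τ in 𝓝[>] t,
        0 ≤ (P.root' i c - k) * (P.root' i (v τ) - k) → v τ ∈ closedAlcove P c := by
      intro c hc hct
      filter_upwards [hside] with τ hτ hpos j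
      constructor
      · rcases (hct j).1.eq_or_lt with h | h
        · have e := honly.2 j ⌊P.root' j c⌋ h.symm
          rw [← mul_sub_eq_of_hyperplane_eq e] at hpos
          linarith [nonneg_of_mul_nonneg_right hpos (sub_pos.2 (hc.floor_lt j))]
        · exact ((hτ j _).2 h).le
      · rcases (hct j).2.eq_or_lt with h | h
        · have e := honly.2 j (⌊P.root' j c⌋ + 1)
            (by rw [hyperplane, Set.mem_ofPred_eq, h]; push_cast; rfl)
          rw [← mul_sub_eq_of_hyperplane_eq e] at hpos
          push_cast at hpos
          by_contra! hcon
          have := mul_neg_of_neg_of_pos (sub_neg.2 (Int.lt_floor_add_one (P.root' j c)))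
            (sub_pos.2 hcon)
          linarith
        · have := (hτ j (⌊P.root' j c⌋ + 1)).1 (by push_cast; exact h)
          push_cast at this
          exact this.le
    set b' := affineReflection P i k b with hb'
    -- If the crossing is allowed, the curve may go to either side. If not, the displacement field
    -- drives it back to the side of `b`.
    by_cases hle : alcoveDist P b' (g b') ≤ alcoveDist P b (g b)
    · have hbt' : v t ∈ closedAlcove P b' := by
        have := closedAlcove_map hr hbt
        rwa [affineReflection_eq_self_iff.2 hik] at this
      filter_upwards [key b hbr hbt, key b' (hbr.map hr) hbt'] with τ h1 h2
      by_cases hpos : 0 ≤ (P.root' i b - k) * (P.root' i (v τ) - k)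
      · exact ⟨b, hb, h1 hpos⟩
      · refine ⟨b', hb.tail ⟨i, k, hwall, rfl, hle⟩, h2 ?_⟩
        rw [hb', root'_affineReflection_self]
        linarith
    · have hpos := honly.displacement_pos hg hbr hbt (not_le.1 hle)
      have hd := (((hv i t).sub_const (k : ℝ)).const_mul (P.root' i b - k))
      have hik' : P.root' i (v t) = k := hik
      have h3 := eventually_pos_of_hasDerivAt hd (by rw [hik', sub_self, mul_zero]) (by
        rw [hik']
        convert hpos using 2
        ring)
      filter_upwards [key b hbr hbt, h3] with τ h1 h2
      exact ⟨b, hb, h1 h2.le⟩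
  · push Not at hreg
    filter_upwards [hside] with τ hτ
    refine ⟨b, hb, fun i => ⟨?_, ?_⟩⟩
    · exact ((hτ i _).2 (lt_of_le_of_ne (hbt i).1 fun h => hreg i _ h.symm)).le
    · have := (hτ i (⌊P.root' i b⌋ + 1)).1 (by
        push_cast
        refine lt_of_le_of_ne (hbt i).2 fun h => hreg i (⌊P.root' i b⌋ + 1) ?_
        rw [hyperplane, Set.mem_ofPred_eq, h]
        push_cast
        rfl)
      push_cast at this
      exact this.le

end Crossing

/-! ### Wall crossings to an alcove of minimal displacement -/

section MinimalDisplacement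

open Filter Topology

variable {ι M N : Type*} [Fintype ι] [AddCommGroup M] [Module ℝ M]

/-- A generic flow line from the alcove of `a` is followed to a late time. Its end is regular, so it
determines the alcove reached by the crossings. -/
theorem exists_descends_alcoveDist_eq_of_inner [NormedAddCommGroup N] [InnerProductSpace ℝ N]
    [FiniteDimensional ℝ N] {P : RootPairing ι ℝ M N} [P.IsReduced] [P.IsRootSystem]
    [P.IsCrystallographic] {g : N ≃ᵃ[ℝ] N} (hg : g ∈ arrangementAut P)
    (hγ : ∀ v w, inner ℝ (g.linear v) (g.linear w) = inner ℝ v w) :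
    ∃ ρ : ℝ, ∀ a, IsRegularPoint P a → ∃ b, Descends P g a b ∧ (alcoveDist P b (g b) : ℝ) = ρ := by
  obtain ⟨B⟩ := nonempty_spectralBasis hγ
  obtain ⟨o, ν, ho, hν⟩ := exists_axis hγ
  obtain ⟨ρ, hρ⟩ := exists_alcoveDist_eventually_eq hg hγ B ho hν
  refine ⟨ρ, fun a ha => ?_⟩
  obtain ⟨z, hz, hsame, hone⟩ := exists_isGenericStart hγ B o ha
  obtain ⟨T, ⟨hreg, hdist⟩, hT⟩ := ((hρ z hz).and (eventually_ge_atTop 0)).exists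
  -- The vector `ν` cancels in `g v + g⁻¹ v - 2 v`, so the flow of the linear part moves along the
  -- displacement field of `g`.
  have hinv : ∀ x, g⁻¹ (o + x) = o - ν + g.linear.symm x := fun x => by
    change g.symm (o + x) = _
    rw [AffineEquiv.symm_apply_eq, show o - ν + g.linear.symm x = (g.linear.symm x - ν) + o by abel,
      affineEquiv_add, map_sub, g.linear.apply_symm_apply, hν, ho]
    abel
  obtain ⟨b, hb, hmem⟩ := exists_descends_of_curve (v := fun t => o + B.flow t z) hg
    (fun i t => by
      have h1 := (B.hasDerivAt_flow z t).const_add o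
      have h2 := (LinearMap.toContinuousLinearMap (P.root' i)).hasFDerivAt.comp_hasDerivAt t h1
      refine h2.congr_deriv ?_
      rw [hinv, add_comm o, affineEquiv_add, ho]
      simp only [LinearMap.coe_toContinuousLinearMap', map_add, map_sub, map_smul, smul_eq_mul]
      ring) hone ha
    (by
      simp only [B.flow_zero]
      exact hsame.mem_closedAlcove) hT
  refine ⟨b, hb, ?_⟩
  have hs := hreg.sameAlcove_of_mem hmem
  rw [← hdist, alcoveDist_congr hs (hs.map hg)]

variable [AddCommGroup N] [Module ℝ N] {P : RootPairing ι ℝ M N} [P.IsReduced] [P.IsRootSystem]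
  [P.IsCrystallographic]

/-- The coroot form is an inner product for which every automorphism of the arrangement is an
isometry. -/
theorem exists_descends_alcoveDist_eq {g : N ≃ᵃ[ℝ] N} (hg : g ∈ arrangementAut P) :
    ∃ ρ : ℝ, ∀ a, IsRegularPoint P a → ∃ b, Descends P g a b ∧ (alcoveDist P b (g b) : ℝ) = ρ := by
  obtain ⟨b⟩ := P.nonempty_base
  have : FiniteDimensional ℝ N := b.toCoweightBasis.finiteDimensional_of_finite
  let core : InnerProductSpace.Core ℝ N :=
    { inner := fun v w => P.CorootForm v w
      conj_inner_symm := fun v w => by simp only [P.corootForm_apply_apply, mul_comm]; rfl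
      re_inner_nonneg := fun v => by
        rw [P.corootForm_apply_apply]
        exact Finset.sum_nonneg fun i _ => mul_self_nonneg _
      add_left := fun u v w => by simp
      smul_left := fun u v r => by simp
      definite := fun v hv => corootForm_pos_iff (P := P) hv }
  let _ : NormedAddCommGroup N := core.toNormedAddCommGroup
  let _ : InnerProductSpace ℝ N := InnerProductSpace.ofCore core.toCore
  exact exists_descends_alcoveDist_eq_of_inner hg fun v w => corootForm_linear hg v w

/-- From every alcove one reaches an alcove of minimal displacement by wall crossings that do not
increase the displacement. -/
theorem exists_descends_minimal {g : N ≃ᵃ[ℝ] N} (hg : g ∈ arrangementAut P) {a : N}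
    (ha : IsRegularPoint P a) :
    ∃ b, Descends P g a b ∧ ∀ c, IsRegularPoint P c → alcoveDist P b (g b) ≤ alcoveDist P c (g c) := by
  obtain ⟨ρ, hρ⟩ := exists_descends_alcoveDist_eq hg
  obtain ⟨b, hb, hbρ⟩ := hρ a ha
  refine ⟨b, hb, fun c hc => ?_⟩
  obtain ⟨c', hc', hcρ⟩ := hρ c hc
  -- Every alcove `c` descends to the same value, so this value is a lower bound.
  have h : alcoveDist P b (g b) = alcoveDist P c' (g c') := by
    exact_mod_cast hbρ.trans hcρ.symm
  exact h ▸ hc'.alcoveDist_le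

end MinimalDisplacement

/-! ### Iwahori–Weyl groups -/

section Extended

variable {ι M N Ω : Type*} [AddCommGroup M] [Module ℝ M] [AddCommGroup N] [Module ℝ N]
  {P : RootPairing ι ℝ M N} {x₀ : N} [Group Ω] {φ : Ω →* MulAut (affineWeylGroup P)}

theorem map_mem_affineSimpleReflections_iff
    (hφ : ∀ τ : Ω, ∀ s ∈ affineSimpleReflections P x₀, φ τ s ∈ affineSimpleReflections P x₀)
    (τ : Ω) (s : affineWeylGroup P) :
    φ τ s ∈ affineSimpleReflections P x₀ ↔ s ∈ affineSimpleReflections P x₀ := by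
  refine ⟨fun h => ?_, hφ τ s⟩
  have := hφ τ⁻¹ _ h
  rwa [map_inv, MulAut.inv_apply_self] at this

variable [P.IsCrystallographic] [P.IsReduced]

/-- The length of a twisted conjugate is a displacement. -/
theorem two_mul_affineLength_twisted_conj [Fintype ι] (hx : IsRegularPoint P x₀)
    {δ : MulAut (affineWeylGroup P)} {d : N ≃ᵃ[ℝ] N}
    (hd : ∀ w v, (δ w : N ≃ᵃ[ℝ] N) (d v) = d ((w : N ≃ᵃ[ℝ] N) v)) (hd₀ : SameAlcove P (d x₀) x₀)
    (u y : affineWeylGroup P) :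
    2 * affineLength P x₀ (y * u * (δ y)⁻¹) =
      alcoveDist P (((y⁻¹ : affineWeylGroup P) : N ≃ᵃ[ℝ] N) x₀)
        (((u : N ≃ᵃ[ℝ] N) * d) (((y⁻¹ : affineWeylGroup P) : N ≃ᵃ[ℝ] N) x₀)) := by
  rw [affineLength, two_mul_ncard_separatingHyperplanes hx (hx.smul _),
    alcoveDist_congr (fun _ => rfl) (hd₀.symm.map (coe_mem_arrangementAut _)), coe_mul_apply,
    ← map_inv, hd, coe_mul_apply, ← alcoveDist_map (coe_mem_arrangementAut y⁻¹), ← coe_mul_apply,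
    inv_mul_cancel, coe_one_apply]
  rfl

variable [Finite ι] [P.IsRootSystem]

theorem affineLength_map_eq (hx : IsRegularPoint P x₀)
    (hφ : ∀ τ : Ω, ∀ s ∈ affineSimpleReflections P x₀, φ τ s ∈ affineSimpleReflections P x₀)
    (τ : Ω) (w : affineWeylGroup P) : affineLength P x₀ (φ τ w) = affineLength P x₀ w := by
  refine le_antisymm (affineLength_map hx _ (hφ τ) w) ?_
  have := affineLength_map hx _ (hφ τ⁻¹) (φ τ w)
  rwa [map_inv, MulAut.inv_apply_self] at this

theorem length_eq_zero_iff (hx : IsRegularPoint P x₀) {w : affineWeylGroup P ⋊[φ] Ω} :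
    length P x₀ φ w = 0 ↔ w.left = 1 :=
  ⟨eq_one_of_affineLength_eq_zero hx, fun h => by rw [length, h, affineLength_one]⟩

theorem mem_lengthZeroSubgroup_iff (hx : IsRegularPoint P x₀) (w : affineWeylGroup P ⋊[φ] Ω) :
    w ∈ lengthZeroSubgroup φ ↔ length P x₀ φ w = 0 := by
  rw [length_eq_zero_iff hx]
  constructor
  · rintro ⟨τ, rfl⟩
    exact SemidirectProduct.left_inr τ
  · intro h
    exact ⟨w.right, SemidirectProduct.ext (by rw [h]; rfl) rfl⟩

theorem isReflectionLength (hx : IsRegularPoint P x₀)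
    (hφ : ∀ τ : Ω, ∀ s ∈ affineSimpleReflections P x₀, φ τ s ∈ affineSimpleReflections P x₀) :
    IsReflectionLength (length P x₀ φ) (simpleReflections P x₀ φ)
      (SemidirectProduct.inl '' affineReflections P) where
  length_one := affineLength_one
  length_inv w := by
    rw [length, SemidirectProduct.inv_left, affineLength_map_eq hx hφ, affineLength_inv hx]
    rfl
  length_mul_of_eq_zero τ w hτ := by
    rw [length_eq_zero_iff hx] at hτ
    rw [length, SemidirectProduct.mul_left, hτ, one_mul, affineLength_map_eq hx hφ]
    rfl
  sq := by
    rintro _ ⟨s, hs, rfl⟩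
    rw [← map_mul, affineSimpleReflections_mul_self hs, map_one]
  simple_mul := by
    rintro _ ⟨s, hs, rfl⟩ w
    have := affineLength_simple_mul hx hs w.left
    simpa only [length, SemidirectProduct.mul_left, SemidirectProduct.left_inl,
      SemidirectProduct.right_inl, map_one, MulAut.one_apply] using this
  exists_descent w hw := by
    obtain ⟨s, hs, h⟩ := exists_descent_affine hx w.left hw
    refine ⟨_, ⟨s, hs, rfl⟩, ?_⟩
    simpa only [length, SemidirectProduct.mul_left, SemidirectProduct.left_inl,
      SemidirectProduct.right_inl, map_one, MulAut.one_apply] using h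
  simple_conj := by
    rintro τ hτ _ ⟨s, hs, rfl⟩
    rw [← mem_lengthZeroSubgroup_iff hx] at hτ
    obtain ⟨τ, rfl⟩ := hτ
    exact ⟨φ τ s, hφ τ s hs, by rw [SemidirectProduct.inl_aut, map_inv]⟩
  simple_subset := by
    rintro _ ⟨s, hs, rfl⟩
    obtain ⟨i, k, -, rfl⟩ := mem_affineSimpleReflections.1 hs
    exact ⟨_, ⟨i, k, rfl⟩, rfl⟩
  inv_mem := by
    rintro _ ⟨_, ⟨i, k, rfl⟩, rfl⟩
    refine ⟨_, ⟨i, k, rfl⟩, ?_⟩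
    rw [← map_inv, inv_eq_of_mul_eq_one_left (affineReflection'_mul_self i k)]
  conj_mem := by
    rintro _ ⟨r, hr, rfl⟩ w
    refine ⟨w.left * φ w.right r * w.left⁻¹, conj_mem_affineReflections
      (map_mem_affineReflections hx (φ w.right) (hφ w.right) hr) _, ?_⟩
    conv_rhs => rw [← SemidirectProduct.inl_left_mul_inr_right w]
    rw [map_mul, map_mul, SemidirectProduct.inl_aut, map_inv, map_inv]
    group
  lift := by
    rintro _ ⟨r, hr, rfl⟩ _ ⟨s, hs, rfl⟩ hne w hw
    rw [← map_mul]
    simp only [length, SemidirectProduct.mul_left, SemidirectProduct.left_inl,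
      SemidirectProduct.right_inl, map_one, MulAut.one_apply] at hw ⊢
    exact affineLength_lift hx hr hs (fun h => hne (by rw [h])) hw

variable {σ : (affineWeylGroup P ⋊[φ] Ω) ≃* (affineWeylGroup P ⋊[φ] Ω)}

theorem apply_inl_eq_inl (hx : IsRegularPoint P x₀)
    (hσ : ∀ w, σ w ∈ simpleReflections P x₀ φ ↔ w ∈ simpleReflections P x₀ φ)
    (w : affineWeylGroup P) :
    σ (SemidirectProduct.inl w) = SemidirectProduct.inl (σ (SemidirectProduct.inl w)).left := by
  obtain ⟨l, hl, rfl⟩ := exists_word hx w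
  suffices h : ∃ w', σ (SemidirectProduct.inl l.prod) = SemidirectProduct.inl w' by
    obtain ⟨w', h⟩ := h
    rw [h, SemidirectProduct.left_inl]
  induction l with
  | nil => exact ⟨1, by rw [List.prod_nil, map_one, map_one]⟩
  | cons s l ih =>
    obtain ⟨w', h⟩ := ih fun s hs => hl s (List.mem_cons_of_mem _ hs)
    obtain ⟨s', -, hs'⟩ := (hσ _).2 ⟨s, hl s List.mem_cons_self, rfl⟩
    exact ⟨s' * w', by rw [List.prod_cons, map_mul, map_mul, h, ← hs', map_mul]⟩

/-- The restriction to the affine Weyl group of an automorphism of the Iwahori–Weyl group. -/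
theorem exists_restriction (hx : IsRegularPoint P x₀)
    (hσ : ∀ w, σ w ∈ simpleReflections P x₀ φ ↔ w ∈ simpleReflections P x₀ φ) :
    ∃ σ₀ : MulAut (affineWeylGroup P), ∀ w,
      σ (SemidirectProduct.inl w) = SemidirectProduct.inl (σ₀ w) := by
  have h1 := apply_inl_eq_inl hx hσ
  have h2 := apply_inl_eq_inl (σ := σ.symm) hx fun w => by
    rw [← hσ, MulEquiv.apply_symm_apply]
  refine ⟨⟨⟨fun w => (σ (SemidirectProduct.inl w)).left,
    fun w => (σ.symm (SemidirectProduct.inl w)).left, fun w => ?_, fun w => ?_⟩,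
    fun v w => ?_⟩, h1⟩
  · beta_reduce
    rw [← h1, σ.symm_apply_apply, SemidirectProduct.left_inl]
  · beta_reduce
    rw [← h2, σ.apply_symm_apply, SemidirectProduct.left_inl]
  · apply SemidirectProduct.inl_injective (φ := φ)
    change SemidirectProduct.inl (σ (SemidirectProduct.inl (v * w))).left =
      SemidirectProduct.inl ((σ (SemidirectProduct.inl v)).left *
        (σ (SemidirectProduct.inl w)).left)
    rw [map_mul SemidirectProduct.inl ((σ (SemidirectProduct.inl v)).left), ← h1, ← h1, ← h1,
      map_mul, map_mul]

/-- Every element can be brought to minimal length by length-nonincreasing cyclic shifts. -/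
theorem exists_arrow_isMinLength (hx : IsRegularPoint P x₀)
    (hφ : ∀ τ : Ω, ∀ s ∈ affineSimpleReflections P x₀, φ τ s ∈ affineSimpleReflections P x₀)
    (hσ : IsCompatible (length P x₀ φ) (simpleReflections P x₀ φ) σ)
    (w : affineWeylGroup P ⋊[φ] Ω) :
    ∃ w', Arrow (length P x₀ φ) (simpleReflections P x₀ φ) σ w w' ∧
      IsMinLength (length P x₀ φ) σ w' := by
  have := Fintype.ofFinite ι
  obtain ⟨σ₀, hσ₀⟩ := exists_restriction hx hσ.mem_iff
  set u := w.left with hu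
  set τ := w.right with hτ
  have hw : w = SemidirectProduct.inl u * SemidirectProduct.inr τ :=
    (SemidirectProduct.inl_left_mul_inr_right w).symm
  -- On the affine part, `σ`-conjugation of `w = u τ` by `y` becomes `δ`-conjugation of `u`.
  set δ : MulAut (affineWeylGroup P) := φ τ * σ₀ with hδ
  have hδS : ∀ s, δ s ∈ affineSimpleReflections P x₀ ↔ s ∈ affineSimpleReflections P x₀ := by
    intro s
    rw [hδ, MulAut.mul_apply, map_mem_affineSimpleReflections_iff hφ,
      ← SemidirectProduct.inl_injective.mem_set_image (f := SemidirectProduct.inl (φ := φ)),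
      ← hσ₀]
    exact (hσ.mem_iff _).trans SemidirectProduct.inl_injective.mem_set_image
  obtain ⟨d, hda, hd, hd₀⟩ := exists_realization hx δ hδS
  set g : N ≃ᵃ[ℝ] N := (u : N ≃ᵃ[ℝ] N) * d with hg
  have hga : g ∈ arrangementAut P := mul_mem (coe_mem_arrangementAut u) hda
  set c : affineWeylGroup P → affineWeylGroup P ⋊[φ] Ω := fun y =>
    SemidirectProduct.inl y * w * (σ (SemidirectProduct.inl y))⁻¹ with hc
  have hcl : ∀ y, (c y).left = y * u * (δ y)⁻¹ := by
    intro y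
    have : c y = SemidirectProduct.inl (y * u * (δ y)⁻¹) * SemidirectProduct.inr τ := by
      simp only [hc]
      rw [hw, hσ₀, hδ, MulAut.mul_apply, map_mul, map_mul, map_inv, SemidirectProduct.inl_aut,
        map_inv]
      group
    rw [this, SemidirectProduct.mul_left, SemidirectProduct.left_inl, SemidirectProduct.left_inr,
      map_one, mul_one]
  have hlen : ∀ y, 2 * length P x₀ φ (c y) =
      alcoveDist P (((y⁻¹ : affineWeylGroup P) : N ≃ᵃ[ℝ] N) x₀)
        (g (((y⁻¹ : affineWeylGroup P) : N ≃ᵃ[ℝ] N) x₀)) := fun y => by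
    rw [length, hcl, two_mul_affineLength_twisted_conj hx hd hd₀]
  -- Crossing a wall of the alcove of `y⁻¹ x₀` replaces `y` by `s y`, where `s` is the reflection in
  -- the image of that wall under `y`, a wall of the base alcove; on conjugates this is a shift by
  -- `s`.
  have hreach : ∀ b, Descends P g x₀ b → ∃ y : affineWeylGroup P,
      b = ((y⁻¹ : affineWeylGroup P) : N ≃ᵃ[ℝ] N) x₀ ∧
      Arrow (length P x₀ φ) (simpleReflections P x₀ φ) σ w (c y) := by
    intro b hb
    induction hb with
    | refl =>
      refine ⟨1, by rw [inv_one, coe_one_apply], ?_⟩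
      simp only [hc]
      rw [map_one, map_one, one_mul, inv_one, mul_one]
      exact Relation.ReflTransGen.refl
    | tail _ h ih =>
      obtain ⟨y, rfl, hy⟩ := ih
      obtain ⟨i, k, hwall, rfl, hle⟩ := h
      obtain ⟨j, m, h1, h2⟩ := conj_affineReflection' y i k
      have hwall' : IsWall P x₀ j m := by
        have := hwall.map (coe_mem_arrangementAut y) h1
        rwa [← coe_mul_apply, mul_inv_cancel, coe_one_apply] at this
      have hs : affineReflection' P j m ∈ affineSimpleReflections P x₀ := ⟨j, m, hwall', rfl⟩
      have e : ((((affineReflection' P j m) * y)⁻¹ : affineWeylGroup P) : N ≃ᵃ[ℝ] N) x₀ =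
          affineReflection P i k (((y⁻¹ : affineWeylGroup P) : N ≃ᵃ[ℝ] N) x₀) := by
        rw [← h2, inv_mul_cancel_right, mul_inv_rev,
          inv_eq_of_mul_eq_one_left (affineReflection'_mul_self i k)]
        rfl
      refine ⟨affineReflection' P j m * y, e.symm,
        hy.tail ⟨SemidirectProduct.inl (affineReflection' P j m), ⟨_, hs, rfl⟩, ?_, ?_⟩⟩
      · have hinv : (σ (SemidirectProduct.inl (affineReflection' P j m)))⁻¹ =
            σ (SemidirectProduct.inl (affineReflection' P j m)) := by
          rw [← map_inv, ← map_inv,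
            inv_eq_of_mul_eq_one_left (affineReflection'_mul_self j m)]
        simp only [hc]
        rw [map_mul, map_mul, mul_inv_rev, hinv]
        simp only [mul_assoc]
      · have l1 := hlen y
        have l2 := hlen (affineReflection' P j m * y)
        rw [e] at l2
        omega
  obtain ⟨b, hb, hmin⟩ := exists_descends_minimal hga hx
  obtain ⟨y, rfl, hy⟩ := hreach b hb
  refine ⟨c y, hy, fun x => ?_⟩
  have hRL := isReflectionLength hx hφ
  -- A general conjugator is a length-zero element times an element of the affine Weyl group. The
  -- first factor does not affect the length, and the second one is covered by the minimality over
  -- all alcoves.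
  have hx' : x = SemidirectProduct.inr x.right *
      SemidirectProduct.inl (φ x.right⁻¹ x.left) := by
    conv_lhs => rw [← SemidirectProduct.inl_left_mul_inr_right x]
    rw [SemidirectProduct.inl_aut, map_inv]
    simp only [inv_inv]
    group
  set a := φ x.right⁻¹ x.left
  have hzero : length P x₀ φ (SemidirectProduct.inr x.right) = 0 :=
    (mem_lengthZeroSubgroup_iff hx _).1 ⟨_, rfl⟩
  have e1 : x * c y * (σ x)⁻¹ =
      SemidirectProduct.inr x.right * c (a * y) * (σ (SemidirectProduct.inr x.right))⁻¹ := by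
    conv_lhs => rw [hx']
    simp only [hc, map_mul, mul_inv_rev, mul_assoc]
  rw [e1, hRL.length_conj_of_eq_zero hzero (c (a * y)) ((hσ.length_eq _).trans hzero)]
  have l1 := hlen y
  have l2 := hlen (a * y)
  have l3 := hmin _ (hx.smul (a * y)⁻¹)
  omega

end Extended

end IwahoriWeyl

theorem proposition2p5 {ι M N Ω : Type*} [Finite ι]
    [AddCommGroup M] [Module ℝ M] [AddCommGroup N] [Module ℝ N]
    (P : RootPairing ι ℝ M N) [P.IsRootSystem] [P.IsCrystallographic] [P.IsReduced]
    (x₀ : N) (_hx₀ : IwahoriWeyl.IsRegularPoint P x₀)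
    [Group Ω] (φ : Ω →* MulAut (IwahoriWeyl.affineWeylGroup P))
    (_hφ : ∀ τ : Ω, ∀ s ∈ IwahoriWeyl.affineSimpleReflections P x₀,
      φ τ s ∈ IwahoriWeyl.affineSimpleReflections P x₀)
    (σ : (IwahoriWeyl.affineWeylGroup P ⋊[φ] Ω) ≃* (IwahoriWeyl.affineWeylGroup P ⋊[φ] Ω))
    (hσ : IwahoriWeyl.IsCompatible (IwahoriWeyl.length P x₀ φ)
      (IwahoriWeyl.simpleReflections P x₀ φ) σ) :
    ∃ b : Module.Basis
        (IwahoriWeyl.MinClass (IwahoriWeyl.length P x₀ φ) (IwahoriWeyl.simpleReflections P x₀ φ)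
          (IwahoriWeyl.lengthZeroSubgroup φ) σ)
        ℂ (IwahoriWeyl.Cocenter hσ),
      (∀ C, ∀ w ∈ C.1, b C = IwahoriWeyl.tBar hσ w) ∧
      ∀ w, ∃! C, IwahoriWeyl.tBar hσ w = b C ∨ IwahoriWeyl.tBar hσ w = -b C :=
  IwahoriWeyl.exists_basis_cocenter hσ (IwahoriWeyl.isReflectionLength _hx₀ _hφ)
    (IwahoriWeyl.mem_lengthZeroSubgroup_iff _hx₀)
    (IwahoriWeyl.exists_arrow_isMinLength _hx₀ _hφ hσ)
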